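/- Let $Q$ be a Hausdorff $d$-dimensional manifold of class $C^{r+1}$, $2\le r\le\infty$, and let $a_t$ (a Riemannian metric on $Q$), $b_t$ (a 1-form on $Q$) and $V(t,q)$ (a function) depend on the time $t\in\mathbb R$ and be of class $C^r$ jointly in $(t,q)\in\mathbb R\times Q$. Let $M=\mathbb R\times Q\times\mathbb R$, with points $(t,q,y)$, carry the Brinkmann metric $$g=a_t-dt\otimes(dy-b_t)-(dy-b_t)\otimes dt-2V\,dt\otimes dt ,$$ and let $H(t,q,p)=\tfrac12 a_t^{-1}(p-b_t,p-b_t)+V(t,q)$. *Rosen coordinates* on an open set $U\subset M$ are a homeomorphism $(t,q,y)\mapsto(t,q',y')$ of $U$ onto an open subset of $\mathbb R\times Q'\times\mathbb R$, where $Q'$ is a $d$-dimensional manifold, which preserves $t$, satisfies $\partial_{y'}=\partial_y$, is at least $C^1$ together with its inverse, and brings $g$ to the form $$g=a'_t-dt\otimes dy'-dy'\otimes dt$$ with $a'_t$ a time-dependent Riemannian metric on $Q'$ (i.e. $a'$ depends on $(t,q')$ only). They are *of class $C^k$* if the map and its inverse are $C^k$ (with $Q'$ of class $C^k$) and $a'$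 is $C^{k-1}$. For an open interval $I$, Rosen coordinates *on $I$* are those with $U=I\times Q\times\mathbb R$ and with image $I\times Q'\times\mathbb R$; they are *global* if $I=\mathbb R$. A function $u$ on $I\times Q$ of class $C^k$, $k\ge1$, is a *solution on $I$* if $\partial_tu+H(t,q,\partial_qu)=0$ there. Its *base characteristics* are the curves $t\mapsto q(t)$ with $\dot q=a_t^{-1}(\cdot,\partial_qu-b_t)$. They are *defined on $I$* (*complete*, if $I=\mathbb R$) if through every point of $I\times Q$ there passes one that is defined on all of $I$, and every base characteristic over an open subinterval of $I$ extends to one over $I$. (1) Every point of $M$ has an open neighbourhood with Rosen coordinates of class $C^{r-1}$ (hence with a $C^{r-2}$ space metric $a'$), taking values in $\mathbb R\times\mathbb R^d\times\mathbb R$, whose coordinate $y'$ is $C^r$. (2) Global case. If $1\le k\le r+1$ and there are global Rosen coordinates of class $C^k$, then there is a global $C^k$ solution of the Hamilton–Jacobi equation whose base characteristics are complete. If $2\le k\le r+1$, there are global Rosen coordinates of class $C^{k-1}$ (with a $C^{k-2}$ space metric) whose coordinate $y'$ is $C^k$ if and only if there is a global $C^k$ solution of the Hamilton–Jacobi equation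 whose base characteristics are complete. (3) Time-local case. Let $t_0\in\mathbb R$. The two assertions of (2) hold with "there are Rosen coordinates on some open interval containing $t_0$" in place of "there are global Rosen coordinates", and "there is a solution on some open interval $I$ containing $t_0$ whose base characteristics are defined on $I$" in place of "there is a global solution whose base characteristics are complete". -/

import Mathlib

open scoped Manifold ContDiff

universe u

noncomputable section

/-- A time dependent symmetric 2-tensor (for instance a metric) on the leaves `{t} × Q`. -/
abbrev TimeBilin (d : ℕ) (Q : Type*) [TopologicalSpace Q]
    [ChartedSpace (EuclideanSpace ℝ (Fin d)) Q] : Type _ :=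
  ℝ → (q : Q) → TangentSpace (𝓡 d) q →L[ℝ] TangentSpace (𝓡 d) q →L[ℝ] ℝ

/-- A time dependent 1-form on the leaves `{t} × Q`. -/
abbrev TimeForm (d : ℕ) (Q : Type*) [TopologicalSpace Q]
    [ChartedSpace (EuclideanSpace ℝ (Fin d)) Q] : Type _ :=
  ℝ → (q : Q) → TangentSpace (𝓡 d) q →L[ℝ] ℝ

/-- `a` is a time dependent Riemannian metric of class `C^m`, defined over the set `S` of events
`(t, q)`. Regularity is joint regularity in `(t, q)`: since `a` is symmetric, its components in
local coordinates are `C^m` exactly when the quadratic function `(t, v) ↦ a_t(v, v)` on `ℝ × TQ`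
is `C^m`. -/
structure IsTimeMetricOn {d : ℕ} {Q : Type*} [TopologicalSpace Q]
    [ChartedSpace (EuclideanSpace ℝ (Fin d)) Q] [IsManifold (𝓡 d) 1 Q]
    (m : ℕ∞) (a : TimeBilin d Q) (S : Set (ℝ × Q)) : Prop where
  symm : ∀ t q, (t, q) ∈ S → ∀ v w, a t q v w = a t q w v
  pos : ∀ t q, (t, q) ∈ S → ∀ v, v ≠ 0 → 0 < a t q v v
  contMDiffOn : ContMDiffOn (𝓘(ℝ, ℝ).prod (𝓡 d).tangent) 𝓘(ℝ, ℝ) (m : WithTop ℕ∞)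
    (fun p : ℝ × TangentBundle (𝓡 d) Q => a p.1 p.2.proj p.2.snd p.2.snd)
    {p | (p.1, p.2.proj) ∈ S}

/-- The data `a_t`, `b_t`, `V`, all of class `C^r` jointly in `(t, q) ∈ ℝ × Q`, which define the
Brinkmann metric on `ℝ × Q × ℝ` and the Lagrangian `a_t(v, v) / 2 + b_t(v) - V`. -/
structure BrinkmannData (d : ℕ) (Q : Type*) [TopologicalSpace Q]
    [ChartedSpace (EuclideanSpace ℝ (Fin d)) Q] [IsManifold (𝓡 d) 1 Q] (r : ℕ∞) where
  a : TimeBilin d Q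
  b : TimeForm d Q
  V : ℝ → Q → ℝ
  isMetric : IsTimeMetricOn r a Set.univ
  contMDiff_b : ContMDiff (𝓘(ℝ, ℝ).prod (𝓡 d).tangent) 𝓘(ℝ, ℝ) (r : WithTop ℕ∞)
    (fun p : ℝ × TangentBundle (𝓡 d) Q => b p.1 p.2.proj p.2.snd)
  contMDiff_V : ContMDiff (𝓘(ℝ, ℝ).prod (𝓡 d)) 𝓘(ℝ, ℝ) (r : WithTop ℕ∞)
    (fun p : ℝ × Q => V p.1 p.2)

/-- The model with corners of the spacetime `ℝ × Q × ℝ`, with points `(t, q, y)`. -/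
abbrev spacetimeModel (d : ℕ) :=
  𝓘(ℝ, ℝ).prod ((𝓡 d).prod 𝓘(ℝ, ℝ))

/-- The Rosen metric `a'_t - dt ⊗ dy' - dy' ⊗ dt` at the point `(t, q', y')`, evaluated on two
tangent vectors of `ℝ × Q' × ℝ`. -/
def rosenMetric {d : ℕ} {Q : Type*} [TopologicalSpace Q]
    [ChartedSpace (EuclideanSpace ℝ (Fin d)) Q] (a : TimeBilin d Q) (x : ℝ × Q × ℝ)
    (X Y : ℝ × TangentSpace (𝓡 d) x.2.1 × ℝ) : ℝ :=
  a x.1 x.2.1 X.2.1 Y.2.1 - X.1 * Y.2.2 - X.2.2 * Y.1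

namespace BrinkmannData

variable {d : ℕ} {Q : Type*} [TopologicalSpace Q]
  [ChartedSpace (EuclideanSpace ℝ (Fin d)) Q] [IsManifold (𝓡 d) 1 Q] {r : ℕ∞}

/-- The Brinkmann metric
`g = a_t - dt ⊗ (dy - b_t) - (dy - b_t) ⊗ dt - 2 V dt ⊗ dt` at the point `(t, q, y)`. -/
def metric (D : BrinkmannData d Q r) (x : ℝ × Q × ℝ)
    (X Y : ℝ × TangentSpace (𝓡 d) x.2.1 × ℝ) : ℝ :=
  D.a x.1 x.2.1 X.2.1 Y.2.1
    - X.1 * (Y.2.2 - D.b x.1 x.2.1 Y.2.1)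
    - (X.2.2 - D.b x.1 x.2.1 X.2.1) * Y.1
    - 2 * D.V x.1 x.2.1 * (X.1 * Y.1)

/-- The vector `a_t⁻¹(·, p)`, that is, the vector `v` with `a_t(v, ·) = p`. -/
def sharp (D : BrinkmannData d Q r) (t : ℝ) (q : Q) (p : TangentSpace (𝓡 d) q →L[ℝ] ℝ) :
    TangentSpace (𝓡 d) q :=
  (D.a t q).inverse p

/-- The Hamiltonian `H(t, q, p) = a_t⁻¹(p - b_t, p - b_t) / 2 + V(t, q)`. -/
def hamiltonian (D : BrinkmannData d Q r) (t : ℝ) (q : Q)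
    (p : TangentSpace (𝓡 d) q →L[ℝ] ℝ) : ℝ :=
  1 / 2 * (p - D.b t q) (D.sharp t q (p - D.b t q)) + D.V t q

/-- The partial differential `∂u/∂q`, a covector on `Q`. -/
def dq (u : ℝ → Q → ℝ) (t : ℝ) (q : Q) : TangentSpace (𝓡 d) q →L[ℝ] ℝ :=
  mfderiv (𝓡 d) 𝓘(ℝ, ℝ) (u t) q

/-- `u` is a classical solution of class `C^k` of the Hamilton-Jacobi equation
`∂u/∂t + H(t, q, ∂u/∂q) = 0` on `I × Q`. -/
structure IsHJSolutionOn (D : BrinkmannData d Q r) (k : ℕ∞) (I : Set ℝ) (u : ℝ → Q → ℝ) :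
    Prop where
  contMDiffOn : ContMDiffOn (𝓘(ℝ, ℝ).prod (𝓡 d)) 𝓘(ℝ, ℝ) (k : WithTop ℕ∞)
    (fun p : ℝ × Q => u p.1 p.2) (I ×ˢ Set.univ)
  equation : ∀ t ∈ I, ∀ q, deriv (fun s => u s q) t + D.hamiltonian t q (dq u t q) = 0

/-- `γ` is, over the open set of times `J`, a base characteristic of `u`: a solution of
`q̇ = ∂H/∂p (t, q, ∂u/∂q) = a_t⁻¹(·, ∂u/∂q - b_t)`. -/
def IsBaseCharacteristicOn (D : BrinkmannData d Q r) (u : ℝ → Q → ℝ) (J : Set ℝ)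
    (γ : ℝ → Q) : Prop :=
  ∀ t ∈ J, HasMFDerivAt 𝓘(ℝ, ℝ) (𝓡 d) γ t
    (ContinuousLinearMap.toSpanSingleton ℝ
      (D.sharp t (γ t) (dq u t (γ t) - D.b t (γ t)) : TangentSpace (𝓡 d) (γ t)))

/-- All base characteristics of `u` are defined on the whole of `I`: through every event of
`I × Q` there passes one that is defined on `I`, and every base characteristic over an open
subinterval of `I` extends to one over `I`. For `I = ℝ` this is completeness. -/
def CharacteristicsDefinedOn (D : BrinkmannData d Q r) (I : Set ℝ) (u : ℝ → Q → ℝ) : Prop :=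
  (∀ t ∈ I, ∀ q, ∃ γ, D.IsBaseCharacteristicOn u I γ ∧ γ t = q) ∧
  (∀ J ⊆ I, IsOpen J → J.OrdConnected → ∀ γ, D.IsBaseCharacteristicOn u J γ →
    ∃ γ', D.IsBaseCharacteristicOn u I γ' ∧ Set.EqOn γ' γ J)

/-- There is a `C^k` solution of the Hamilton-Jacobi equation on `I × Q` whose base
characteristics are all defined on the whole of `I`. -/
def HasHJSolution (D : BrinkmannData d Q r) (k : ℕ∞) (I : Set ℝ) : Prop :=
  ∃ u, D.IsHJSolutionOn k I u ∧ D.CharacteristicsDefinedOn I u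

/-- `Φ : (t, q, y) ↦ (t, q', y')`, from an open subset of the spacetime onto an open subset of
`ℝ × Q' × ℝ`, puts the Brinkmann metric in the Rosen form with space metric `a'`, and
`∂/∂y' = ∂/∂y`. The change of coordinates is `C^k` in both directions, its component `y'` is
moreover `C^l`, and `a'` is `C^(k-1)`. -/
structure IsRosen (D : BrinkmannData d Q r) (k l : ℕ∞) {Q' : Type*} [TopologicalSpace Q']
    [ChartedSpace (EuclideanSpace ℝ (Fin d)) Q'] [IsManifold (𝓡 d) 1 Q']
    (Φ : OpenPartialHomeomorph (ℝ × Q × ℝ) (ℝ × Q' × ℝ)) (a' : TimeBilin d Q') : Prop where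
  contMDiffOn : ContMDiffOn (spacetimeModel d) (spacetimeModel d) (k : WithTop ℕ∞) Φ Φ.source
  contMDiffOn_symm :
    ContMDiffOn (spacetimeModel d) (spacetimeModel d) (k : WithTop ℕ∞) Φ.symm Φ.target
  contMDiffOn_y : ContMDiffOn (spacetimeModel d) 𝓘(ℝ, ℝ) (l : WithTop ℕ∞)
    (fun x => (Φ x).2.2) Φ.source
  time : ∀ x ∈ Φ.source, (Φ x).1 = x.1
  killing : ∀ x ∈ Φ.source,
    mfderiv (spacetimeModel d) (spacetimeModel d) Φ x
      ((0, 0, 1) : ℝ × TangentSpace (𝓡 d) x.2.1 × ℝ) =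
      ((0, 0, 1) : ℝ × TangentSpace (𝓡 d) (Φ x).2.1 × ℝ)
  isMetric : IsTimeMetricOn (k - 1) a' ((fun x' => (x'.1, x'.2.1)) '' Φ.target)
  metric_eq : ∀ x ∈ Φ.source, ∀ X Y : ℝ × TangentSpace (𝓡 d) x.2.1 × ℝ,
    D.metric x X Y = rosenMetric a' (Φ x)
      (mfderiv (spacetimeModel d) (spacetimeModel d) Φ x X)
      (mfderiv (spacetimeModel d) (spacetimeModel d) Φ x Y)

/-- Rosen coordinates on the whole part `I × Q × ℝ` of the spacetime: a `d`-dimensional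
manifold `Q'` and a diffeomorphism of `I × Q × ℝ` onto `I × Q' × ℝ` which puts the metric in
Rosen form. -/
def HasRosen {Q : Type u} [TopologicalSpace Q]
    [ChartedSpace (EuclideanSpace ℝ (Fin d)) Q] [IsManifold (𝓡 d) 1 Q]
    (D : BrinkmannData d Q r) (k l : ℕ∞) (I : Set ℝ) : Prop :=
  ∃ (Q' : Type u) (_ : TopologicalSpace Q') (_ : ChartedSpace (EuclideanSpace ℝ (Fin d)) Q')
    (_ : IsManifold (𝓡 d) 1 Q') (_ : IsManifold (𝓡 d) (k : WithTop ℕ∞) Q')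
    (Φ : OpenPartialHomeomorph (ℝ × Q × ℝ) (ℝ × Q' × ℝ)) (a' : TimeBilin d Q'),
    Φ.source = {x | x.1 ∈ I} ∧ Φ.target = {x | x.1 ∈ I} ∧ D.IsRosen k l Φ a'

end BrinkmannData

/-- `P I` holds for some open interval `I` containing `t₀`. -/
def TimeLocally (t₀ : ℝ) (P : Set ℝ → Prop) : Prop :=
  ∃ I : Set ℝ, IsOpen I ∧ I.OrdConnected ∧ t₀ ∈ I ∧ P I

end

/-! Rosen coordinates amount to a solution of the Hamilton–Jacobi equation together with labels for
its base characteristics.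

From coordinates to solutions: since `t` and `∂/∂y` are preserved and whole `y`-lines lie in the
domain, the change of coordinates is `(t, q, y) ↦ (t, q'(t, q), y - u(t, q))`. Let `N` be `∂/∂t`
taken at constant `(q', y')`. The Rosen form gives `g(N, ·) = -dy'`. In the Brinkmann form, the
components of this identity along `Q` say that `N` projects to `Z = a_t⁻¹(·, ∂u/∂q - b_t)`; its
`t`-component, combined with `dy'(N) = 0`, is twice the Hamilton–Jacobi equation
(`IsRosen.characteristic_and_equation`). So the curves of constant `q'` are the base
characteristics, and they live on all of `I` because the image is `I × Q' × ℝ`.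

From solutions to coordinates: the Hamilton–Jacobi equation is what is needed for `g(X, Y) = a_t(X_q
- X_t Z, Y_q - Y_t Z) - X_t dy'(Y) - dy'(X) Y_t` with `y' = y - u` (`brinkmann_eq_rosen`). If `q'`
is constant along `Z`, then `X_q - X_t Z` depends only on `dq'(X)`, and the first term is a metric
in the variables `(t, q')` (`isRosen_rosenCoordinates`). If the characteristics fill `I`, their
position at a time `t₀` serves as `q'` (`HasHJSolution.hasRosen`). A `C^k` function `u` has a
`C^(k-1)` characteristic field, hence a `C^(k-1)` evolution (`contMDiffAt_evolution`); this is the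
lost derivative, while `y'` remains `C^k`.

Near a point, `u` comes from the method of characteristics with `u = 0` at time `t₀`
(`exists_local_hamiltonJacobi`). The Hamiltonian is `C^r`, its flow is `C^(r-1)`, and `du = p dq - H
dt` is again `C^(r-1)`, so `u` is `C^r`.

All of this rests on `C^n` dependence of flows on initial data, obtained from the implicit function
theorem in the Banach space of continuous curves. -/

/-! ### Smoothness of postcomposition on spaces of continuous functions. -/

section PostcompositionSmooth

open Set Metric

variable {K : Type*} [TopologicalSpace K] [CompactSpace K]
  {F G : Type*} [NormedAddCommGroup F] [NormedSpace ℝ F] [NormedAddCommGroup G] [NormedSpace ℝ G]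

/-- Pointwise application of a continuous family of continuous linear maps. -/
noncomputable def ContinuousMap.pointwiseCLM :
    C(K, F →L[ℝ] G) →L[ℝ] C(K, F) →L[ℝ] C(K, G) :=
  LinearMap.mkContinuous₂
    (LinearMap.mk₂ ℝ
      (fun (A : C(K, F →L[ℝ] G)) (h : C(K, F)) =>
        (⟨fun s => A s (h s), A.continuous.clm_apply h.continuous⟩ : C(K, G)))
      (fun _ _ _ => by ext; simp) (fun _ _ _ => by ext; simp)
      (fun _ _ _ => by ext; simp) (fun _ _ _ => by ext; simp))
    1 (fun A h => by
      rw [ContinuousMap.norm_le _ (by positivity)]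
      intro s
      rw [one_mul]
      exact ((A s).le_opNorm _).trans
        (mul_le_mul (A.norm_coe_le_norm s) (h.norm_coe_le_norm s) (norm_nonneg _) (by positivity)))

/-- Continuity of `γ ↦ f' ∘ γ` for the sup norm bounds the variation of `f'` by `ε` at all
parameters at once; the mean value inequality at each parameter then gives a uniform remainder. -/
lemma ContinuousMap.hasFDerivAt_postcomp {f : C(F, G)} {f' : C(F, F →L[ℝ] G)}
    (hf : ∀ x, HasFDerivAt f (f' x) x) (γ : C(K, F)) :
    HasFDerivAt (fun γ : C(K, F) => f.comp γ) (pointwiseCLM (f'.comp γ)) γ := by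
  rw [hasFDerivAt_iff_isLittleO_nhds_zero, Asymptotics.isLittleO_iff]
  intro ε hε
  have hc : Continuous fun γ : C(K, F) => f'.comp γ := ContinuousMap.continuous_postcomp f'
  obtain ⟨δ, hδ, H⟩ := Metric.mem_nhds_iff.1
    (hc.continuousAt.preimage_mem_nhds (ball_mem_nhds (f'.comp γ) hε))
  filter_upwards [ball_mem_nhds (0 : C(K, F)) hδ] with h hh
  rw [mem_ball_zero_iff] at hh
  rw [ContinuousMap.norm_le _ (by positivity)]
  intro s
  -- Each point of the segment is the value at `s` of a curve `γ + θ • h`, which is as close to `γ`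
  -- as `h` is to zero.
  have key : ∀ y ∈ segment ℝ (γ s) (γ s + h s), ‖f' y - f' (γ s)‖ ≤ ε := by
    intro y hy
    rw [segment_eq_image'] at hy
    obtain ⟨θ, hθ, rfl⟩ := hy
    have h1 : ‖θ • h‖ < δ := by
      rw [norm_smul, Real.norm_of_nonneg hθ.1]
      exact (mul_le_of_le_one_left (norm_nonneg _) hθ.2).trans_lt hh
    have h2 : f'.comp (γ + θ • h) ∈ ball (f'.comp γ) ε := H (by simpa [dist_eq_norm] using h1)
    have h3 := (ContinuousMap.dist_apply_le_dist s).trans (mem_ball.1 h2).le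
    simpa [dist_eq_norm] using h3
  have := (convex_segment (𝕜 := ℝ) (γ s) (γ s + h s)).norm_image_sub_le_of_norm_hasFDerivWithin_le'
    (fun x _ => (hf x).hasFDerivWithinAt) key (left_mem_segment ℝ _ _) (right_mem_segment ℝ _ _)
  rw [add_sub_cancel_left] at this
  exact this.trans (mul_le_mul_of_nonneg_left (h.norm_coe_le_norm s) hε.le)

end PostcompositionSmooth

/-- Induction on the order: the derivative is again a postcomposition, by `f'`, followed by a
bounded linear map. The target changes from `G` to `F →L[ℝ] G`, so `G` is generalized and shares the
universe of `F`. -/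
theorem ContinuousMap.contDiff_postcomp {K : Type*} [TopologicalSpace K] [CompactSpace K]
    {F G : Type u} [NormedAddCommGroup F] [NormedSpace ℝ F] [NormedAddCommGroup G]
    [NormedSpace ℝ G] {n : ℕ∞} {f : F → G} (hf : ContDiff ℝ n f) :
    ContDiff ℝ n (fun γ : C(K, F) => (⟨f, hf.continuous⟩ : C(F, G)).comp γ) := by
  suffices H : ∀ m : ℕ, ∀ (G : Type u) [NormedAddCommGroup G] [NormedSpace ℝ G] (f : C(F, G)),
      ContDiff ℝ m f → ContDiff ℝ m (fun γ : C(K, F) => f.comp γ) by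
    rw [contDiff_iff_forall_nat_le]
    exact fun m hm => H m G ⟨f, hf.continuous⟩ (hf.of_le (by exact_mod_cast hm))
  intro m
  induction m with
  | zero =>
    intro G _ _ f _
    exact contDiff_zero.2 (ContinuousMap.continuous_postcomp f)
  | succ m ih =>
    intro G _ _ f hf
    push_cast at hf ⊢
    obtain ⟨f', hf', hd⟩ := contDiff_succ_iff_hasFDerivAt.1 hf
    rw [contDiff_succ_iff_hasFDerivAt]
    let F' : C(F, F →L[ℝ] G) := ⟨f', hf'.continuous⟩
    refine ⟨fun γ => ContinuousMap.pointwiseCLM (F'.comp γ), ?_, fun γ => ?_⟩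
    · exact ContinuousMap.pointwiseCLM.contDiff.comp (ih _ F' hf')
    · exact ContinuousMap.hasFDerivAt_postcomp (f' := F') hd γ

/-! ### The local flow of a globally defined `C^n` vector field. -/

section Flow

open Set Metric MeasureTheory intervalIntegral Filter Topology

variable {F : Type u} [NormedAddCommGroup F] [NormedSpace ℝ F]

/-- The primitive vanishing at `0` of a continuous curve parametrized by the unit interval. -/
noncomputable def unitInterval.primitiveCLM (F : Type u) [NormedAddCommGroup F]
    [NormedSpace ℝ F] : C(unitInterval, F) →L[ℝ] C(unitInterval, F) :=
  LinearMap.mkContinuous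
    { toFun := fun γ => ⟨fun s => ∫ σ in (0 : ℝ)..s, γ (projIcc 0 1 zero_le_one σ),
        (continuous_primitive (fun a b => (γ.continuous.comp continuous_projIcc).intervalIntegrable
          a b) 0).comp continuous_subtype_val⟩
      map_add' := fun γ δ => by
        ext s
        exact integral_add ((γ.continuous.comp continuous_projIcc).intervalIntegrable _ _)
          ((δ.continuous.comp continuous_projIcc).intervalIntegrable _ _)
      map_smul' := fun c γ => by
        ext s
        exact integral_smul c _ }
    1 (fun γ => by
      rw [ContinuousMap.norm_le _ (by positivity)]
      intro s
      refine (norm_integral_le_of_norm_le_const (C := ‖γ‖)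
        (fun σ _ => γ.norm_coe_le_norm _)).trans ?_
      rw [sub_zero, abs_of_nonneg s.2.1, one_mul]
      exact mul_le_of_le_one_right (norm_nonneg _) s.2.2)

lemma unitInterval.primitiveCLM_apply (γ : C(unitInterval, F)) (s : unitInterval) :
    unitInterval.primitiveCLM F γ s = ∫ σ in (0 : ℝ)..s, γ (projIcc 0 1 zero_le_one σ) := rfl

/-- The map whose zeros are the rescaled integral curves `s ↦ x (t s)`, `x' = X x`, `x 0 = z`. -/
noncomputable def scaledPicard {X : F → F} (hX : Continuous X)
    (w : (ℝ × F) × C(unitInterval, F)) : C(unitInterval, F) :=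
  w.2 - ContinuousMap.const _ w.1.2 -
    w.1.1 • unitInterval.primitiveCLM F ((⟨X, hX⟩ : C(F, F)).comp w.2)

lemma contDiff_scaledPicard {n : ℕ∞} {X : F → F} (hX : ContDiff ℝ n X) :
    ContDiff ℝ n (scaledPicard hX.continuous) := by
  have h1 : ContDiff ℝ n fun w : (ℝ × F) × C(unitInterval, F) =>
      (⟨X, hX.continuous⟩ : C(F, F)).comp w.2 :=
    (ContinuousMap.contDiff_postcomp hX).comp contDiff_snd
  have h2 : ContDiff ℝ n fun w : (ℝ × F) × C(unitInterval, F) =>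
      (ContinuousMap.const unitInterval w.1.2) :=
    (ContinuousLinearMap.const ℝ unitInterval : F →L[ℝ] C(unitInterval, F)).contDiff.comp
      contDiff_fst.snd
  exact (contDiff_snd.sub h2).sub
    (contDiff_fst.fst.smul ((unitInterval.primitiveCLM F).contDiff.comp h1))

/-- After rescaling, the time `t` is only a factor in front of the integral. At `t = 0` the integral
disappears and the map is a translation in the curve, so the implicit function theorem applies
without any smallness estimate. -/
lemma fderiv_scaledPicard_comp_inr {X : F → F} (hX : ContDiff ℝ 1 X) (z : F)
    (γ : C(unitInterval, F)) :
    fderiv ℝ (scaledPicard hX.continuous) ((0, z), γ) ∘L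
      .inr ℝ (ℝ × F) C(unitInterval, F) = .id ℝ _ := by
  have hd : DifferentiableAt ℝ (scaledPicard hX.continuous) ((0, z), γ) :=
    ((contDiff_scaledPicard (n := 1) hX).differentiable one_ne_zero) _
  have h1 := hd.hasFDerivAt.comp γ (hasFDerivAt_prodMk_right (𝕜 := ℝ) (0, z) γ)
  refine h1.unique ?_
  have : (scaledPicard hX.continuous ∘ fun y => ((0, z), y)) =
      fun y : C(unitInterval, F) => y - ContinuousMap.const _ z := by
    funext y
    simp [scaledPicard]
  rw [this]
  exact (hasFDerivAt_id γ).sub_const _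

/-- A rescaled integral curve is a zero of `scaledPicard`. -/
lemma scaledPicard_eq_zero {X : F → F} (hX : Continuous X) [CompleteSpace F] {t : ℝ} {z : F}
    {x : ℝ → F} (h0 : x 0 = z) (hx : ∀ s ∈ uIcc 0 t, HasDerivAt x (X (x s)) s)
    (γ : C(unitInterval, F)) (hγ : ∀ s : unitInterval, γ s = x (t * s)) :
    scaledPicard hX ((t, z), γ) = 0 := by
  ext s
  have hmem : ∀ σ ∈ uIcc (0 : ℝ) s, t * σ ∈ uIcc 0 t := by
    intro σ hσ
    rw [uIcc_of_le s.2.1] at hσ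
    have : σ ≤ 1 := hσ.2.trans s.2.2
    rcases le_total 0 t with ht | ht
    · rw [uIcc_of_le ht]
      exact ⟨mul_nonneg ht hσ.1, mul_le_of_le_one_right ht this⟩
    · rw [uIcc_of_ge ht]
      exact ⟨by nlinarith, mul_nonpos_of_nonpos_of_nonneg ht hσ.1⟩
  have hproj : ∀ σ ∈ uIcc (0 : ℝ) s, γ (projIcc 0 1 zero_le_one σ) = x (t * σ) := by
    intro σ hσ
    rw [uIcc_of_le s.2.1] at hσ
    rw [hγ, projIcc_of_mem zero_le_one ⟨hσ.1, hσ.2.trans s.2.2⟩]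
  have hderiv : ∀ σ ∈ uIcc (0 : ℝ) s,
      HasDerivAt (fun σ => x (t * σ)) (t • X (γ (projIcc 0 1 zero_le_one σ))) σ := by
    intro σ hσ
    rw [hproj σ hσ]
    have := (hx _ (hmem σ hσ)).scomp σ ((hasDerivAt_id σ).const_mul t)
    simpa [Function.comp_def] using this
  have hint := integral_eq_sub_of_hasDerivAt hderiv
    (((hX.comp (γ.continuous.comp continuous_projIcc)).const_smul t).intervalIntegrable _ _)
  rw [intervalIntegral.integral_smul] at hint
  simp only [scaledPicard, ContinuousMap.sub_apply, ContinuousMap.smul_apply,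
    unitInterval.primitiveCLM_apply, ContinuousMap.comp_apply, ContinuousMap.coe_mk,
    ContinuousMap.const_apply, ContinuousMap.zero_apply]
  rw [hint, hγ]
  simp [h0]

/-- The local flow of a vector field of class `C^n` is of class `C^n`. -/
theorem exists_contDiffOn_flow [CompleteSpace F] {n : ℕ∞} (hn : 1 ≤ n) {X : F → F}
    (hX : ContDiff ℝ n X) (z₀ : F) :
    ∃ (φ : ℝ × F → F) (ε : ℝ), 0 < ε ∧ ContDiffOn ℝ n φ (Ioo (-ε) ε ×ˢ ball z₀ ε) ∧
      ∀ z ∈ ball z₀ ε, φ (0, z) = z ∧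
        ∀ t ∈ Ioo (-ε) ε, HasDerivAt (fun t => φ (t, z)) (X (φ (t, z))) t := by
  have hn' : (n : WithTop ℕ∞) ≠ 0 := by
    have : n ≠ 0 := (zero_lt_one.trans_le hn).ne'
    exact_mod_cast this
  have hX1 : ContDiff ℝ 1 X := hX.of_le (by exact_mod_cast hn)
  set S := scaledPicard hX.continuous with hS
  have hSn : ContDiff ℝ n S := contDiff_scaledPicard hX
  set u₀ : (ℝ × F) × C(unitInterval, F) := ((0, z₀), ContinuousMap.const _ z₀) with hu₀
  have hSu : S u₀ = 0 := by ext s; simp [hS, hu₀, scaledPicard]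
  set A : (ℝ × F) × C(unitInterval, F) → (C(unitInterval, F) →L[ℝ] C(unitInterval, F)) :=
    fun w => fderiv ℝ S w ∘L .inr ℝ (ℝ × F) C(unitInterval, F) with hA
  have hAc : Continuous A :=
    (hSn.continuous_fderiv hn').clm_comp continuous_const
  have hA0 : A u₀ = .id ℝ _ := fderiv_scaledPicard_comp_inr hX1 _ _
  have hAinv : ∀ᶠ w in 𝓝 u₀, (A w).IsInvertible := by
    have : {L : C(unitInterval, F) →L[ℝ] C(unitInterval, F) | L.IsInvertible} ∈ 𝓝 (A u₀) := by
      rw [hA0]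
      exact ContinuousLinearEquiv.nhds (ContinuousLinearEquiv.refl ℝ C(unitInterval, F))
    exact hAc.continuousAt this
  have hinv0 := hAinv.self_of_nhds
  set ψ := (hSn.contDiffAt (x := u₀)).implicitFunction hn' hinv0 with hψ
  have hψ0 : ψ (0, z₀) = ContinuousMap.const _ z₀ :=
    (hSn.contDiffAt (x := u₀)).implicitFunction_apply_self hn' hinv0
  have hψ1 : ∀ᶠ p in 𝓝 ((0 : ℝ), z₀), ContDiffAt ℝ 1 ψ p :=
    (((hSn.contDiffAt (x := u₀)).contDiffAt_implicitFunction hn' hinv0).of_le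
      (by exact_mod_cast hn)).eventually (by simp)
  have hψz : ∀ᶠ p in 𝓝 ((0 : ℝ), z₀), S (p, ψ p) = 0 := by
    have := (hSn.contDiffAt (x := u₀)).eventually_apply_implicitFunction hn' hinv0
    rwa [hSu] at this
  have huniq : ∀ᶠ w in 𝓝 u₀, S w = 0 ↔ ψ w.1 = w.2 := by
    have := (hSn.contDiffAt (x := u₀)).eventually_apply_eq_iff_implicitFunction hn' hinv0
    rwa [hSu] at this
  have hψc : ContinuousAt ψ (0, z₀) := hψ1.self_of_nhds.continuousAt
  have hgr : Tendsto (fun p => (p, ψ p)) (𝓝 ((0 : ℝ), z₀)) (𝓝 u₀) := by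
    have : ContinuousAt (fun p => (p, ψ p)) ((0 : ℝ), z₀) := continuousAt_id.prodMk hψc
    rwa [ContinuousAt, hψ0] at this
  -- For `n = ∞`, smoothness at the base point does not spread to a neighbourhood by itself. The
  -- implicit function theorem is applied again at each nearby zero, and uniqueness identifies the
  -- new implicit function with `ψ`.
  have hψn : ∀ᶠ p in 𝓝 ((0 : ℝ), z₀), ContDiffAt ℝ n ψ p := by
    filter_upwards [hψ1.eventually_nhds, hψz.eventually_nhds, hgr.eventually hAinv]
      with p hp1 hpz hpi
    have hpz' := hpz.self_of_nhds
    have h := (hSn.contDiffAt (x := (p, ψ p))).contDiffAt_implicitFunction hn' hpi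
    refine h.congr_of_eventuallyEq ?_
    have hcp : ContinuousAt (fun p => (p, ψ p)) p :=
      continuousAt_id.prodMk hp1.self_of_nhds.continuousAt
    have hev := hcp.eventually
      ((hSn.contDiffAt (x := (p, ψ p))).eventually_apply_eq_iff_implicitFunction hn' hpi)
    filter_upwards [hev, hpz] with q hq hqz
    exact (hq.1 (hqz.trans hpz'.symm)).symm
  -- comparison with the continuous flow
  obtain ⟨ε, hε, a, r, L, K, hr, hpl⟩ := IsPicardLindelof.of_contDiffAt_one (hX1.contDiffAt (x := z₀))
  obtain ⟨α, hα, hαc⟩ := (hpl 0).exists_forall_mem_closedBall_eq_hasDerivWithinAt_continuousOn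
  simp only [zero_sub, zero_add] at hα hαc
  have hr' : (0 : ℝ) < r := hr
  have hαd : ∀ z ∈ closedBall z₀ (r : ℝ), ∀ t ∈ Ioo (-ε) ε,
      HasDerivAt (fun t => α (z, t)) (X (α (z, t))) t := fun z hz t ht =>
    ((hα z hz).2 t (Ioo_subset_Icc_self ht)).hasDerivAt (Icc_mem_nhds ht.1 ht.2)
  have hα0 : ContinuousAt α (z₀, 0) := hαc.continuousAt
    (prod_mem_nhds (closedBall_mem_nhds _ hr') (Icc_mem_nhds (by linarith) hε))
  obtain ⟨U, hU, V, hV, hUV⟩ := mem_nhds_prod_iff.1 huniq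
  obtain ⟨η, hη, hηV⟩ := Metric.mem_nhds_iff.1 hV
  have hα00 : α (z₀, 0) = z₀ := (hα z₀ (mem_closedBall_self hr'.le)).1
  -- Half of `η`, since the sup distance of the curves will only be bounded by a non-strict
  -- inequality.
  have hclose : ∀ᶠ w in 𝓝 (z₀, (0 : ℝ)), dist (α w) z₀ < η / 2 := by
    have := hα0.eventually (ball_mem_nhds _ (half_pos hη))
    rwa [hα00] at this
  obtain ⟨δ₁, hδ₁, hball⟩ := Metric.mem_nhds_iff.1 hclose
  obtain ⟨δ₂, hδ₂, hball₂⟩ := Metric.mem_nhds_iff.1 hU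
  obtain ⟨δ₃, hδ₃, hball₃⟩ := Metric.mem_nhds_iff.1 hψn
  set δ := min (min δ₁ δ₂) (min δ₃ (min ε r)) with hδ
  have hδpos : 0 < δ := by positivity
  -- The rescaled Picard–Lindelöf curve is a zero of `S` near `u₀`, hence it is `ψ (t, z)`. Its
  -- value at the end of the unit interval is therefore both smooth in `(t, z)` and an integral
  -- curve in `t`.
  have hkey : ∀ z ∈ ball z₀ δ, ∀ t ∈ Ioo (-δ) δ,
      ψ (t, z) ⟨1, by simp⟩ = α (z, t) ∧ ContDiffAt ℝ n ψ (t, z) := by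
    intro z hz t ht
    rw [mem_ball] at hz
    have e1 : δ ≤ δ₁ := (min_le_left _ _).trans (min_le_left _ _)
    have e2 : δ ≤ δ₂ := (min_le_left _ _).trans (min_le_right _ _)
    have e3 : δ ≤ δ₃ := (min_le_right _ _).trans (min_le_left _ _)
    have e4 : δ ≤ ε := (min_le_right _ _).trans ((min_le_right _ _).trans (min_le_left _ _))
    have e5 : δ ≤ r := (min_le_right _ _).trans ((min_le_right _ _).trans (min_le_right _ _))
    have habs : |t| < δ := abs_lt.2 ht
    have hzr : z ∈ closedBall z₀ (r : ℝ) := (hz.le.trans e5)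
    have hts : ∀ s : unitInterval, |t * s| ≤ |t| := fun s => by
      rw [abs_mul, abs_of_nonneg s.2.1]
      exact mul_le_of_le_one_right (abs_nonneg _) s.2.2
    have hcont : Continuous fun s : unitInterval => α (z, t * s) := by
      have h1 : ContinuousOn (fun t => α (z, t)) (Ioo (-ε) ε) :=
        fun t ht => (hαd z hzr t ht).continuousAt.continuousWithinAt
      exact h1.comp_continuous (by fun_prop)
        (fun s => abs_lt.1 ((hts s).trans_lt (habs.trans_le e4)))
    set γ : C(unitInterval, F) := ⟨fun s => α (z, t * s), hcont⟩ with hγ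
    have hS0 : S ((t, z), γ) = 0 := by
      refine scaledPicard_eq_zero hX.continuous (x := fun s => α (z, s)) (hα z hzr).1 ?_ γ
        (fun s => rfl)
      intro s hs
      refine hαd z hzr s (abs_lt.1 (lt_of_le_of_lt ?_ (habs.trans_le e4)))
      simpa using abs_sub_left_of_mem_uIcc hs
    have hmem : ((t, z), γ) ∈ U ×ˢ V := by
      refine ⟨hball₂ ?_, hηV ?_⟩
      · rw [mem_ball, Prod.dist_eq, max_lt_iff]
        exact ⟨by simpa using habs.trans_le e2, hz.trans_le e2⟩
      · rw [mem_ball]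
        refine lt_of_le_of_lt ?_ (half_lt_self hη)
        rw [ContinuousMap.dist_le (half_pos hη).le]
        intro s
        have hm : (z, t * (s : ℝ)) ∈ ball (z₀, (0 : ℝ)) δ₁ := ?_
        · exact (show dist (α (z, t * (s : ℝ))) z₀ < η / 2 from hball hm).le
        rw [mem_ball, Prod.dist_eq, max_lt_iff]
        exact ⟨hz.trans_le e1, by simpa using (hts s).trans_lt (habs.trans_le e1)⟩
    have := (hUV hmem).1 hS0
    refine ⟨?_, hball₃ ?_⟩
    · change ψ ((t, z), γ).1 _ = _
      rw [this]
      simp [hγ]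
    · rw [mem_ball, Prod.dist_eq, max_lt_iff]
      exact ⟨by simpa using habs.trans_le e3, hz.trans_le e3⟩
  have e4 : δ ≤ ε := (min_le_right _ _).trans ((min_le_right _ _).trans (min_le_left _ _))
  have e5 : δ ≤ r := (min_le_right _ _).trans ((min_le_right _ _).trans (min_le_right _ _))
  refine ⟨fun p => ψ p ⟨1, by simp⟩, δ, hδpos, ?_, fun z hz => ⟨?_, fun t ht => ?_⟩⟩
  · intro p hp
    have h := (hkey p.2 hp.2 p.1 hp.1).2
    exact ((ContinuousMap.evalCLM ℝ (⟨1, by simp⟩ : unitInterval)).contDiff.contDiffAt.comp p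
      h).contDiffWithinAt
  · change ψ (0, z) _ = z
    rw [(hkey z hz 0 ⟨by linarith, hδpos⟩).1]
    exact (hα z (hz.le.trans e5)).1
  · change HasDerivAt (fun t => ψ (t, z) _) (X (ψ (t, z) _)) t
    rw [(hkey z hz t ht).1]
    refine (hαd z (hz.le.trans e5) t ⟨by linarith [ht.1], ht.2.trans_le e4⟩).congr_of_eventuallyEq ?_
    filter_upwards [Ioo_mem_nhds ht.1 ht.2] with s hs
    exact (hkey z hz s hs).1

end Flow

/-! ### Vector fields on open sets, time dependent fields, and mixed derivatives. -/

section LocalFlow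

open Set Metric Filter Topology

variable {F : Type u} [NormedAddCommGroup F] [NormedSpace ℝ F]

/-- A bump function equal to one near `z₀` and supported in the domain cuts the field off without
changing it near `z₀`; this reduces flows on open sets to globally defined fields. -/
lemma ContDiffOn.exists_contDiff_eventuallyEq [FiniteDimensional ℝ F] {G : Type*}
    [NormedAddCommGroup G] [NormedSpace ℝ G] {n : ℕ∞} {W : Set F} (hW : IsOpen W) {X : F → G}
    (hX : ContDiffOn ℝ n X W) {z₀ : F} (hz₀ : z₀ ∈ W) :
    ∃ Y : F → G, ContDiff ℝ n Y ∧ Y =ᶠ[𝓝 z₀] X := by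
  obtain ⟨R, hR, hRW⟩ := Metric.isOpen_iff.1 hW z₀ hz₀
  let χ : ContDiffBump z₀ := ⟨R / 4, R / 2, by positivity, by linarith⟩
  refine ⟨fun z => χ z • X z, contDiff_iff_contDiffAt.2 fun z => ?_, ?_⟩
  · by_cases hz : z ∈ W
    · exact χ.contDiff.contDiffAt.smul (hX.contDiffAt (hW.mem_nhds hz))
    · refine contDiffAt_const (c := (0 : G)) |>.congr_of_eventuallyEq ?_
      have : z ∉ tsupport χ := fun h => hz (hRW (by
        rw [χ.tsupport_eq, mem_closedBall] at h
        exact mem_ball.2 (h.trans_lt (by change R / 2 < R; linarith))))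
      filter_upwards [notMem_tsupport_iff_eventuallyEq.1 this] with w hw
      simp [hw]
  · filter_upwards [χ.eventuallyEq_one] with z hz
    simp [hz]

/-- The local flow of a vector field of class `C^n` on an open set. -/
theorem ContDiffOn.exists_contDiffOn_flow [FiniteDimensional ℝ F] {n : ℕ∞} (hn : 1 ≤ n)
    {W : Set F} (hW : IsOpen W) {X : F → F} (hX : ContDiffOn ℝ n X W) {z₀ : F} (hz₀ : z₀ ∈ W) :
    ∃ (φ : ℝ × F → F) (ε : ℝ), 0 < ε ∧ ContDiffOn ℝ n φ (Ioo (-ε) ε ×ˢ ball z₀ ε) ∧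
      ∀ z ∈ ball z₀ ε, φ (0, z) = z ∧ ∀ t ∈ Ioo (-ε) ε,
        φ (t, z) ∈ W ∧ HasDerivAt (fun t => φ (t, z)) (X (φ (t, z))) t := by
  have := FiniteDimensional.complete ℝ F
  obtain ⟨Y, hY, hYX⟩ := hX.exists_contDiff_eventuallyEq hW hz₀
  obtain ⟨φ, ε, hε, hφ, hflow⟩ := _root_.exists_contDiffOn_flow hn hY z₀
  have hopen : IsOpen (Ioo (-ε) ε ×ˢ ball z₀ ε) := isOpen_Ioo.prod isOpen_ball
  have hφ0 : φ (0, z₀) = z₀ := (hflow z₀ (mem_ball_self hε)).1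
  have hc : ContinuousAt φ (0, z₀) := hφ.continuousOn.continuousAt
    (hopen.mem_nhds ⟨⟨by linarith, hε⟩, mem_ball_self hε⟩)
  have hev : ∀ᶠ p in 𝓝 ((0 : ℝ), z₀), φ p ∈ W ∧ Y (φ p) = X (φ p) := by
    have h1 : ∀ᶠ w in 𝓝 (φ (0, z₀)), w ∈ W ∧ Y w = X w := by
      rw [hφ0]
      exact (hW.eventually_mem hz₀).and hYX
    exact hc.eventually h1
  obtain ⟨δ, hδ, hball⟩ := Metric.mem_nhds_iff.1 hev
  have key : ∀ t ∈ Ioo (-(min ε δ)) (min ε δ), ∀ z ∈ ball z₀ (min ε δ),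
      t ∈ Ioo (-ε) ε ∧ z ∈ ball z₀ ε ∧ φ (t, z) ∈ W ∧ Y (φ (t, z)) = X (φ (t, z)) := by
    intro t ht z hz
    have ht' : |t| < min ε δ := abs_lt.2 ht
    refine ⟨abs_lt.1 (ht'.trans_le (min_le_left _ _)), ball_subset_ball (min_le_left _ _) hz, ?_⟩
    have hm : (t, z) ∈ ball ((0 : ℝ), z₀) δ := ?_
    · exact (show φ (t, z) ∈ W ∧ Y (φ (t, z)) = X (φ (t, z)) from hball hm)
    rw [mem_ball, Prod.dist_eq, max_lt_iff]
    exact ⟨by simpa using ht'.trans_le (min_le_right _ _), hz.trans_le (min_le_right _ _)⟩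
  refine ⟨φ, min ε δ, lt_min hε hδ, hφ.mono ?_, fun z hz => ⟨?_, fun t ht => ?_⟩⟩
  · rintro ⟨t, z⟩ ⟨ht, hz⟩
    exact ⟨(key t ht z hz).1, (key t ht z hz).2.1⟩
  · exact (hflow z (ball_subset_ball (min_le_left _ _) hz)).1
  · obtain ⟨h1, h2, h3, h4⟩ := key t ht z hz
    exact ⟨h3, h4 ▸ (hflow z h2).2 t h1⟩

/-- The local evolution of a time dependent vector field of class `C^n`. -/
theorem ContDiffOn.exists_contDiffOn_evolution [FiniteDimensional ℝ F] {n : ℕ∞} (hn : 1 ≤ n)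
    {W : Set (ℝ × F)} (hW : IsOpen W) {f : ℝ × F → F} (hf : ContDiffOn ℝ n f W) {t₀ : ℝ} {x₀ : F}
    (h₀ : (t₀, x₀) ∈ W) :
    ∃ (φ : ℝ × ℝ × F → F) (ε : ℝ), 0 < ε ∧
      ContDiffOn ℝ n φ
        (Ioo (t₀ - ε) (t₀ + ε) ×ˢ Ioo (t₀ - ε) (t₀ + ε) ×ˢ ball x₀ ε) ∧
      ∀ t ∈ Ioo (t₀ - ε) (t₀ + ε), ∀ x ∈ ball x₀ ε, φ (t, t, x) = x ∧
        ∀ s ∈ Ioo (t₀ - ε) (t₀ + ε), (s, φ (s, t, x)) ∈ W ∧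
          HasDerivAt (fun s => φ (s, t, x)) (f (s, φ (s, t, x))) s := by
  -- Time is added as a coordinate of velocity one, and the evolution from `t` to `s` is the
  -- autonomous flow for time `s - t`. Halving the radius below keeps `|s - t| < ε`.
  have hX : ContDiffOn ℝ n (fun z : ℝ × F => ((1 : ℝ), f z)) W := contDiffOn_const.prodMk hf
  obtain ⟨Φ, ε, hε, hΦ, hflow⟩ := hX.exists_contDiffOn_flow hn hW h₀
  have hfst : ∀ z ∈ ball (t₀, x₀) ε, ∀ τ ∈ Ioo (-ε) ε, (Φ (τ, z)).1 = z.1 + τ := by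
    intro z hz τ hτ
    have hd : ∀ σ ∈ Ioo (-ε) ε, HasDerivAt (fun σ => (Φ (σ, z)).1 - σ) 0 σ := by
      intro σ hσ
      have h1 := ((hflow z hz).2 σ hσ).2
      have h2 : HasDerivAt (fun σ => (Φ (σ, z)).1) 1 σ :=
        (ContinuousLinearMap.fst ℝ ℝ F).hasFDerivAt.comp_hasDerivAt σ h1
      have h3 := h2.sub (hasDerivAt_id' σ)
      rw [sub_self] at h3
      exact h3
    have := isOpen_Ioo.is_const_of_deriv_eq_zero isPreconnected_Ioo
      (fun σ hσ => (hd σ hσ).differentiableAt.differentiableWithinAt)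
      (fun σ hσ => (hd σ hσ).deriv) hτ (y := 0) ⟨by linarith, hε⟩
    simp only [(hflow z hz).1] at this
    linarith
  have hmem : ∀ t ∈ Ioo (t₀ - ε / 2) (t₀ + ε / 2), ∀ x ∈ ball x₀ (ε / 2),
      (t, x) ∈ ball (t₀, x₀) ε := by
    intro t ht x hx
    rw [mem_ball, Prod.dist_eq, max_lt_iff]
    refine ⟨?_, (mem_ball.1 hx).trans (half_lt_self hε)⟩
    rw [Real.dist_eq, abs_lt]
    constructor <;> linarith [ht.1, ht.2]
  refine ⟨fun p => (Φ (p.1 - p.2.1, p.2)).2, ε / 2, half_pos hε, ?_, fun t ht x hx => ⟨?_, ?_⟩⟩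
  · refine contDiff_snd.comp_contDiffOn (hΦ.comp (t := Ioo (-ε) ε ×ˢ ball (t₀, x₀) ε)
      (f := fun p : ℝ × ℝ × F => (p.1 - p.2.1, p.2)) (by fun_prop) ?_)
    rintro ⟨s, t, x⟩ ⟨hs, ht, hx⟩
    exact ⟨⟨by linarith [hs.1, ht.2], by linarith [hs.2, ht.1]⟩, hmem t ht x hx⟩
  · simp [(hflow _ (hmem t ht x hx)).1]
  · intro s hs
    have hst : s - t ∈ Ioo (-ε) ε := ⟨by linarith [hs.1, ht.2], by linarith [hs.2, ht.1]⟩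
    obtain ⟨h1, h2⟩ := (hflow _ (hmem t ht x hx)).2 (s - t) hst
    have h3 : (Φ (s - t, (t, x))) = (s, (Φ (s - t, (t, x))).2) :=
      Prod.ext (by rw [hfst _ (hmem t ht x hx) _ hst]; simp) rfl
    refine ⟨h3 ▸ h1, ?_⟩
    have h4 : HasDerivAt (fun s => Φ (s - t, (t, x))) _ s := h2.comp_sub_const s t
    rw [h3] at h4
    exact (ContinuousLinearMap.snd ℝ ℝ F).hasFDerivAt.comp_hasDerivAt s h4

/-- If `y` and its time derivative `h` are `C^1`, then mixed derivatives of `y` commute. -/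
lemma hasDerivAt_fderiv_apply_snd {G : Type*} [NormedAddCommGroup G] [NormedSpace ℝ G]
    {y h : ℝ × F → G} {t : ℝ} {x : F} (hy : ∀ᶠ z in 𝓝 (t, x), DifferentiableAt ℝ y z)
    (hyh : ∀ᶠ z in 𝓝 (t, x), HasDerivAt (fun s => y (s, z.2)) (h z) z.1)
    (hh : ContDiffAt ℝ 1 h (t, x)) (ξ : F) :
    HasDerivAt (fun s => fderiv ℝ y (s, x) (0, ξ)) (fderiv ℝ h (t, x) (0, ξ)) t := by
  have hpt : Tendsto (fun w : ℝ × ℝ => (w.2, x + w.1 • ξ)) (𝓝 (0, t)) (𝓝 (t, x)) := by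
    have : Continuous fun w : ℝ × ℝ => (w.2, x + w.1 • ξ) := by fun_prop
    simpa using this.tendsto (0, t)
  have hpt0 : Tendsto (fun w : ℝ × ℝ => (w.2, x)) (𝓝 (0, t)) (𝓝 (t, x)) := by
    have : Continuous fun w : ℝ × ℝ => (w.2, x) := by fun_prop
    simpa using this.tendsto (0, t)
  have hle : 𝓝[≠] (0 : ℝ) ×ˢ 𝓝 t ≤ 𝓝 (0, t) := by
    rw [nhds_prod_eq]
    exact Filter.prod_mono nhdsWithin_le_nhds le_rfl
  -- The spatial difference quotients of `y` converge pointwise, and their time derivatives, the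
  -- difference quotients of `h`, converge uniformly because `h` is strictly differentiable. No
  -- second derivative of `y` is assumed.
  refine hasDerivAt_of_tendstoUniformlyOnFilter (l := 𝓝[≠] (0 : ℝ))
    (f := fun l s => l⁻¹ • (y (s, x + l • ξ) - y (s, x)))
    (f' := fun l s => l⁻¹ • (h (s, x + l • ξ) - h (s, x)))
    (g' := fun _ => fderiv ℝ h (t, x) (0, ξ)) ?_ ?_ ?_
  · rw [Metric.tendstoUniformlyOnFilter_iff]
    intro ε hε
    have hs := (hh.hasStrictFDerivAt one_ne_zero).isLittleO
    have hs' := (hs.comp_tendsto ((hpt.prodMk_nhds hpt0).mono_left hle)).def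
      (show (0 : ℝ) < ε / (2 * (‖ξ‖ + 1)) by positivity)
    have hne : ∀ᶠ w : ℝ × ℝ in 𝓝[≠] (0 : ℝ) ×ˢ 𝓝 t, w.1 ≠ 0 :=
      tendsto_fst.eventually self_mem_nhdsWithin
    filter_upwards [hs', hne] with w hw hw0
    simp only [Function.comp_apply, Prod.mk_sub_mk, sub_self, add_sub_cancel_left] at hw
    have e1 : ((0 : ℝ), w.1 • ξ) = w.1 • ((0 : ℝ), ξ) := by simp
    rw [e1, map_smul, norm_smul] at hw
    have e2 : fderiv ℝ h (t, x) (0, ξ) - w.1⁻¹ • (h (w.2, x + w.1 • ξ) - h (w.2, x)) =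
        -(w.1⁻¹ • (h (w.2, x + w.1 • ξ) - h (w.2, x) - w.1 • fderiv ℝ h (t, x) (0, ξ))) := by
      rw [smul_sub w.1⁻¹ (_ - _) (w.1 • _), inv_smul_smul₀ hw0, neg_sub]
    rw [dist_eq_norm, e2, norm_neg, norm_smul, norm_inv]
    have hpos : 0 < ‖w.1‖ := norm_pos_iff.2 hw0
    have hξ : ‖((0 : ℝ), ξ)‖ = ‖ξ‖ := by simp
    rw [hξ] at hw
    rw [inv_mul_lt_iff₀ hpos]
    refine hw.trans_lt ?_
    rw [mul_comm ‖w.1‖ ‖ξ‖, ← mul_assoc, mul_comm ‖w.1‖ ε]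
    refine mul_lt_mul_of_pos_right ?_ hpos
    rw [div_mul_eq_mul_div, div_lt_iff₀ (by positivity)]
    nlinarith [norm_nonneg ξ]
  · have h1 := ((hpt.eventually hyh).and (hpt0.eventually hyh)).filter_mono hle
    filter_upwards [h1] with w hw
    exact (hw.1.sub hw.2).const_smul _
  · have h1 : Tendsto (fun s : ℝ => (s, x)) (𝓝 t) (𝓝 (t, x)) :=
      (by fun_prop : Continuous fun s : ℝ => (s, x)).tendsto t
    filter_upwards [h1.eventually hy] with s hs
    have := hs.hasFDerivAt.hasLineDerivAt ((0 : ℝ), ξ)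
    have := this.tendsto_slope_zero
    simpa using this

end LocalFlow

/-! ### Hamilton's equations and the method of characteristics. -/

section HamiltonJacobi

open Set Metric Filter Topology

variable {E : Type u} [NormedAddCommGroup E] [NormedSpace ℝ E]

/-- The canonical 1-form `p dq - h dt` on `ℝ × E`. -/
noncomputable def canonicalForm (p : E →L[ℝ] ℝ) (h : ℝ) : ℝ × E →L[ℝ] ℝ :=
  p.comp (ContinuousLinearMap.snd ℝ ℝ E) - h • ContinuousLinearMap.fst ℝ ℝ E

@[simp]
lemma canonicalForm_apply (p : E →L[ℝ] ℝ) (h : ℝ) (v : ℝ × E) :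
    canonicalForm p h v = p v.2 - h * v.1 := by simp [canonicalForm]

lemma fderiv_apply_one_zero {G : Type*} [NormedAddCommGroup G] [NormedSpace ℝ G]
    {g : ℝ × E → G} {g' : G} {z : ℝ × E} (hg : DifferentiableAt ℝ g z)
    (hg' : HasDerivAt (fun s => g (s, z.2)) g' z.1) : fderiv ℝ g z (1, 0) = g' :=
  (hg.hasFDerivAt.comp_hasDerivAt z.1
    ((hasDerivAt_id z.1).prodMk (hasDerivAt_const z.1 z.2))).unique hg'

lemma map_prodMk_eq_smul_add {G : Type*} [NormedAddCommGroup G] [NormedSpace ℝ G]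
    (L : ℝ × E →L[ℝ] G) (τ : ℝ) (ξ : E) : L (τ, ξ) = τ • L (1, 0) + L (0, ξ) := by
  rw [← map_smul, ← map_add]
  simp

/-- Solutions of Hamilton's equations starting from the zero section, together with the action
along them, whose differential is `p dq - H dt`. -/
theorem exists_hamiltonian_evolution [FiniteDimensional ℝ E] {m : ℕ∞} (hm : 1 ≤ m)
    {W : Set (ℝ × E × (E →L[ℝ] ℝ))} (hW : IsOpen W) {H : ℝ × E × (E →L[ℝ] ℝ) → ℝ}
    (hH : ContDiffOn ℝ (m + 1) H W) {v : ℝ × E × (E →L[ℝ] ℝ) → E} (hv : ContDiffOn ℝ m v W)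
    (hHv : ∀ w ∈ W, ∀ π, fderiv ℝ H w (0, 0, π) = π (v w)) {t₀ : ℝ} {x₀ : E}
    (h₀ : (t₀, x₀, 0) ∈ W) :
    ∃ (q : ℝ × E → E) (p : ℝ × E → E →L[ℝ] ℝ) (U : ℝ × E → ℝ) (ε : ℝ), 0 < ε ∧
      ContDiffOn ℝ m q (Ioo (t₀ - ε) (t₀ + ε) ×ˢ ball x₀ ε) ∧
      ContDiffOn ℝ m p (Ioo (t₀ - ε) (t₀ + ε) ×ˢ ball x₀ ε) ∧
      (∀ x ∈ ball x₀ ε, q (t₀, x) = x) ∧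
      ∀ z ∈ Ioo (t₀ - ε) (t₀ + ε) ×ˢ ball x₀ ε, (z.1, q z, p z) ∈ W ∧
        HasFDerivAt U (p z ∘L fderiv ℝ q z -
          H (z.1, q z, p z) • ContinuousLinearMap.fst ℝ ℝ E) z ∧
        fderiv ℝ q z (1, 0) = v (z.1, q z, p z) := by
  set ι : ℝ × E × (E →L[ℝ] ℝ) × ℝ → ℝ × E × (E →L[ℝ] ℝ) := fun w => (w.1, w.2.1, w.2.2.1) with hι
  have hιc : ContDiff ℝ m ι := by fun_prop
  set W' := ι ⁻¹' W with hW'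
  have hW'o : IsOpen W' := hW.preimage hιc.continuous
  have hdH : ContDiffOn ℝ m (fderiv ℝ H) W := hH.fderiv_of_isOpen hW le_rfl
  have hHm : ContDiffOn ℝ m H W := hH.of_le (by exact_mod_cast le_self_add)
  set dHq : ℝ × E × (E →L[ℝ] ℝ) → E →L[ℝ] ℝ := fun w =>
    fderiv ℝ H w ∘L (ContinuousLinearMap.inr ℝ ℝ _ ∘L ContinuousLinearMap.inl ℝ E _) with hdHq
  have hdHqc : ContDiffOn ℝ m dHq W := hdH.clm_comp contDiffOn_const
  -- Hamilton's equations, with the action carried along as one more unknown whose velocity is the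
  -- Lagrangian `p(v) - H`.
  set X : ℝ × E × (E →L[ℝ] ℝ) × ℝ → E × (E →L[ℝ] ℝ) × ℝ := fun w =>
    (v (ι w), -dHq (ι w), w.2.2.1 (v (ι w)) - H (ι w)) with hX
  have hmaps : MapsTo ι W' W := fun w hw => hw
  have hXc : ContDiffOn ℝ m X W' := by
    have h1 := hv.comp hιc.contDiffOn hmaps
    have h2 := hdHqc.comp hιc.contDiffOn hmaps
    have h3 := hHm.comp hιc.contDiffOn hmaps
    have h4 : ContDiffOn ℝ m (fun w : ℝ × E × (E →L[ℝ] ℝ) × ℝ => w.2.2.1) W' := by fun_prop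
    exact h1.prodMk (h2.neg.prodMk ((h4.clm_apply h1).sub h3))
  obtain ⟨φ, ε, hε, hφ, hflow⟩ := hXc.exists_contDiffOn_evolution (t₀ := t₀)
    (x₀ := ((x₀, 0, 0) : E × (E →L[ℝ] ℝ) × ℝ)) hm hW'o h₀
  set J := Ioo (t₀ - ε) (t₀ + ε) with hJ
  have ht₀ : t₀ ∈ J := ⟨by linarith, by linarith⟩
  set O := J ×ˢ ball x₀ ε with hO
  have hOo : IsOpen O := isOpen_Ioo.prod isOpen_ball
  set σ : ℝ × E → E × (E →L[ℝ] ℝ) × ℝ := fun z => φ (z.1, t₀, z.2, 0, 0) with hσ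
  have hb : ∀ x ∈ ball x₀ ε, ((x, 0, 0) : E × (E →L[ℝ] ℝ) × ℝ) ∈
      ball ((x₀, 0, 0) : E × (E →L[ℝ] ℝ) × ℝ) ε := by
    intro x hx
    simpa [Prod.dist_eq, hε] using hx
  have hσc : ContDiffOn ℝ m σ O :=
    hφ.comp (f := fun z : ℝ × E => (z.1, t₀, z.2, (0 : E →L[ℝ] ℝ), (0 : ℝ))) (by fun_prop)
      (fun z hz => ⟨hz.1, ht₀, hb _ hz.2⟩)
  have hσ0 : ∀ x ∈ ball x₀ ε, σ (t₀, x) = (x, 0, 0) := fun x hx => (hflow t₀ ht₀ _ (hb x hx)).1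
  have hσW : ∀ z ∈ O, (z.1, σ z) ∈ W' := fun z hz =>
    ((hflow t₀ ht₀ _ (hb _ hz.2)).2 z.1 hz.1).1
  have hσd : ∀ z ∈ O, HasDerivAt (fun s => σ (s, z.2)) (X (z.1, σ z)) z.1 := fun z hz =>
    ((hflow t₀ ht₀ _ (hb _ hz.2)).2 z.1 hz.1).2
  set q : ℝ × E → E := fun z => (σ z).1 with hq
  set p : ℝ × E → E →L[ℝ] ℝ := fun z => (σ z).2.1 with hp
  set U : ℝ × E → ℝ := fun z => (σ z).2.2 with hU
  have hqc : ContDiffOn ℝ m q O := contDiff_fst.comp_contDiffOn hσc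
  have hpc : ContDiffOn ℝ m p O := contDiff_snd.fst.comp_contDiffOn hσc
  have hUc : ContDiffOn ℝ m U O := contDiff_snd.snd.comp_contDiffOn hσc
  set c : ℝ × E → ℝ × E × (E →L[ℝ] ℝ) := fun z => (z.1, q z, p z) with hc
  have hcW : ∀ z ∈ O, c z ∈ W := hσW
  have hcc : ContDiffOn ℝ m c O := contDiffOn_fst.prodMk (hqc.prodMk hpc)
  have hm0 : (m : WithTop ℕ∞) ≠ 0 := by
    have : m ≠ 0 := (zero_lt_one.trans_le hm).ne'
    exact_mod_cast this
  have hm1 : (1 : WithTop ℕ∞) ≤ m := by exact_mod_cast hm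
  have hqt : ∀ z ∈ O, HasDerivAt (fun s => q (s, z.2)) (v (c z)) z.1 := fun z hz =>
    (ContinuousLinearMap.fst ℝ E ((E →L[ℝ] ℝ) × ℝ)).hasFDerivAt.comp_hasDerivAt z.1 (hσd z hz)
  have hpt : ∀ z ∈ O, HasDerivAt (fun s => p (s, z.2)) (-dHq (c z)) z.1 := fun z hz =>
    (ContinuousLinearMap.fst ℝ (E →L[ℝ] ℝ) ℝ ∘L
      ContinuousLinearMap.snd ℝ E _).hasFDerivAt.comp_hasDerivAt z.1 (hσd z hz)
  have hUt : ∀ z ∈ O, HasDerivAt (fun s => U (s, z.2)) (p z (v (c z)) - H (c z)) z.1 :=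
    fun z hz => (ContinuousLinearMap.snd ℝ (E →L[ℝ] ℝ) ℝ ∘L
      ContinuousLinearMap.snd ℝ E _).hasFDerivAt.comp_hasDerivAt z.1 (hσd z hz)
  have hdiff : ∀ {G : Type u} [NormedAddCommGroup G] [NormedSpace ℝ G] {g : ℝ × E → G},
      ContDiffOn ℝ m g O → ∀ z ∈ O, DifferentiableAt ℝ g z := fun hg z hz =>
    (hg.contDiffAt (hOo.mem_nhds hz)).differentiableAt hm0
  have hUdiff : ∀ z ∈ O, DifferentiableAt ℝ U z := fun z hz =>
    (hUc.contDiffAt (hOo.mem_nhds hz)).differentiableAt hm0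
  have hvc : ContDiffOn ℝ m (fun z => v (c z)) O := hv.comp hcc hcW
  have hHc : ContDiffOn ℝ m (fun z => H (c z)) O := hHm.comp hcc hcW
  have hLc : ContDiffOn ℝ m (fun z => p z (v (c z)) - H (c z)) O := (hpc.clm_apply hvc).sub hHc
  -- By Hamilton's equations the difference of the two sides has zero time derivative, and it
  -- vanishes at `t₀`, where `p` and `U` are zero.
  have hspace : ∀ z ∈ O, ∀ ξ, fderiv ℝ U z (0, ξ) = p z (fderiv ℝ q z (0, ξ)) := by
    rintro ⟨t, x⟩ ⟨ht, hx⟩ ξ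
    have hd : ∀ s ∈ J, HasDerivAt
        (fun s => fderiv ℝ U (s, x) (0, ξ) - p (s, x) (fderiv ℝ q (s, x) (0, ξ))) 0 s := by
      intro s hs
      have hz : (s, x) ∈ O := ⟨hs, hx⟩
      have hev : ∀ᶠ z in 𝓝 (s, x), z ∈ O := hOo.eventually_mem hz
      have h1 := hasDerivAt_fderiv_apply_snd (hev.mono fun z hz => hUdiff z hz)
        (hev.mono fun z hz => hUt z hz)
        ((hLc.contDiffAt (hOo.mem_nhds hz)).of_le hm1) ξ
      have h2 := hasDerivAt_fderiv_apply_snd (hev.mono fun z hz => hdiff hqc z hz)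
        (hev.mono fun z hz => hqt z hz)
        ((hvc.contDiffAt (hOo.mem_nhds hz)).of_le hm1) ξ
      have h3 := h1.sub ((hpt _ hz).clm_apply h2)
      have h4 : HasFDerivAt (fun z => p z (v (c z)) - H (c z)) _ (s, x) :=
        ((hdiff hpc _ hz).hasFDerivAt.clm_apply (hdiff hvc _ hz).hasFDerivAt).sub
          (((hH.differentiableOn (by simp) _ (hcW _ hz)).differentiableAt
            (hW.mem_nhds (hcW _ hz))).hasFDerivAt.comp (s, x)
            ((hasFDerivAt_fst (𝕜 := ℝ) (p := (s, x))).prodMk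
              ((hdiff hqc _ hz).hasFDerivAt.prodMk (hdiff hpc _ hz).hasFDerivAt)))
      convert! h3 using 1
      rw [h4.fderiv]
      have h5 : fderiv ℝ H (c (s, x)) (0, fderiv ℝ q (s, x) (0, ξ), fderiv ℝ p (s, x) (0, ξ)) =
          dHq (c (s, x)) (fderiv ℝ q (s, x) (0, ξ)) +
            fderiv ℝ p (s, x) (0, ξ) (v (c (s, x))) := by
        rw [← hHv _ (hcW _ hz)]
        simp only [hdHq, ContinuousLinearMap.comp_apply]
        rw [← map_add]
        simp
      simp only [sub_apply, add_apply,
        ContinuousLinearMap.comp_apply, ContinuousLinearMap.flip_apply,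
        ContinuousLinearMap.prod_apply, ContinuousLinearMap.coe_fst', 
        neg_apply]
      rw [h5]
      ring
    have hconst := isOpen_Ioo.is_const_of_deriv_eq_zero isPreconnected_Ioo
      (fun σ hσ => (hd σ hσ).differentiableAt.differentiableWithinAt)
      (fun σ hσ => (hd σ hσ).deriv) ht ht₀
    have hz₀ : (t₀, x) ∈ O := ⟨ht₀, hx⟩
    have hp0 : p (t₀, x) = 0 := by simp [hp, hσ0 x hx]
    have hU0 : fderiv ℝ U (t₀, x) (0, ξ) = 0 := by
      have h1 := (hUdiff _ hz₀).hasFDerivAt.comp x (hasFDerivAt_prodMk_right (𝕜 := ℝ) t₀ x)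
      have h2 : (U ∘ fun y => (t₀, y)) =ᶠ[𝓝 x] fun _ => 0 := by
        filter_upwards [isOpen_ball.mem_nhds hx] with y hy
        simp [hU, hσ0 y hy]
      have h3 := h1.unique ((hasFDerivAt_const (0 : ℝ) x).congr_of_eventuallyEq h2)
      simpa using congrArg (fun L => L ξ) h3
    simp only [hp0, hU0, zero_apply, sub_zero] at hconst
    exact sub_eq_zero.1 hconst
  refine ⟨q, p, U, ε, hε, hqc, hpc, fun x hx => by simp [hq, hσ0 x hx], fun z hz =>
    ⟨hcW z hz, ?_, fderiv_apply_one_zero (hdiff hqc z hz) (hqt z hz)⟩⟩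
  have h1 := (hUdiff z hz).hasFDerivAt
  convert! h1 using 1
  refine ContinuousLinearMap.ext fun ⟨τ, ξ⟩ => ?_
  have e1 := fderiv_apply_one_zero (hUdiff z hz) (hUt z hz)
  have e2 := fderiv_apply_one_zero (hdiff hqc z hz) (hqt z hz)
  rw [map_prodMk_eq_smul_add (fderiv ℝ U z), hspace z hz, e1]
  simp only [sub_apply, ContinuousLinearMap.comp_apply,
    smul_apply, ContinuousLinearMap.coe_fst']
  rw [map_prodMk_eq_smul_add (fderiv ℝ q z), map_add, map_smul, e2]
  simp only [smul_eq_mul, hc]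
  ring

/-- A local solution of the Hamilton-Jacobi equation obtained by the method of characteristics,
together with local coordinates which are constant along the characteristics. -/
theorem exists_local_hamiltonJacobi [FiniteDimensional ℝ E] {m : ℕ∞} (hm : 1 ≤ m)
    {W : Set (ℝ × E × (E →L[ℝ] ℝ))} (hW : IsOpen W) {H : ℝ × E × (E →L[ℝ] ℝ) → ℝ}
    (hH : ContDiffOn ℝ (m + 1) H W) {v : ℝ × E × (E →L[ℝ] ℝ) → E} (hv : ContDiffOn ℝ m v W)
    (hHv : ∀ w ∈ W, ∀ π, fderiv ℝ H w (0, 0, π) = π (v w)) {t₀ : ℝ} {x₀ : E}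
    (h₀ : (t₀, x₀, 0) ∈ W) :
    ∃ (Ψ : OpenPartialHomeomorph (ℝ × E) (ℝ × E)) (u : ℝ × E → ℝ) (P : ℝ × E → E →L[ℝ] ℝ),
      (t₀, x₀) ∈ Ψ.source ∧ ContDiffOn ℝ m Ψ Ψ.source ∧ ContDiffOn ℝ m Ψ.symm Ψ.target ∧
      ContDiffOn ℝ (m + 1) u Ψ.source ∧
      ∀ z ∈ Ψ.source, (Ψ z).1 = z.1 ∧ (z.1, z.2, P z) ∈ W ∧
        HasFDerivAt u (canonicalForm (P z) (H (z.1, z.2, P z))) z ∧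
        fderiv ℝ Ψ z (1, v (z.1, z.2, P z)) = (1, 0) := by
  have hcomp := FiniteDimensional.complete ℝ E
  obtain ⟨q, p, U, ε, hε, hq, hp, hq0, hz⟩ := exists_hamiltonian_evolution hm hW hH hv hHv h₀
  set O := Ioo (t₀ - ε) (t₀ + ε) ×ˢ ball x₀ ε with hO
  have hOo : IsOpen O := isOpen_Ioo.prod isOpen_ball
  have hm0 : (m : WithTop ℕ∞) ≠ 0 := by
    have : m ≠ 0 := (zero_lt_one.trans_le hm).ne'
    exact_mod_cast this
  have hm1 : (1 : WithTop ℕ∞) ≤ m := by exact_mod_cast hm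
  have hz₀ : (t₀, x₀) ∈ O := ⟨⟨by linarith, by linarith⟩, mem_ball_self hε⟩
  set G : ℝ × E → ℝ × E := fun z => (z.1, q z) with hG
  have hGc : ContDiffOn ℝ m G O := contDiffOn_fst.prodMk hq
  have hqd : ∀ z ∈ O, DifferentiableAt ℝ q z := fun z hz =>
    (hq.contDiffAt (hOo.mem_nhds hz)).differentiableAt hm0
  have hGd : ∀ z ∈ O, HasFDerivAt G ((ContinuousLinearMap.fst ℝ ℝ E).prod (fderiv ℝ q z)) z :=
    fun z hz => hasFDerivAt_fst.prodMk (hqd z hz).hasFDerivAt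
  set v₀ := v (t₀, q (t₀, x₀), p (t₀, x₀)) with hv₀
  -- At time `t₀` the map `q` is the identity in space, so the derivative of `G` at the base point
  -- is the shear `(τ, ξ) ↦ (τ, τ • v₀ + ξ)`, which is invertible.
  let e : (ℝ × E) ≃L[ℝ] (ℝ × E) := ContinuousLinearEquiv.equivOfInverse
    ((ContinuousLinearMap.fst ℝ ℝ E).prod
      ((ContinuousLinearMap.fst ℝ ℝ E).smulRight v₀ + ContinuousLinearMap.snd ℝ ℝ E))
    ((ContinuousLinearMap.fst ℝ ℝ E).prod
      (ContinuousLinearMap.snd ℝ ℝ E - (ContinuousLinearMap.fst ℝ ℝ E).smulRight v₀))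
    (fun z => by ext <;> simp) (fun z => by ext <;> simp)
  have hqx : ∀ ξ, fderiv ℝ q (t₀, x₀) (0, ξ) = ξ := by
    intro ξ
    have h1 := (hqd _ hz₀).hasFDerivAt.comp x₀ (hasFDerivAt_prodMk_right (𝕜 := ℝ) t₀ x₀)
    have h2 : (q ∘ fun y => (t₀, y)) =ᶠ[𝓝 x₀] id := by
      filter_upwards [ball_mem_nhds x₀ hε] with y hy
      exact hq0 y hy
    have h3 := h1.unique ((hasFDerivAt_id x₀).congr_of_eventuallyEq h2)
    simpa using congrArg (fun L => L ξ) h3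
  have hGe : HasFDerivAt G (e : ℝ × E →L[ℝ] ℝ × E) (t₀, x₀) := by
    convert! hGd _ hz₀ using 1
    refine ContinuousLinearMap.ext fun ⟨τ, ξ⟩ => Prod.ext rfl ?_
    change τ • v₀ + ξ = fderiv ℝ q (t₀, x₀) (τ, ξ)
    rw [map_prodMk_eq_smul_add, hqx, (hz _ hz₀).2.2]
  have hGe' := hGc.contDiffAt (hOo.mem_nhds hz₀)
  -- Restricting to the open set where the derivative of `G` is invertible makes the inverse `C^m`
  -- at every point of the target, also for `m = ∞`.
  set O' := O ∩ fderiv ℝ G ⁻¹' range ((↑) : ((ℝ × E) ≃L[ℝ] (ℝ × E)) → _) with hO'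
  have hO'o : IsOpen O' := (hGc.continuousOn_fderiv_of_isOpen hOo hm1).isOpen_inter_preimage hOo
    ContinuousLinearEquiv.isOpen
  have hz₀' : (t₀, x₀) ∈ O' := ⟨hz₀, e, hGe.fderiv.symm⟩
  set Θ := (hGe'.toOpenPartialHomeomorph G hGe hm0).restrOpen O' hO'o with hΘ
  have hΘG : ∀ z, Θ z = G z := fun z => rfl
  have hΘs : ∀ z ∈ Θ.source, z ∈ O' := fun z hz => hz.2
  have hsymm : ∀ w ∈ Θ.target, Θ.symm w ∈ O' ∧ (Θ.symm w).1 = w.1 ∧ q (Θ.symm w) = w.2 := by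
    intro w hw
    have h1 : G (Θ.symm w) = w := Θ.right_inv hw
    exact ⟨hΘs _ (Θ.map_target hw), (Prod.ext_iff.1 h1).1, (Prod.ext_iff.1 h1).2⟩
  have hsc : ∀ w ∈ Θ.target, ContDiffAt ℝ m Θ.symm w := by
    intro w hw
    obtain ⟨⟨h1, f, hf⟩, -⟩ := hsymm w hw
    have h2 := hGc.contDiffAt (hOo.mem_nhds h1)
    refine Θ.contDiffAt_symm (f₀' := f) hw ?_ h2
    rw [hf]
    exact (h2.differentiableAt hm0).hasFDerivAt
  have hscO : ContDiffOn ℝ m Θ.symm Θ.target := fun w hw => (hsc w hw).contDiffWithinAt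
  have hmaps : MapsTo Θ.symm Θ.target O := fun w hw => (hsymm w hw).1.1
  have hpc : ContDiffOn ℝ m (fun w => p (Θ.symm w)) Θ.target := hp.comp hscO hmaps
  have hcurve : ∀ w ∈ Θ.target, ((Θ.symm w).1, q (Θ.symm w), p (Θ.symm w)) =
      (w.1, w.2, p (Θ.symm w)) := by
    intro w hw
    rw [(hsymm w hw).2.1, (hsymm w hw).2.2]
  have hinW : ∀ w ∈ Θ.target, (w.1, w.2, p (Θ.symm w)) ∈ W := fun w hw =>
    hcurve w hw ▸ (hz _ (hmaps hw)).1
  -- the derivative of the coordinate change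
  have hsd : ∀ w ∈ Θ.target, ∀ ξ,
      fderiv ℝ G (Θ.symm w) (fderiv ℝ Θ.symm w ξ) = ξ := by
    intro w hw ξ
    have h1 : HasFDerivAt Θ.symm (fderiv ℝ Θ.symm w) w :=
      ((hsc w hw).differentiableAt hm0).hasFDerivAt
    have h2 := (hGd _ (hmaps hw)).comp w h1
    have h3 : G ∘ Θ.symm =ᶠ[𝓝 w] id := by
      filter_upwards [Θ.open_target.mem_nhds hw] with y hy
      exact Θ.right_inv hy
    have h4 := h2.unique ((hasFDerivAt_id w).congr_of_eventuallyEq h3)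
    rw [(hGd _ (hmaps hw)).fderiv]
    exact congrArg (fun L => L ξ) h4
  have hud : ∀ w ∈ Θ.target, HasFDerivAt (fun w => U (Θ.symm w))
      (canonicalForm (p (Θ.symm w)) (H (w.1, w.2, p (Θ.symm w)))) w := by
    intro w hw
    have h1 : HasFDerivAt Θ.symm (fderiv ℝ Θ.symm w) w :=
      ((hsc w hw).differentiableAt hm0).hasFDerivAt
    have h2 := (hz _ (hmaps hw)).2.1.comp w h1
    convert! h2 using 1
    refine ContinuousLinearMap.ext fun ξ => ?_
    have h3 := hsd w hw ξ
    rw [(hGd _ (hmaps hw)).fderiv] at h3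
    have h4 : (fderiv ℝ Θ.symm w ξ).1 = ξ.1 := (Prod.ext_iff.1 h3).1
    have h5 : fderiv ℝ q (Θ.symm w) (fderiv ℝ Θ.symm w ξ) = ξ.2 := (Prod.ext_iff.1 h3).2
    rw [hcurve w hw]
    simp only [canonicalForm_apply, ContinuousLinearMap.comp_apply, sub_apply, smul_apply,
      ContinuousLinearMap.coe_fst', smul_eq_mul]
    rw [h4, h5]
  refine ⟨Θ.symm, fun w => U (Θ.symm w), fun w => p (Θ.symm w), ?_, hscO,
    hGc.mono fun z hz => (hΘs z hz).1, ?_, fun w hw =>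
    ⟨(hsymm w hw).2.1, hinW w hw, hud w hw, ?_⟩⟩
  · have h1 : (t₀, x₀) ∈ Θ.source :=
      ⟨hGe'.mem_toOpenPartialHomeomorph_source hGe hm0, hz₀'⟩
    have h2 := Θ.map_source h1
    rwa [hΘG, show G (t₀, x₀) = (t₀, x₀) from Prod.ext rfl (hq0 x₀ (mem_ball_self hε))] at h2
  · rw [OpenPartialHomeomorph.symm_source]
    -- The gain of a derivative: `U` and `Θ.symm` are only `C^m`, but the differential `p dq - H dt`
    -- of their composition is itself `C^m`.
    refine (contDiffOn_succ_iff_fderiv_of_isOpen Θ.open_target).2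
      ⟨fun w hw => (hud w hw).differentiableAt.differentiableWithinAt, by simp, ?_⟩
    have h1 : ContDiffOn ℝ m (fun w => (w.1, w.2, p (Θ.symm w))) Θ.target :=
      contDiffOn_fst.prodMk (contDiffOn_snd.prodMk hpc)
    have h2 : ContDiffOn ℝ m (fun w => H (w.1, w.2, p (Θ.symm w))) Θ.target :=
      (hH.of_le (by exact_mod_cast le_self_add)).comp h1 hinW
    have h3 : ContDiffOn ℝ m (fun w => canonicalForm (p (Θ.symm w))
        (H (w.1, w.2, p (Θ.symm w)))) Θ.target :=
      (hpc.clm_comp contDiffOn_const).sub (h2.smul contDiffOn_const)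
    exact h3.congr fun w hw => (hud w hw).fderiv
  · obtain ⟨⟨h1, f, hf⟩, -⟩ := hsymm w hw
    have h2 := hsd w hw (1, v (w.1, w.2, p (Θ.symm w)))
    have h3 : fderiv ℝ G (Θ.symm w) (1, 0) = (1, v (w.1, w.2, p (Θ.symm w))) := by
      rw [(hGd _ h1).fderiv]
      refine Prod.ext rfl ?_
      change fderiv ℝ q (Θ.symm w) (1, 0) = _
      rw [(hz _ h1).2.2, hcurve w hw]
    rw [← hf] at h2 h3
    exact f.injective (h2.trans h3.symm)

end HamiltonJacobi

/-! ### Positive forms, curves of zero velocity, and pointwise facts about the data. -/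

lemma ContinuousLinearMap.isInvertible_of_pos {E : Type*} [NormedAddCommGroup E] [NormedSpace ℝ E]
    [FiniteDimensional ℝ E] {B : E →L[ℝ] E →L[ℝ] ℝ} (hB : ∀ v, v ≠ 0 → 0 < B v v) :
    B.IsInvertible := by
  have hinj : Function.Injective B := by
    rw [injective_iff_map_eq_zero]
    intro v hv
    by_contra h
    have := hB v h
    simp [hv] at this
  have hfin : Module.finrank ℝ E = Module.finrank ℝ (E →L[ℝ] ℝ) := by
    rw [← (LinearMap.toContinuousLinearMap (𝕜 := ℝ) (E := E) (F' := ℝ)).finrank_eq]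
    exact Subspace.dual_finrank_eq.symm
  let e := (LinearEquiv.ofInjectiveOfFinrankEq B.toLinearMap hinj hfin).toContinuousLinearEquiv
  exact ⟨e, by ext; rfl⟩

/-- A curve in a manifold with vanishing velocity over a connected open set of times is constant. -/
lemma eqOn_const_of_hasMFDerivAt_zero {E H M : Type*} [NormedAddCommGroup E] [NormedSpace ℝ E]
    [TopologicalSpace H] {I : ModelWithCorners ℝ E H} [TopologicalSpace M] [ChartedSpace H M]
    [IsManifold I 1 M] {J : Set ℝ} (hJ : IsOpen J) (hJ' : IsPreconnected J) {γ : ℝ → M}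
    (hγ : ∀ t ∈ J, HasMFDerivAt 𝓘(ℝ, ℝ) I γ t 0) {s t : ℝ} (hs : s ∈ J) (ht : t ∈ J) :
    γ s = γ t := by
  -- Working with local constancy avoids a closedness argument, so `M` need not be Hausdorff.
  have hloc : IsLocallyConstant (J.domRestrict γ) := by
    rw [IsLocallyConstant.iff_eventually_eq]
    rintro ⟨t, ht⟩
    have hev : ∀ᶠ s in nhds t, s ∈ J ∧ γ s ∈ (chartAt H (γ t)).source :=
      (hJ.eventually_mem ht).and ((hγ t ht).continuousAt.eventually
        ((chartAt H (γ t)).open_source.eventually_mem (mem_chart_source H (γ t))))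
    obtain ⟨ε, hε, hball⟩ := Metric.eventually_nhds_iff_ball.1 hev
    have hd : ∀ s ∈ Metric.ball t ε, HasFDerivAt (extChartAt I (γ t) ∘ γ) (0 : ℝ →L[ℝ] E) s := by
      intro s hs
      have h1 := (hasMFDerivAt_extChartAt (I := I) (hball s hs).2).comp s (hγ s (hball s hs).1)
      rw [hasMFDerivAt_iff_hasFDerivAt] at h1
      exact h1.congr_fderiv (ContinuousLinearMap.comp_zero _)
    have hconst : ∀ s ∈ Metric.ball t ε, γ s = γ t := by
      intro s hs
      have h1 := Metric.isOpen_ball.is_const_of_fderiv_eq_zero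
        (convex_ball t ε).isPreconnected
        (fun s hs => (hd s hs).differentiableAt.differentiableWithinAt)
        (fun s hs => (hd s hs).fderiv) hs (Metric.mem_ball_self hε)
      refine (extChartAt I (γ t)).injOn ?_ ?_ h1
      · rw [extChartAt_source]
        exact (hball s hs).2
      · exact mem_extChartAt_source _
    have : Metric.ball t ε ∈ nhds t := Metric.ball_mem_nhds t hε
    filter_upwards [continuous_subtype_val.continuousAt.preimage_mem_nhds
      (x := (⟨t, ht⟩ : J)) this] with s hs
    exact hconst s hs
  have : PreconnectedSpace J := isPreconnected_iff_preconnectedSpace.1 hJ'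
  exact hloc.apply_eq_of_preconnectedSpace ⟨s, hs⟩ ⟨t, ht⟩

section Data

variable {d : ℕ} {Q : Type*} [TopologicalSpace Q]
  [ChartedSpace (EuclideanSpace ℝ (Fin d)) Q]

/-- The partial derivatives of a function on `ℝ × Q`. -/
lemma hasDerivAt_dq_of_hasMFDerivAt {u : ℝ → Q → ℝ} {t : ℝ} {q : Q}
    {U : ℝ × EuclideanSpace ℝ (Fin d) →L[ℝ] ℝ}
    (hu : HasMFDerivAt (𝓘(ℝ, ℝ).prod (𝓡 d)) 𝓘(ℝ, ℝ) (fun p : ℝ × Q => u p.1 p.2) (t, q) U) :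
    HasDerivAt (fun s => u s q) (U (1, 0)) t ∧ ∀ v, BrinkmannData.dq (d := d) u t q v = U (0, v) := by
  constructor
  · have h1 : HasMFDerivAt 𝓘(ℝ, ℝ) (𝓘(ℝ, ℝ).prod (𝓡 d)) (fun s : ℝ => (s, q)) t
      ((ContinuousLinearMap.id ℝ ℝ).prod (0 : ℝ →L[ℝ] EuclideanSpace ℝ (Fin d))) :=
      (hasMFDerivAt_id t).prodMk (hasMFDerivAt_const q t)
    have h2 := hu.comp t h1
    rw [hasMFDerivAt_iff_hasFDerivAt] at h2
    have h3 : HasFDerivAt (fun s => u s q) (U ∘L ((ContinuousLinearMap.id ℝ ℝ).prod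
      (0 : ℝ →L[ℝ] EuclideanSpace ℝ (Fin d)))) t := h2
    exact h3.hasDerivAt
  · intro v
    have h1 : HasMFDerivAt (𝓡 d) (𝓘(ℝ, ℝ).prod (𝓡 d)) (fun q : Q => (t, q)) q
      ((0 : EuclideanSpace ℝ (Fin d) →L[ℝ] ℝ).prod
        (ContinuousLinearMap.id ℝ (EuclideanSpace ℝ (Fin d)))) :=
      (hasMFDerivAt_const t q).prodMk (hasMFDerivAt_id q)
    have h2 := (hu.comp q h1).mfderiv
    exact congrArg (fun L : EuclideanSpace ℝ (Fin d) →L[ℝ] ℝ => L v) h2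


namespace BrinkmannData

variable [IsManifold (𝓡 d) 1 Q] {r : ℕ∞}

lemma isInvertible_a (D : BrinkmannData d Q r) (t : ℝ) (q : Q) : (D.a t q).IsInvertible :=
  ContinuousLinearMap.isInvertible_of_pos (E := EuclideanSpace ℝ (Fin d)) (D.isMetric.pos t q trivial)

@[simp]
lemma a_sharp (D : BrinkmannData d Q r) (t : ℝ) (q : Q) (p : TangentSpace (𝓡 d) q →L[ℝ] ℝ) :
    D.a t q (D.sharp t q p) = p :=
  (D.isInvertible_a t q).self_apply_inverse p

lemma eq_sharp_iff (D : BrinkmannData d Q r) {t : ℝ} {q : Q} {p : TangentSpace (𝓡 d) q →L[ℝ] ℝ}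
   {v : TangentSpace (𝓡 d) q} : v = D.sharp t q p ↔ D.a t q v = p := by
  refine ⟨fun h => h ▸ D.a_sharp t q p, fun h => ?_⟩
  rw [← h]
  exact ((D.isInvertible_a t q).inverse_apply_self v).symm

end BrinkmannData

end Data

/-- The metric dual of `∂/∂t` in Rosen coordinates is `-dy'`. This single property of the Rosen form
yields both the characteristics and the Hamilton–Jacobi equation. -/
lemma rosenMetric_of_eq {d : ℕ} {Q' : Type*} [TopologicalSpace Q']
    [ChartedSpace (EuclideanSpace ℝ (Fin d)) Q'] (a' : TimeBilin d Q') (x : ℝ × Q' × ℝ) {X : ℝ × EuclideanSpace ℝ (Fin d) × ℝ}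
    (Y : ℝ × EuclideanSpace ℝ (Fin d) × ℝ) (hX : X = (1, 0, 0)) : rosenMetric a' x X Y = -Y.2.2 := by
  subst hX
  have h1 : a' x.1 x.2.1 (0 : EuclideanSpace ℝ (Fin d)) Y.2.1 = 0 :=
    (congrArg (fun L : EuclideanSpace ℝ (Fin d) →L[ℝ] ℝ => L Y.2.1)
      (map_zero (a' x.1 x.2.1))).trans rfl
  change a' x.1 x.2.1 (0 : EuclideanSpace ℝ (Fin d)) Y.2.1 - 1 * Y.2.2 - 0 * Y.1 = _
  rw [h1]
  ring

/-! ### From Rosen coordinates to a Hamilton–Jacobi solution. -/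

section RosenToHamiltonJacobi

open Set Filter Topology

variable {d : ℕ} {Q : Type*} [TopologicalSpace Q] [ChartedSpace (EuclideanSpace ℝ (Fin d)) Q]
  [IsManifold (𝓡 d) 1 Q] {Q' : Type*} [TopologicalSpace Q']
  [ChartedSpace (EuclideanSpace ℝ (Fin d)) Q'] [IsManifold (𝓡 d) 1 Q'] {r : ℕ∞}

/-- The tangent space of the spacetime at any of its points. -/
local notation "𝕋" => ℝ × EuclideanSpace ℝ (Fin d) × ℝ

namespace BrinkmannData

/-- The velocity of the curves of constant `(q', y')`. -/
noncomputable def rosenTime (Φ : OpenPartialHomeomorph (ℝ × Q × ℝ) (ℝ × Q' × ℝ))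
    (x : ℝ × Q × ℝ) : 𝕋 :=
  (mfderiv (spacetimeModel d) (spacetimeModel d) Φ.symm (Φ x) : 𝕋 →L[ℝ] 𝕋) (1, 0, 0)

/-- The function `u` with `y' = y - u`. -/
def rosenAction (Φ : OpenPartialHomeomorph (ℝ × Q × ℝ) (ℝ × Q' × ℝ)) (t : ℝ) (q : Q) : ℝ :=
  -(Φ (t, q, 0)).2.2

variable {D : BrinkmannData d Q r} {k l : ℕ∞}
  {Φ : OpenPartialHomeomorph (ℝ × Q × ℝ) (ℝ × Q' × ℝ)} {a' : TimeBilin d Q'} {I : Set ℝ}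

lemma IsRosen.mdifferentiable (h : D.IsRosen k l Φ a') (hk : 1 ≤ k) :
    Φ.MDifferentiable (spacetimeModel d) (spacetimeModel d) := by
  have hk' : (k : WithTop ℕ∞) ≠ 0 := by
    have : k ≠ 0 := (zero_lt_one.trans_le hk).ne'
    exact_mod_cast this
  exact ⟨h.contMDiffOn.mdifferentiableOn hk', h.contMDiffOn_symm.mdifferentiableOn hk'⟩

lemma IsRosen.mfderiv_rosenTime (h : D.IsRosen k l Φ a') (hk : 1 ≤ k) {x : ℝ × Q × ℝ}
    (hx : x ∈ Φ.source) :
    (mfderiv (spacetimeModel d) (spacetimeModel d) Φ x : 𝕋 →L[ℝ] 𝕋) (rosenTime (d := d) Φ x) =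
      (1, 0, 0) := by
  have h1 := (h.mdifferentiable hk).comp_symm_deriv (Φ.map_source hx)
  rw [Φ.left_inv hx] at h1
  exact congrArg (fun L : 𝕋 →L[ℝ] 𝕋 => L (1, 0, 0)) h1

/-- Along a `y`-line, which lies entirely in the source, the image moves with velocity `∂/∂y'`;
hence `q'` and `y' - y` stay constant. -/
lemma IsRosen.apply_eq (h : D.IsRosen k l Φ a') (hk : 1 ≤ k) (hs : Φ.source = {x | x.1 ∈ I})
    {t : ℝ} (ht : t ∈ I) (q : Q) (y : ℝ) :
    Φ (t, q, y) = (t, (Φ (t, q, 0)).2.1, y - rosenAction Φ t q) := by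
  have hmem : ∀ y, (t, q, y) ∈ Φ.source := fun y => by rw [hs]; exact ht
  have hline : ∀ y, HasMFDerivAt 𝓘(ℝ, ℝ) (spacetimeModel d) (fun y : ℝ => Φ (t, q, y)) y
      ((ContinuousLinearMap.toSpanSingleton ℝ ((0, 0, 1) : 𝕋)) : ℝ →L[ℝ] 𝕋) := by
    intro y
    have h1 : HasMFDerivAt 𝓘(ℝ, ℝ) (spacetimeModel d) (fun y : ℝ => (t, q, y)) y
        ((0 : ℝ →L[ℝ] ℝ).prod ((0 : ℝ →L[ℝ] EuclideanSpace ℝ (Fin d)).prod (.id ℝ ℝ))) :=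
      (hasMFDerivAt_const t y).prodMk ((hasMFDerivAt_const q y).prodMk (hasMFDerivAt_id y))
    have h2 := ((h.mdifferentiable hk).mdifferentiableAt (hmem y)).hasMFDerivAt.comp y h1
    refine h2.congr_mfderiv (ContinuousLinearMap.ext_ring ?_)
    have h3 := h.killing _ (hmem y)
    refine Eq.trans ?_ (h3.trans ?_)
    · rfl
    · exact (one_smul ℝ ((0, 0, 1) : 𝕋)).symm
  have hq : (Φ (t, q, y)).2.1 = (Φ (t, q, 0)).2.1 := by
    refine eqOn_const_of_hasMFDerivAt_zero (I := 𝓡 d) isOpen_univ isPreconnected_univ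
      (γ := fun y => (Φ (t, q, y)).2.1) (fun s _ => ?_) (mem_univ y) (mem_univ 0)
    have h1 := (hasMFDerivAt_fst (I := 𝓡 d) (I' := 𝓘(ℝ, ℝ)) (Φ (t, q, s)).2).comp s
      ((hasMFDerivAt_snd (I := 𝓘(ℝ, ℝ)) (I' := (𝓡 d).prod 𝓘(ℝ, ℝ)) (Φ (t, q, s))).comp s (hline s))
    refine h1.congr_mfderiv (ContinuousLinearMap.ext_ring ?_)
    exact smul_zero (1 : ℝ)
  have hy : (Φ (t, q, y)).2.2 = y - rosenAction Φ t q := by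
    have hd : ∀ y, HasDerivAt (fun y => (Φ (t, q, y)).2.2 - y) 0 y := by
      intro s
      have h1 := (hasMFDerivAt_snd (I := 𝓡 d) (I' := 𝓘(ℝ, ℝ)) (Φ (t, q, s)).2).comp s
        ((hasMFDerivAt_snd (I := 𝓘(ℝ, ℝ)) (I' := (𝓡 d).prod 𝓘(ℝ, ℝ)) (Φ (t, q, s))).comp s
          (hline s))
      rw [hasMFDerivAt_iff_hasFDerivAt] at h1
      have h2 : HasFDerivAt (fun y => (Φ (t, q, y)).2.2)
        ((ContinuousLinearMap.snd ℝ _ ℝ) ∘L (ContinuousLinearMap.snd ℝ ℝ _) ∘L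
          (ContinuousLinearMap.toSpanSingleton ℝ ((0, 0, 1) : 𝕋))) s := h1
      have h3 := h2.hasDerivAt.sub (hasDerivAt_id' s)
      convert! h3 using 1
      simp
    have := is_const_of_deriv_eq_zero (fun y => (hd y).differentiableAt)
      (fun y => (hd y).deriv) y 0
    simp only [rosenAction]
    linarith
  exact Prod.ext (h.time _ (hmem y)) (Prod.ext hq hy)

lemma IsRosen.mdifferentiableAt_rosenAction (h : D.IsRosen k l Φ a') (hk : 1 ≤ k)
    (hs : Φ.source = {x | x.1 ∈ I}) {t : ℝ} (ht : t ∈ I) (q : Q) :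
    MDifferentiableAt (𝓘(ℝ, ℝ).prod (𝓡 d)) 𝓘(ℝ, ℝ)
      (fun p : ℝ × Q => rosenAction Φ p.1 p.2) (t, q) := by
  have hmem : (t, q, (0 : ℝ)) ∈ Φ.source := by rw [hs]; exact ht
  have h1 : MDifferentiableAt (𝓘(ℝ, ℝ).prod (𝓡 d)) (spacetimeModel d)
      (fun p : ℝ × Q => (p.1, p.2, (0 : ℝ))) (t, q) :=
    mdifferentiableAt_fst.prodMk (mdifferentiableAt_snd.prodMk mdifferentiableAt_const)
  have h2 := ((h.mdifferentiable hk).mdifferentiableAt hmem).comp (t, q) h1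
  exact ((mdifferentiableAt_snd (I := 𝓡 d) (I' := 𝓘(ℝ, ℝ))).comp (t, q)
    ((mdifferentiableAt_snd (I := 𝓘(ℝ, ℝ)) (I' := (𝓡 d).prod 𝓘(ℝ, ℝ))).comp (t, q) h2)).neg

/-- The differentials of the coordinates `t` and `y'`. -/
lemma IsRosen.mfderiv_apply (h : D.IsRosen k l Φ a') (hk : 1 ≤ k)
    (hs : Φ.source = {x | x.1 ∈ I}) {t : ℝ} (ht : t ∈ I) (q : Q) (y : ℝ)
    {U : ℝ × EuclideanSpace ℝ (Fin d) →L[ℝ] ℝ}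
    (hU : HasMFDerivAt (𝓘(ℝ, ℝ).prod (𝓡 d)) 𝓘(ℝ, ℝ)
      (fun p : ℝ × Q => rosenAction Φ p.1 p.2) (t, q) U) (Y : 𝕋) :
    ((mfderiv (spacetimeModel d) (spacetimeModel d) Φ (t, q, y) : 𝕋 →L[ℝ] 𝕋) Y).1 = Y.1 ∧
    ((mfderiv (spacetimeModel d) (spacetimeModel d) Φ (t, q, y) : 𝕋 →L[ℝ] 𝕋) Y).2.2 =
      Y.2.2 - U (Y.1, Y.2.1) := by
  have hmem : (t, q, y) ∈ Φ.source := by rw [hs]; exact ht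
  have hev : ∀ᶠ x in 𝓝 (t, q, y), x ∈ Φ.source := Φ.open_source.eventually_mem hmem
  have hΦ := ((h.mdifferentiable hk).mdifferentiableAt hmem).hasMFDerivAt
  constructor
  · have h1 := (hasMFDerivAt_fst (I := 𝓘(ℝ, ℝ)) (I' := (𝓡 d).prod 𝓘(ℝ, ℝ))
      (Φ (t, q, y))).comp (t, q, y) hΦ
    have h2 := (hasMFDerivAt_fst (I := 𝓘(ℝ, ℝ)) (I' := (𝓡 d).prod 𝓘(ℝ, ℝ))
      (t, q, y)).congr_of_eventuallyEq (f₁ := Prod.fst ∘ Φ) (hev.mono fun x hx => h.time x hx)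
    exact congrArg (fun L : 𝕋 →L[ℝ] ℝ => L Y) (hasMFDerivAt_unique h1 h2)
  · have h1 := (hasMFDerivAt_snd (I := 𝓡 d) (I' := 𝓘(ℝ, ℝ)) (Φ (t, q, y)).2).comp (t, q, y)
      ((hasMFDerivAt_snd (I := 𝓘(ℝ, ℝ)) (I' := (𝓡 d).prod 𝓘(ℝ, ℝ))
        (Φ (t, q, y))).comp (t, q, y) hΦ)
    have h3 : HasMFDerivAt (spacetimeModel d) (𝓘(ℝ, ℝ).prod (𝓡 d))
        (fun x : ℝ × Q × ℝ => (x.1, x.2.1)) (t, q, y)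
        ((ContinuousLinearMap.fst ℝ ℝ (EuclideanSpace ℝ (Fin d) × ℝ)).prod
          (ContinuousLinearMap.fst ℝ (EuclideanSpace ℝ (Fin d)) ℝ ∘L
            ContinuousLinearMap.snd ℝ ℝ (EuclideanSpace ℝ (Fin d) × ℝ))) :=
      (hasMFDerivAt_fst (t, q, y)).prodMk
        ((hasMFDerivAt_fst (q, y)).comp (t, q, y) (hasMFDerivAt_snd (t, q, y)))
    have h4 : HasMFDerivAt (spacetimeModel d) 𝓘(ℝ, ℝ) (fun x : ℝ × Q × ℝ => x.2.2) (t, q, y)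
        (ContinuousLinearMap.snd ℝ (EuclideanSpace ℝ (Fin d)) ℝ ∘L
          ContinuousLinearMap.snd ℝ ℝ (EuclideanSpace ℝ (Fin d) × ℝ)) :=
      (hasMFDerivAt_snd (q, y)).comp (t, q, y) (hasMFDerivAt_snd (t, q, y))
    have h5 := (h4.sub (hU.comp (t, q, y) h3)).congr_of_eventuallyEq
      (f₁ := Prod.snd ∘ Prod.snd ∘ Φ) (hev.mono fun x hx => by
        have hx' : x.1 ∈ I := by rwa [hs] at hx
        simp [h.apply_eq hk hs hx' x.2.1 x.2.2])
    exact congrArg (fun L : 𝕋 →L[ℝ] ℝ => L Y) (hasMFDerivAt_unique h1 h5)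

/-- With `N = rosenTime`, the identity `g(N, ·) = -dy' = -(dy - du)` is tested on vectors tangent to
`Q`, which determines the projection of `N`, and then on `∂/∂t`, which gives the equation. -/
lemma IsRosen.characteristic_and_equation (h : D.IsRosen k l Φ a') (hk : 1 ≤ k)
    (hs : Φ.source = {x | x.1 ∈ I}) {t : ℝ} (ht : t ∈ I) (q : Q) (y : ℝ) :
    (rosenTime (d := d) Φ (t, q, y)).1 = 1 ∧
    (rosenTime (d := d) Φ (t, q, y)).2.1 = D.sharp t q (dq (rosenAction Φ) t q - D.b t q) ∧
    deriv (fun s => rosenAction Φ s q) t + D.hamiltonian t q (dq (rosenAction Φ) t q) = 0 := by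
  have hmem : (t, q, y) ∈ Φ.source := by rw [hs]; exact ht
  have hU := (h.mdifferentiableAt_rosenAction hk hs ht q).hasMFDerivAt
  generalize mfderiv (𝓘(ℝ, ℝ).prod (𝓡 d)) 𝓘(ℝ, ℝ)
    (fun p : ℝ × Q => rosenAction Φ p.1 p.2) (t, q) = U at hU
  change ℝ × EuclideanSpace ℝ (Fin d) →L[ℝ] ℝ at U
  obtain ⟨hUt, hUq⟩ := hasDerivAt_dq_of_hasMFDerivAt hU
  have hd := h.mfderiv_apply hk hs ht q y hU
  have hN := h.mfderiv_rosenTime hk hmem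
  set N := rosenTime (d := d) Φ (t, q, y) with hNdef
  obtain ⟨hN1, hN2⟩ := hd N
  rw [hN] at hN1 hN2
  have hmet : ∀ Y : 𝕋, D.metric (t, q, y) N Y = -(Y.2.2 - U (Y.1, Y.2.1)) := by
    intro Y
    rw [← (hd Y).2]
    exact (h.metric_eq _ hmem N Y).trans (rosenMetric_of_eq a' _ _ hN)
  have hmet' : ∀ (s : ℝ) (v : EuclideanSpace ℝ (Fin d)) (y : ℝ),
      D.a t q N.2.1 v - 1 * (y - D.b t q v) - (N.2.2 - D.b t q N.2.1) * s
        - 2 * D.V t q * (1 * s) = -(y - U (s, v)) := by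
    intro s v y
    have h1 : D.a t q N.2.1 v - N.1 * (y - D.b t q v) - (N.2.2 - D.b t q N.2.1) * s
        - 2 * D.V t q * (N.1 * s) = -(y - U (s, v)) := hmet (s, v, y)
    rwa [← hN1] at h1
  have hZ : N.2.1 = D.sharp t q (dq (d := d) (rosenAction Φ) t q - D.b t q) := by
    refine D.eq_sharp_iff.2 (ContinuousLinearMap.ext fun v => ?_)
    have h1 := hmet' 0 v 0
    have h2 := hUq v
    have h3 : (dq (d := d) (rosenAction Φ) t q - D.b t q) v =
      dq (d := d) (rosenAction Φ) t q v - D.b t q v := rfl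
    rw [h3, h2]
    linarith
  refine ⟨hN1.symm, hZ, ?_⟩
  have h1 := hmet' 1 0 0
  -- This is `dy'(N) = 0`; it removes the unknown `y`-component of `N` and leaves twice the
  -- Hamilton–Jacobi equation.
  have h2 : N.2.2 = U (1, N.2.1) := by
    have h3 : (0 : ℝ) = N.2.2 - U (N.1, N.2.1) := hN2
    rw [← hN1] at h3
    change (0 : ℝ) = N.2.2 - U (1, N.2.1) at h3
    linarith
  have h4 : U (1, N.2.1) = U (1, 0) + U (0, N.2.1) := by
    rw [← map_add]
    simp
  have h5 : D.a t q N.2.1 (0 : EuclideanSpace ℝ (Fin d)) = 0 := map_zero (D.a t q N.2.1)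
  have h6 : D.b t q (0 : EuclideanSpace ℝ (Fin d)) = 0 := map_zero (D.b t q)
  have h7 : (dq (d := d) (rosenAction Φ) t q - D.b t q) N.2.1 =
    dq (d := d) (rosenAction Φ) t q N.2.1 - D.b t q N.2.1 := rfl
  have h8 : dq (d := d) (rosenAction Φ) t q N.2.1 = U (0, N.2.1) := hUq N.2.1
  rw [hamiltonian, ← hZ, h7, hUt.deriv, h8]
  rw [h5, h6] at h1
  linarith

/-- The curve of constant `(q', y')` through the point `(t, q, 0)`. -/
def rosenCurve (Φ : OpenPartialHomeomorph (ℝ × Q × ℝ) (ℝ × Q' × ℝ)) (t : ℝ) (q : Q) (s : ℝ) : Q :=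
  (Φ.symm (s, (Φ (t, q, 0)).2)).2.1

/-- The velocity of a curve of constant `(q', y')` is `rosenTime`, whose projection to `Q` is the
characteristic field. The curve exists over all of `I` because the target is all of `I × Q' × ℝ`. -/
lemma IsRosen.isBaseCharacteristicOn_rosenCurve (h : D.IsRosen k l Φ a') (hk : 1 ≤ k)
    (hs : Φ.source = {x | x.1 ∈ I}) (ht : Φ.target = {x | x.1 ∈ I}) (t : ℝ) (q : Q) :
    D.IsBaseCharacteristicOn (rosenAction Φ) I (rosenCurve Φ t q) := by
  intro s hsI
  set c := (Φ (t, q, 0)).2 with hc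
  have hmem : (s, c) ∈ Φ.target := by rw [ht]; exact hsI
  have htime : (Φ.symm (s, c)).1 = s := by
    have h1 := h.time _ (Φ.map_target hmem)
    rw [Φ.right_inv hmem] at h1
    exact h1.symm
  have hx : Φ.symm (s, c) = (s, rosenCurve Φ t q s, (Φ.symm (s, c)).2.2) :=
    Prod.ext htime rfl
  have h1 : HasMFDerivAt 𝓘(ℝ, ℝ) (spacetimeModel d) (fun s : ℝ => (s, c)) s
      ((ContinuousLinearMap.id ℝ ℝ).prod (0 : ℝ →L[ℝ] EuclideanSpace ℝ (Fin d) × ℝ)) :=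
    (hasMFDerivAt_id s).prodMk (hasMFDerivAt_const c s)
  have h2 := ((h.mdifferentiable hk).mdifferentiableAt_symm hmem).hasMFDerivAt.comp s h1
  have h3 := (hasMFDerivAt_fst (I := 𝓡 d) (I' := 𝓘(ℝ, ℝ)) (Φ.symm (s, c)).2).comp s
    ((hasMFDerivAt_snd (I := 𝓘(ℝ, ℝ)) (I' := (𝓡 d).prod 𝓘(ℝ, ℝ)) (Φ.symm (s, c))).comp s h2)
  have h4 := (h.characteristic_and_equation hk hs hsI (rosenCurve Φ t q s)
    (Φ.symm (s, c)).2.2).2.1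
  rw [← hx] at h4
  have h5 : rosenTime (d := d) Φ (Φ.symm (s, c)) =
      (mfderiv (spacetimeModel d) (spacetimeModel d) Φ.symm (s, c) : 𝕋 →L[ℝ] 𝕋) (1, 0, 0) := by
    rw [rosenTime, Φ.right_inv hmem]
  rw [h5] at h4
  refine HasMFDerivAt.congr_mfderiv h3 (ContinuousLinearMap.ext_ring ?_)
  exact h4.trans (one_smul ℝ _).symm

/-- The coordinate `q'` has zero velocity along any base characteristic. This replaces uniqueness
for differential equations, which would not be available when the coordinates are `C^1` and the
field is merely continuous. -/
lemma IsRosen.eqOn_rosenCurve (h : D.IsRosen k l Φ a') (hk : 1 ≤ k)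
    (hs : Φ.source = {x | x.1 ∈ I}) {J : Set ℝ} (hJI : J ⊆ I) (hJ : IsOpen J)
    (hJ' : J.OrdConnected) {γ : ℝ → Q} (hγ : D.IsBaseCharacteristicOn (rosenAction Φ) J γ)
    {t : ℝ} (ht : t ∈ J) : EqOn (rosenCurve Φ t (γ t)) γ J := by
  have hmem : ∀ s ∈ J, ∀ q y, (s, q, y) ∈ Φ.source := fun s hs' q y => by
    rw [hs]; exact hJI hs'
  have hconst : ∀ s ∈ J, (Φ (s, γ s, 0)).2.1 = (Φ (t, γ t, 0)).2.1 := by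
    intro s hsJ
    refine eqOn_const_of_hasMFDerivAt_zero (I := 𝓡 d) hJ hJ'.isPreconnected
      (γ := fun s => (Φ (s, γ s, 0)).2.1) (fun s hsJ => ?_) hsJ ht
    obtain ⟨hN1, hN2, -⟩ := h.characteristic_and_equation hk hs (hJI hsJ) (γ s) 0
    have hN := h.mfderiv_rosenTime hk (hmem s hsJ (γ s) 0)
    set N := rosenTime (d := d) Φ (s, γ s, 0) with hNdef
    have h1 : HasMFDerivAt 𝓘(ℝ, ℝ) (spacetimeModel d) (fun s : ℝ => (s, γ s, (0 : ℝ))) s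
        ((ContinuousLinearMap.id ℝ ℝ).prod ((ContinuousLinearMap.toSpanSingleton ℝ N.2.1 :
          ℝ →L[ℝ] EuclideanSpace ℝ (Fin d)).prod (0 : ℝ →L[ℝ] ℝ))) := by
      rw [hN2]
      exact (hasMFDerivAt_id s).prodMk ((hγ s hsJ).prodMk (hasMFDerivAt_const 0 s))
    have h2 := ((h.mdifferentiable hk).mdifferentiableAt
      (hmem s hsJ (γ s) 0)).hasMFDerivAt.comp s h1
    have h3 := (hasMFDerivAt_fst (I := 𝓡 d) (I' := 𝓘(ℝ, ℝ)) (Φ (s, γ s, 0)).2).comp s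
      ((hasMFDerivAt_snd (I := 𝓘(ℝ, ℝ)) (I' := (𝓡 d).prod 𝓘(ℝ, ℝ)) (Φ (s, γ s, 0))).comp s h2)
    refine HasMFDerivAt.congr_mfderiv h3 (ContinuousLinearMap.ext_ring ?_)
    have hk0 := h.killing _ (hmem s hsJ (γ s) 0)
    set L : 𝕋 →L[ℝ] 𝕋 := mfderiv (spacetimeModel d) (spacetimeModel d) Φ (s, γ s, 0) with hL
    change L N = (1, 0, 0) at hN
    change L (0, 0, 1) = (0, 0, 1) at hk0
    -- The lift of the characteristic to `y = 0` has a velocity differing from `N` by a multiple of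
    -- `∂/∂y`, which does not move `q'`.
    have h4 : L (1, (1 : ℝ) • N.2.1, 0) = L N - N.2.2 • L (0, 0, 1) := by
      rw [← map_smul, ← map_sub]
      congr 1
      ext <;> simp [hN1]
    have h5 : (L (1, (1 : ℝ) • N.2.1, 0)).2.1 = 0 := by
      rw [h4, hN, hk0]
      simp
    exact h5
  intro s hsJ
  have h1 : Φ (s, γ s, (Φ (t, γ t, 0)).2.2 + rosenAction Φ s (γ s)) =
      (s, (Φ (t, γ t, 0)).2) := by
    rw [h.apply_eq hk hs (hJI hsJ)]
    refine Prod.ext rfl (Prod.ext (hconst s hsJ) ?_)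
    simp
  have h2 := Φ.left_inv (hmem s hsJ (γ s) ((Φ (t, γ t, 0)).2.2 + rosenAction Φ s (γ s)))
  rw [h1] at h2
  simp only [rosenCurve]
  rw [h2]

/-- The function `u` is `-y'` on the slice `y = 0`, so its class is that of `y'` alone and may
exceed that of `Φ`. -/
lemma IsRosen.isHJSolutionOn (h : D.IsRosen k l Φ a') (hk : 1 ≤ k)
    (hs : Φ.source = {x | x.1 ∈ I}) : D.IsHJSolutionOn l I (rosenAction Φ) where
  contMDiffOn := by
    have h1 : ContMDiff (𝓘(ℝ, ℝ).prod (𝓡 d)) (spacetimeModel d) (l : WithTop ℕ∞)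
        (fun p : ℝ × Q => (p.1, p.2, (0 : ℝ))) :=
      contMDiff_fst.prodMk (contMDiff_snd.prodMk contMDiff_const)
    exact (h.contMDiffOn_y.comp h1.contMDiffOn (fun p hp => by rw [hs]; exact hp.1)).neg
  equation t ht q := (h.characteristic_and_equation hk hs ht q 0).2.2

lemma IsRosen.characteristicsDefinedOn (h : D.IsRosen k l Φ a') (hk : 1 ≤ k)
    (hs : Φ.source = {x | x.1 ∈ I}) (ht : Φ.target = {x | x.1 ∈ I}) :
    D.CharacteristicsDefinedOn I (rosenAction Φ) := by
  refine ⟨fun t htI q => ⟨rosenCurve Φ t q, h.isBaseCharacteristicOn_rosenCurve hk hs ht t q, ?_⟩,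
    fun J hJI hJ hJ' γ hγ => ?_⟩
  · have hmem : (t, q, (0 : ℝ)) ∈ Φ.source := by rw [hs]; exact htI
    have h1 : (t, (Φ (t, q, 0)).2) = Φ (t, q, 0) := Prod.ext (h.time _ hmem).symm rfl
    simp only [rosenCurve]
    rw [h1, Φ.left_inv hmem]
  · rcases J.eq_empty_or_nonempty with rfl | ⟨t, htJ⟩
    · exact ⟨_, h.isBaseCharacteristicOn_rosenCurve hk hs ht 0 (γ 0), fun s hs => hs.elim⟩
    · exact ⟨_, h.isBaseCharacteristicOn_rosenCurve hk hs ht t (γ t),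
        h.eqOn_rosenCurve hk hs hJI hJ hJ' hγ htJ⟩

theorem HasRosen.hasHJSolution {Q : Type u} [TopologicalSpace Q]
    [ChartedSpace (EuclideanSpace ℝ (Fin d)) Q] [IsManifold (𝓡 d) 1 Q] {D : BrinkmannData d Q r}
    (hk : 1 ≤ k) (h : D.HasRosen k l I) : D.HasHJSolution l I := by
  obtain ⟨Q', _, _, _, _, Φ, a', hs, ht, hΦ⟩ := h
  exact ⟨rosenAction Φ, hΦ.isHJSolutionOn hk hs, hΦ.characteristicsDefinedOn hk hs ht⟩

end BrinkmannData

end RosenToHamiltonJacobi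

lemma contMDiff_timeSpace {d : ℕ} {Q : Type*} [TopologicalSpace Q]
    [ChartedSpace (EuclideanSpace ℝ (Fin d)) Q] {n : WithTop ℕ∞} :
    ContMDiff (spacetimeModel d) (𝓘(ℝ, ℝ).prod (𝓡 d)) n (fun x : ℝ × Q × ℝ => (x.1, x.2.1)) :=
  contMDiff_fst.prodMk (contMDiff_fst.comp contMDiff_snd)

lemma contMDiff_snd_snd {d : ℕ} {Q : Type*} [TopologicalSpace Q]
    [ChartedSpace (EuclideanSpace ℝ (Fin d)) Q] {n : WithTop ℕ∞} :
    ContMDiff (spacetimeModel d) 𝓘(ℝ, ℝ) n (fun x : ℝ × Q × ℝ => x.2.2) :=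
  contMDiff_snd.comp contMDiff_snd

/-! ### Rosen form of the metric from a solution and coordinates constant along its characteristics.
-/

section RosenOfSolution

open Set Filter Topology

variable {d : ℕ} {Q : Type*} [TopologicalSpace Q] [ChartedSpace (EuclideanSpace ℝ (Fin d)) Q]
  [IsManifold (𝓡 d) 1 Q] {Q' : Type*} [TopologicalSpace Q']
  [ChartedSpace (EuclideanSpace ℝ (Fin d)) Q'] [IsManifold (𝓡 d) 1 Q'] {r : ℕ∞}

/-- The fibrewise derivative, jointly in `(t, q)`, of a time dependent map. -/
lemma ContMDiffOn.fibreDerivative {f : ℝ × Q' → Q} {m n : WithTop ℕ∞} {O : Set (ℝ × Q')}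
    (hO : IsOpen O) (hf : ContMDiffOn (𝓘(ℝ, ℝ).prod (𝓡 d)) (𝓡 d) n f O) (hmn : m + 1 ≤ n) :
    ContMDiffOn (𝓘(ℝ, ℝ).prod (𝓡 d).tangent) (𝓡 d).tangent m
      (fun p : ℝ × TangentBundle (𝓡 d) Q' =>
        (⟨f (p.1, p.2.proj), (mfderiv (𝓘(ℝ, ℝ).prod (𝓡 d)) (𝓡 d) f (p.1, p.2.proj) :
          ℝ × EuclideanSpace ℝ (Fin d) →L[ℝ] EuclideanSpace ℝ (Fin d)) (0, p.2.snd)⟩ :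
          TangentBundle (𝓡 d) Q))
      {p | (p.1, p.2.proj) ∈ O} := by
  have h1 : ContMDiff (𝓘(ℝ, ℝ).prod (𝓡 d).tangent) (𝓘(ℝ, ℝ).tangent.prod (𝓡 d).tangent) m
      (fun p : ℝ × TangentBundle (𝓡 d) Q' =>
        ((⟨p.1, 0⟩ : TangentBundle 𝓘(ℝ, ℝ) ℝ), p.2)) :=
    ((Bundle.contMDiff_zeroSection ℝ (TangentSpace 𝓘(ℝ, ℝ) : ℝ → Type _)).comp
      contMDiff_fst).prodMk contMDiff_snd
  have h2 := (contMDiff_equivTangentBundleProd_symm (I := 𝓘(ℝ, ℝ)) (M := ℝ) (I' := 𝓡 d)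
    (M' := Q') (n := m)).comp h1
  have h3 := hf.contMDiffOn_tangentMapWithin hmn hO.uniqueMDiffOn
  refine (h3.comp h2.contMDiffOn (fun p hp => hp)).congr fun p hp => ?_
  have e : mfderivWithin (𝓘(ℝ, ℝ).prod (𝓡 d)) (𝓡 d) f O (p.1, p.2.proj) =
      mfderiv (𝓘(ℝ, ℝ).prod (𝓡 d)) (𝓡 d) f (p.1, p.2.proj) := mfderivWithin_of_isOpen hO hp
  exact congrArg (fun L : ℝ × EuclideanSpace ℝ (Fin d) →L[ℝ] EuclideanSpace ℝ (Fin d) =>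
    (⟨f (p.1, p.2.proj), L (0, p.2.snd)⟩ : TangentBundle (𝓡 d) Q)) e.symm

namespace BrinkmannData

/-- The space part of the inverse of a time preserving change of coordinates. -/
def spaceInverse (Ψ : OpenPartialHomeomorph (ℝ × Q) (ℝ × Q')) (z : ℝ × Q') : Q := (Ψ.symm z).2

/-- The derivative of `q' ↦ q` at constant time. -/
noncomputable def spaceInverseDeriv (Ψ : OpenPartialHomeomorph (ℝ × Q) (ℝ × Q')) (t : ℝ)
    (q' : Q') : EuclideanSpace ℝ (Fin d) →L[ℝ] EuclideanSpace ℝ (Fin d) :=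
  (mfderiv (𝓘(ℝ, ℝ).prod (𝓡 d)) (𝓡 d) (spaceInverse Ψ) (t, q') :
    ℝ × EuclideanSpace ℝ (Fin d) →L[ℝ] EuclideanSpace ℝ (Fin d)) ∘L
    ContinuousLinearMap.inr ℝ ℝ (EuclideanSpace ℝ (Fin d))

/-- The space metric in the coordinates `(t, q')`. -/
noncomputable def pulledBackMetric (D : BrinkmannData d Q r)
    (Ψ : OpenPartialHomeomorph (ℝ × Q) (ℝ × Q')) : TimeBilin d Q' := fun t q' =>
  ContinuousLinearMap.bilinearComp
    (D.a t (spaceInverse Ψ (t, q')) :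
      EuclideanSpace ℝ (Fin d) →L[ℝ] EuclideanSpace ℝ (Fin d) →L[ℝ] ℝ)
    (spaceInverseDeriv (d := d) Ψ t q') (spaceInverseDeriv (d := d) Ψ t q')

lemma pulledBackMetric_apply (D : BrinkmannData d Q r)
    (Ψ : OpenPartialHomeomorph (ℝ × Q) (ℝ × Q')) (t : ℝ) (q' : Q')
    (v w : EuclideanSpace ℝ (Fin d)) :
    D.pulledBackMetric Ψ t q' v w = D.a t (spaceInverse Ψ (t, q'))
      (spaceInverseDeriv (d := d) Ψ t q' v) (spaceInverseDeriv (d := d) Ψ t q' w) := rfl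

/-- The change of coordinates `(t, q, y) ↦ (t, q', y - u)`. -/
def rosenCoordinates (Ψ : OpenPartialHomeomorph (ℝ × Q) (ℝ × Q')) (u : ℝ → Q → ℝ)
    (hu : ContinuousOn (fun z : ℝ × Q => u z.1 z.2) Ψ.source) :
    OpenPartialHomeomorph (ℝ × Q × ℝ) (ℝ × Q' × ℝ) where
  toFun x := ((Ψ (x.1, x.2.1)).1, (Ψ (x.1, x.2.1)).2, x.2.2 - u x.1 x.2.1)
  invFun x := ((Ψ.symm (x.1, x.2.1)).1, (Ψ.symm (x.1, x.2.1)).2,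
    x.2.2 + u (Ψ.symm (x.1, x.2.1)).1 (Ψ.symm (x.1, x.2.1)).2)
  source := {x | (x.1, x.2.1) ∈ Ψ.source}
  target := {x | (x.1, x.2.1) ∈ Ψ.target}
  map_source' x hx := Ψ.map_source hx
  map_target' x hx := Ψ.map_target hx
  left_inv' x hx := by
    change (x.1, x.2.1) ∈ Ψ.source at hx
    simp [Ψ.left_inv hx]
  right_inv' x hx := by
    change (x.1, x.2.1) ∈ Ψ.target at hx
    simp [Ψ.right_inv hx]
  open_source := Ψ.open_source.preimage (by fun_prop)
  open_target := Ψ.open_target.preimage (by fun_prop)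
  continuousOn_toFun := by
    have hp : ContinuousOn (fun x : ℝ × Q × ℝ => (x.1, x.2.1)) {x | (x.1, x.2.1) ∈ Ψ.source} := by
      fun_prop
    have h1 := Ψ.continuousOn.comp hp (fun x hx => hx)
    exact (continuous_fst.comp_continuousOn h1).prodMk
      ((continuous_snd.comp_continuousOn h1).prodMk
        ((by fun_prop : Continuous fun x : ℝ × Q × ℝ => x.2.2).continuousOn.sub
          (hu.comp hp (fun x hx => hx))))
  continuousOn_invFun := by
    have hp : ContinuousOn (fun x : ℝ × Q' × ℝ => (x.1, x.2.1)) {x | (x.1, x.2.1) ∈ Ψ.target} := by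
      fun_prop
    have h1 := Ψ.symm.continuousOn.comp hp (fun x hx => hx)
    exact (continuous_fst.comp_continuousOn h1).prodMk
      ((continuous_snd.comp_continuousOn h1).prodMk
        ((by fun_prop : Continuous fun x : ℝ × Q' × ℝ => x.2.2).continuousOn.add
          (hu.comp h1 (fun x hx => Ψ.map_target hx))))

variable {D : BrinkmannData d Q r} {j l : ℕ∞} {Ψ : OpenPartialHomeomorph (ℝ × Q) (ℝ × Q')}
  {u : ℝ → Q → ℝ}

lemma mdifferentiable_of_contMDiffOn (hj : 1 ≤ j)
    (hΨ : ContMDiffOn (𝓘(ℝ, ℝ).prod (𝓡 d)) (𝓘(ℝ, ℝ).prod (𝓡 d)) (j : WithTop ℕ∞) Ψ Ψ.source)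
    (hΨ' : ContMDiffOn (𝓘(ℝ, ℝ).prod (𝓡 d)) (𝓘(ℝ, ℝ).prod (𝓡 d)) (j : WithTop ℕ∞)
      Ψ.symm Ψ.target) :
    Ψ.MDifferentiable (𝓘(ℝ, ℝ).prod (𝓡 d)) (𝓘(ℝ, ℝ).prod (𝓡 d)) := by
  have hj' : (j : WithTop ℕ∞) ≠ 0 := by
    have : j ≠ 0 := (zero_lt_one.trans_le hj).ne'
    exact_mod_cast this
  exact ⟨hΨ.mdifferentiableOn hj', hΨ'.mdifferentiableOn hj'⟩

/-- The differential of the inverse change of coordinates in terms of its space part. -/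
lemma mfderiv_symm_apply
    (hΨ : Ψ.MDifferentiable (𝓘(ℝ, ℝ).prod (𝓡 d)) (𝓘(ℝ, ℝ).prod (𝓡 d)))
    (htime : ∀ z ∈ Ψ.source, (Ψ z).1 = z.1) {z' : ℝ × Q'} (hz' : z' ∈ Ψ.target)
    (v : EuclideanSpace ℝ (Fin d)) :
    (mfderiv (𝓘(ℝ, ℝ).prod (𝓡 d)) (𝓘(ℝ, ℝ).prod (𝓡 d)) Ψ.symm z' :
      ℝ × EuclideanSpace ℝ (Fin d) →L[ℝ] ℝ × EuclideanSpace ℝ (Fin d)) (0, v) =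
      (0, spaceInverseDeriv (d := d) Ψ z'.1 z'.2 v) := by
  have h1 := (hΨ.mdifferentiableAt_symm hz').hasMFDerivAt
  have h2 := (hasMFDerivAt_fst (I := 𝓘(ℝ, ℝ)) (I' := 𝓡 d) (Ψ.symm z')).comp z' h1
  have h3 := (hasMFDerivAt_snd (I := 𝓘(ℝ, ℝ)) (I' := 𝓡 d) (Ψ.symm z')).comp z' h1
  have h4 := (hasMFDerivAt_fst (I := 𝓘(ℝ, ℝ)) (I' := 𝓡 d) z').congr_of_eventuallyEq
    (f₁ := Prod.fst ∘ Ψ.symm) (by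
      filter_upwards [Ψ.open_target.mem_nhds hz'] with w hw
      have h5 := htime _ (Ψ.map_target hw)
      rw [Ψ.right_inv hw] at h5
      exact h5.symm)
  refine Prod.ext ?_ ?_
  · exact congrArg (fun L : ℝ × EuclideanSpace ℝ (Fin d) →L[ℝ] ℝ => L (0, v))
      (hasMFDerivAt_unique h2 h4)
  · exact congrArg (fun L : ℝ × EuclideanSpace ℝ (Fin d) →L[ℝ] EuclideanSpace ℝ (Fin d) =>
      L (0, v)) h3.mfderiv.symm

/-- Pulling back uses one derivative of `q' ↦ q`, whence the class `j - 1`; the bound `j ≤ r + 1`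
makes `a` regular enough. Positivity survives because the inverse coordinate change is injective on
vectors tangent to the leaves. -/
lemma isTimeMetricOn_pulledBackMetric (hj : 1 ≤ j) (hjr : j ≤ r + 1)
    (hΨ : ContMDiffOn (𝓘(ℝ, ℝ).prod (𝓡 d)) (𝓘(ℝ, ℝ).prod (𝓡 d)) (j : WithTop ℕ∞) Ψ Ψ.source)
    (hΨ' : ContMDiffOn (𝓘(ℝ, ℝ).prod (𝓡 d)) (𝓘(ℝ, ℝ).prod (𝓡 d)) (j : WithTop ℕ∞)
      Ψ.symm Ψ.target)
    (htime : ∀ z ∈ Ψ.source, (Ψ z).1 = z.1) :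
    IsTimeMetricOn (j - 1) (D.pulledBackMetric Ψ) Ψ.target where
  symm t q' _ v w := D.isMetric.symm t (spaceInverse Ψ (t, q')) trivial
    (spaceInverseDeriv (d := d) Ψ t q' v) (spaceInverseDeriv (d := d) Ψ t q' w)
  pos t q' htq v hv := by
    have hm := mdifferentiable_of_contMDiffOn hj hΨ hΨ'
    refine D.isMetric.pos t (spaceInverse Ψ (t, q')) trivial
      (spaceInverseDeriv (d := d) Ψ t q' v) fun h0 => hv ?_
    have h1 := mfderiv_symm_apply hm htime htq v
    have h2 : spaceInverseDeriv (d := d) Ψ t q' v = 0 := h0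
    have h3 := hm.symm.mfderiv_injective htq
    have h4 : ((0 : ℝ), v) = ((0 : ℝ), (0 : EuclideanSpace ℝ (Fin d))) := h3 (by
      refine (h1.trans ?_).trans (map_zero _).symm
      exact congrArg (Prod.mk 0) h2)
    exact (Prod.ext_iff.1 h4).2
  contMDiffOn := by
    have hs : ContMDiffOn (𝓘(ℝ, ℝ).prod (𝓡 d)) (𝓡 d) (j : WithTop ℕ∞) (spaceInverse Ψ)
      Ψ.target := contMDiff_snd.comp_contMDiffOn hΨ'
    have h1 := hs.fibreDerivative (m := ((j - 1 : ℕ∞) : WithTop ℕ∞)) Ψ.open_target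
      (by exact_mod_cast (tsub_add_cancel_of_le hj).le)
    have h2 := (D.isMetric.contMDiffOn.of_le
      (m := ((j - 1 : ℕ∞) : WithTop ℕ∞)) (by exact_mod_cast tsub_le_iff_right.2 hjr)).comp
      (contMDiffOn_fst.prodMk h1) (fun p hp => trivial)
    exact h2

/-- The space part of a vector, followed along the curves of constant `q'`. -/
lemma spaceInverseDeriv_mfderiv
    (hΨ : Ψ.MDifferentiable (𝓘(ℝ, ℝ).prod (𝓡 d)) (𝓘(ℝ, ℝ).prod (𝓡 d)))
    (htime : ∀ z ∈ Ψ.source, (Ψ z).1 = z.1) {z : ℝ × Q} (hz : z ∈ Ψ.source)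
    {Z : EuclideanSpace ℝ (Fin d)}
    {A : ℝ × EuclideanSpace ℝ (Fin d) →L[ℝ] ℝ × EuclideanSpace ℝ (Fin d)}
    (hA : A = mfderiv (𝓘(ℝ, ℝ).prod (𝓡 d)) (𝓘(ℝ, ℝ).prod (𝓡 d)) Ψ z) (hZ : A (1, Z) = (1, 0))
    (X : ℝ × EuclideanSpace ℝ (Fin d)) :
    (A X).1 = X.1 ∧
      spaceInverseDeriv (d := d) Ψ (Ψ z).1 (Ψ z).2 (A X).2 = X.2 - X.1 • Z := by
  have h1 : (A X).1 = X.1 := by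
    have h2 := (hasMFDerivAt_fst (I := 𝓘(ℝ, ℝ)) (I' := 𝓡 d) (Ψ z)).comp z
      (hΨ.mdifferentiableAt hz).hasMFDerivAt
    have h3 := (hasMFDerivAt_fst (I := 𝓘(ℝ, ℝ)) (I' := 𝓡 d) z).congr_of_eventuallyEq
      (f₁ := Prod.fst ∘ Ψ) (by
        filter_upwards [Ψ.open_source.mem_nhds hz] with w hw using htime w hw)
    rw [hA]
    exact congrArg (fun L : ℝ × EuclideanSpace ℝ (Fin d) →L[ℝ] ℝ => L X)
      (hasMFDerivAt_unique h2 h3)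
  refine ⟨h1, ?_⟩
  have h2 : A (0, X.2 - X.1 • Z) = (0, (A X).2) := by
    have e1 : ((0 : ℝ), X.2 - X.1 • Z) = X - X.1 • ((1 : ℝ), Z) := by ext <;> simp
    rw [e1, map_sub, map_smul, hZ]
    ext <;> simp [h1]
  have h3 := mfderiv_symm_apply hΨ htime (Ψ.map_source hz) (A X).2
  have h4 := hΨ.symm_comp_deriv hz
  have h5 := congrArg (fun L : ℝ × EuclideanSpace ℝ (Fin d) →L[ℝ] ℝ × EuclideanSpace ℝ (Fin d) =>
    L (0, X.2 - X.1 • Z)) h4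
  have h6 : (mfderiv (𝓘(ℝ, ℝ).prod (𝓡 d)) (𝓘(ℝ, ℝ).prod (𝓡 d)) Ψ.symm (Ψ z) :
      ℝ × EuclideanSpace ℝ (Fin d) →L[ℝ] ℝ × EuclideanSpace ℝ (Fin d)) (A (0, X.2 - X.1 • Z)) =
      (0, X.2 - X.1 • Z) := by
    rw [hA]
    exact h5
  rw [h2, h3] at h6
  exact (Prod.ext_iff.1 h6).2

lemma hasMFDerivAt_rosenCoordinates
    {hu : ContinuousOn (fun z : ℝ × Q => u z.1 z.2) Ψ.source} {t : ℝ} {q : Q} (y : ℝ)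
    {A : ℝ × EuclideanSpace ℝ (Fin d) →L[ℝ] ℝ × EuclideanSpace ℝ (Fin d)}
    (hA : HasMFDerivAt (𝓘(ℝ, ℝ).prod (𝓡 d)) (𝓘(ℝ, ℝ).prod (𝓡 d)) Ψ (t, q) A)
    {U : ℝ × EuclideanSpace ℝ (Fin d) →L[ℝ] ℝ}
    (hU : HasMFDerivAt (𝓘(ℝ, ℝ).prod (𝓡 d)) 𝓘(ℝ, ℝ) (fun z : ℝ × Q => u z.1 z.2) (t, q) U)
    (X : ℝ × EuclideanSpace ℝ (Fin d) × ℝ) :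
    (mfderiv (spacetimeModel d) (spacetimeModel d) (rosenCoordinates Ψ u hu) (t, q, y) :
      ℝ × EuclideanSpace ℝ (Fin d) × ℝ →L[ℝ] ℝ × EuclideanSpace ℝ (Fin d) × ℝ) X =
      ((A (X.1, X.2.1)).1, (A (X.1, X.2.1)).2, X.2.2 - U (X.1, X.2.1)) := by
  have h3 : HasMFDerivAt (spacetimeModel d) (𝓘(ℝ, ℝ).prod (𝓡 d))
      (fun x : ℝ × Q × ℝ => (x.1, x.2.1)) (t, q, y)
      ((ContinuousLinearMap.fst ℝ ℝ (EuclideanSpace ℝ (Fin d) × ℝ)).prod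
        (ContinuousLinearMap.fst ℝ (EuclideanSpace ℝ (Fin d)) ℝ ∘L
          ContinuousLinearMap.snd ℝ ℝ (EuclideanSpace ℝ (Fin d) × ℝ))) :=
    (hasMFDerivAt_fst (t, q, y)).prodMk
      ((hasMFDerivAt_fst (q, y)).comp (t, q, y) (hasMFDerivAt_snd (t, q, y)))
  have h4 : HasMFDerivAt (spacetimeModel d) 𝓘(ℝ, ℝ) (fun x : ℝ × Q × ℝ => x.2.2) (t, q, y)
      (ContinuousLinearMap.snd ℝ (EuclideanSpace ℝ (Fin d)) ℝ ∘L
        ContinuousLinearMap.snd ℝ ℝ (EuclideanSpace ℝ (Fin d) × ℝ)) :=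
    (hasMFDerivAt_snd (q, y)).comp (t, q, y) (hasMFDerivAt_snd (t, q, y))
  have h5 := hA.comp (t, q, y) h3
  have h6 := ((hasMFDerivAt_fst (I := 𝓘(ℝ, ℝ)) (I' := 𝓡 d) (Ψ (t, q))).comp (t, q, y) h5).prodMk
    (((hasMFDerivAt_snd (I := 𝓘(ℝ, ℝ)) (I' := 𝓡 d) (Ψ (t, q))).comp (t, q, y) h5).prodMk
      (h4.sub (hU.comp (t, q, y) h3)))
  exact congrArg (fun L : ℝ × EuclideanSpace ℝ (Fin d) × ℝ →L[ℝ]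
    ℝ × EuclideanSpace ℝ (Fin d) × ℝ => L X) h6.mfderiv

/-- Completing the square: the cross terms `a Z ·` turn `b` into the spatial part of `U`, and what
remains is a multiple of `X.1 * Y.1` by the Hamilton–Jacobi expression, since `a Z Z = U (0, Z) - b
Z`. -/
lemma brinkmann_eq_rosen {E : Type*} [NormedAddCommGroup E] [NormedSpace ℝ E]
    {a : E →L[ℝ] E →L[ℝ] ℝ} {b : E →L[ℝ] ℝ} {V : ℝ} {U : ℝ × E →L[ℝ] ℝ} {Z : E}
    (hsymm : ∀ v w, a v w = a w v) (hZ : ∀ v, a Z v = U (0, v) - b v)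
    (heq : U (1, 0) + (1 / 2 * (U (0, Z) - b Z) + V) = 0) (X Y : ℝ × E × ℝ) :
    a X.2.1 Y.2.1 - X.1 * (Y.2.2 - b Y.2.1) - (X.2.2 - b X.2.1) * Y.1 - 2 * V * (X.1 * Y.1) =
      a (X.2.1 - X.1 • Z) (Y.2.1 - Y.1 • Z)
        - X.1 * (Y.2.2 - U (Y.1, Y.2.1)) - (X.2.2 - U (X.1, X.2.1)) * Y.1 := by
  have hUX : ∀ (s : ℝ) (v : E), U (s, v) = s * U (1, 0) + U (0, v) :=
    fun s v => map_prodMk_eq_smul_add U s v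
  simp only [map_sub, map_smul, sub_apply, smul_apply, smul_eq_mul]
  rw [hUX X.1, hUX Y.1, hsymm X.2.1 Z, hZ, hZ, hZ]
  linear_combination (-(2 * X.1 * Y.1)) * heq

lemma metric_eq_of_hamiltonJacobi (D : BrinkmannData d Q r) {t : ℝ} {q : Q}
    {U : ℝ × EuclideanSpace ℝ (Fin d) →L[ℝ] ℝ}
    (hU : HasMFDerivAt (𝓘(ℝ, ℝ).prod (𝓡 d)) 𝓘(ℝ, ℝ) (fun z : ℝ × Q => u z.1 z.2) (t, q) U)
    (heq : deriv (fun s => u s q) t + D.hamiltonian t q (dq u t q) = 0)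
    {Z : EuclideanSpace ℝ (Fin d)} (hZ : Z = D.sharp t q (dq u t q - D.b t q)) (y : ℝ)
    (X Y : ℝ × EuclideanSpace ℝ (Fin d) × ℝ) :
    D.metric (t, q, y) X Y =
      (D.a t q : EuclideanSpace ℝ (Fin d) →L[ℝ] EuclideanSpace ℝ (Fin d) →L[ℝ] ℝ)
        (X.2.1 - X.1 • Z) (Y.2.1 - Y.1 • Z)
        - X.1 * (Y.2.2 - U (Y.1, Y.2.1)) - (X.2.2 - U (X.1, X.2.1)) * Y.1 := by
  obtain ⟨hUt, hUq⟩ := hasDerivAt_dq_of_hasMFDerivAt hU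
  set a : EuclideanSpace ℝ (Fin d) →L[ℝ] EuclideanSpace ℝ (Fin d) →L[ℝ] ℝ := D.a t q with ha
  set b : EuclideanSpace ℝ (Fin d) →L[ℝ] ℝ := D.b t q with hb
  have hsymm : ∀ v w, a v w = a w v := D.isMetric.symm t q trivial
  have hZ' : ∀ v, a Z v = U (0, v) - b v := by
    intro v
    have h1 := D.eq_sharp_iff.1 hZ
    exact (congrArg (fun L : EuclideanSpace ℝ (Fin d) →L[ℝ] ℝ => L v) h1).trans
      (congrArg (· - b v) (hUq v))
  have heq' : U (1, 0) + (1 / 2 * (U (0, Z) - b Z) + D.V t q) = 0 := by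
    rw [hUt.deriv] at heq
    have h2 : D.hamiltonian t q (dq u t q) = 1 / 2 * (U (0, Z) - b Z) + D.V t q := by
      rw [hamiltonian, ← hZ]
      exact congrArg (fun w : ℝ => 1 / 2 * (w - b Z) + D.V t q) (hUq Z)
    rwa [h2] at heq
  exact brinkmann_eq_rosen hsymm hZ' heq' X Y

/-- The common endpoint of the local and the complete constructions: they differ only in how `Ψ`,
which straightens the characteristics, is produced. By `spaceInverseDeriv_mfderiv`, the pulled back
metric evaluates `a` on `X_q - X_t Z`, as `metric_eq_of_hamiltonJacobi` requires. -/
theorem isRosen_rosenCoordinates (hj : 1 ≤ j) (hjr : j ≤ r + 1) (hjl : j ≤ l)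
    (hΨ : ContMDiffOn (𝓘(ℝ, ℝ).prod (𝓡 d)) (𝓘(ℝ, ℝ).prod (𝓡 d)) (j : WithTop ℕ∞) Ψ Ψ.source)
    (hΨ' : ContMDiffOn (𝓘(ℝ, ℝ).prod (𝓡 d)) (𝓘(ℝ, ℝ).prod (𝓡 d)) (j : WithTop ℕ∞)
      Ψ.symm Ψ.target)
    (htime : ∀ z ∈ Ψ.source, (Ψ z).1 = z.1)
    (hu : ContMDiffOn (𝓘(ℝ, ℝ).prod (𝓡 d)) 𝓘(ℝ, ℝ) (l : WithTop ℕ∞)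
      (fun z : ℝ × Q => u z.1 z.2) Ψ.source)
    (heq : ∀ z ∈ Ψ.source,
      deriv (fun s => u s z.2) z.1 + D.hamiltonian z.1 z.2 (dq u z.1 z.2) = 0)
    (hchar : ∀ z ∈ Ψ.source,
      (mfderiv (𝓘(ℝ, ℝ).prod (𝓡 d)) (𝓘(ℝ, ℝ).prod (𝓡 d)) Ψ z :
        ℝ × EuclideanSpace ℝ (Fin d) →L[ℝ] ℝ × EuclideanSpace ℝ (Fin d))
        (1, D.sharp z.1 z.2 (dq u z.1 z.2 - D.b z.1 z.2)) = (1, 0)) :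
    D.IsRosen j l (rosenCoordinates Ψ u hu.continuousOn) (D.pulledBackMetric Ψ) := by
  have hm := mdifferentiable_of_contMDiffOn hj hΨ hΨ'
  have hl0 : (l : WithTop ℕ∞) ≠ 0 := by
    have : l ≠ 0 := (zero_lt_one.trans_le (hj.trans hjl)).ne'
    exact_mod_cast this
  have huj : ContMDiffOn (𝓘(ℝ, ℝ).prod (𝓡 d)) 𝓘(ℝ, ℝ) (j : WithTop ℕ∞)
      (fun z : ℝ × Q => u z.1 z.2) Ψ.source := hu.of_le (by exact_mod_cast hjl)
  have hUd : ∀ z ∈ Ψ.source, HasMFDerivAt (𝓘(ℝ, ℝ).prod (𝓡 d)) 𝓘(ℝ, ℝ)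
      (fun z : ℝ × Q => u z.1 z.2) z _ := fun z hz =>
    ((hu.mdifferentiableOn hl0 z hz).mdifferentiableAt (Ψ.open_source.mem_nhds hz)).hasMFDerivAt
  have hy : ContMDiffOn (spacetimeModel d) 𝓘(ℝ, ℝ) (l : WithTop ℕ∞)
      (fun x => (rosenCoordinates Ψ u hu.continuousOn x).2.2)
      (rosenCoordinates Ψ u hu.continuousOn).source :=
    contMDiff_snd_snd.contMDiffOn.sub (hu.comp contMDiff_timeSpace.contMDiffOn (fun x hx => hx))
  refine ⟨?_, ?_, hy, fun x hx => htime _ hx, fun x hx => ?_, ?_, fun x hx X Y => ?_⟩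
  · have h1 := hΨ.comp (contMDiff_timeSpace (Q := Q)).contMDiffOn
      (fun x (hx : x ∈ (rosenCoordinates Ψ u hu.continuousOn).source) => hx)
    exact (contMDiff_fst.comp_contMDiffOn h1).prodMk
      ((contMDiff_snd.comp_contMDiffOn h1).prodMk (hy.of_le (by exact_mod_cast hjl)))
  · have h1 := hΨ'.comp (contMDiff_timeSpace (Q := Q')).contMDiffOn
      (fun x (hx : x ∈ (rosenCoordinates Ψ u hu.continuousOn).target) => hx)
    have h2 := huj.comp h1 (fun x hx => Ψ.map_target hx)
    exact (contMDiff_fst.comp_contMDiffOn h1).prodMk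
      ((contMDiff_snd.comp_contMDiffOn h1).prodMk (contMDiff_snd_snd.contMDiffOn.add h2))
  · obtain ⟨t, q, y⟩ := x
    refine (hasMFDerivAt_rosenCoordinates (hu := hu.continuousOn) y
      (hm.mdifferentiableAt hx).hasMFDerivAt (hUd _ hx) (0, 0, 1)).trans ?_
    have h1 : ∀ (A : ℝ × EuclideanSpace ℝ (Fin d) →L[ℝ] ℝ × EuclideanSpace ℝ (Fin d))
        (U : ℝ × EuclideanSpace ℝ (Fin d) →L[ℝ] ℝ),
        ((A (0, 0)).1, (A (0, 0)).2, 1 - U (0, 0)) =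
          ((0 : ℝ), (0 : EuclideanSpace ℝ (Fin d)), (1 : ℝ)) := fun A U => by
      rw [Prod.mk_zero_zero, map_zero, map_zero]
      simp
    exact h1 _ _
  · have h1 : (fun x' : ℝ × Q' × ℝ => (x'.1, x'.2.1)) ''
        (rosenCoordinates Ψ u hu.continuousOn).target = Ψ.target := by
      ext z
      constructor
      · rintro ⟨x, hx, rfl⟩
        exact hx
      · intro hz
        exact ⟨(z.1, z.2, 0), hz, rfl⟩
    rw [h1]
    exact isTimeMetricOn_pulledBackMetric hj hjr hΨ hΨ' htime
  · obtain ⟨t, q, y⟩ := x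
    change (t, q) ∈ Ψ.source at hx
    revert X Y
    change ∀ X Y : ℝ × EuclideanSpace ℝ (Fin d) × ℝ, _
    intro X Y
    obtain ⟨A, hAdef⟩ : ∃ A : ℝ × EuclideanSpace ℝ (Fin d) →L[ℝ] ℝ × EuclideanSpace ℝ (Fin d),
      A = mfderiv (𝓘(ℝ, ℝ).prod (𝓡 d)) (𝓘(ℝ, ℝ).prod (𝓡 d)) Ψ (t, q) := ⟨_, rfl⟩
    obtain ⟨Z, hZ⟩ : ∃ Z : EuclideanSpace ℝ (Fin d),
      Z = D.sharp t q (dq u t q - D.b t q) := ⟨_, rfl⟩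
    have hA : HasMFDerivAt (𝓘(ℝ, ℝ).prod (𝓡 d)) (𝓘(ℝ, ℝ).prod (𝓡 d)) Ψ (t, q) A := by
      rw [hAdef]
      exact (hm.mdifferentiableAt hx).hasMFDerivAt
    have hAZ : A (1, Z) = (1, 0) := by
      rw [hAdef, hZ]
      exact hchar _ hx
    obtain ⟨U, hU⟩ : ∃ U : ℝ × EuclideanSpace ℝ (Fin d) →L[ℝ] ℝ,
      HasMFDerivAt (𝓘(ℝ, ℝ).prod (𝓡 d)) 𝓘(ℝ, ℝ) (fun z : ℝ × Q => u z.1 z.2) (t, q) U :=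
      ⟨_, hUd _ hx⟩
    have hdX := hasMFDerivAt_rosenCoordinates (hu := hu.continuousOn) y hA hU X
    have hdY := hasMFDerivAt_rosenCoordinates (hu := hu.continuousOn) y hA hU Y
    obtain ⟨hX1, hX2⟩ := spaceInverseDeriv_mfderiv hm htime hx hAdef hAZ (X.1, X.2.1)
    obtain ⟨hY1, hY2⟩ := spaceInverseDeriv_mfderiv hm htime hx hAdef hAZ (Y.1, Y.2.1)
    refine (metric_eq_of_hamiltonJacobi D hU (heq _ hx) hZ y X Y).trans ?_
    refine Eq.trans ?_ (congrArg₂ (fun X Y : ℝ × EuclideanSpace ℝ (Fin d) × ℝ =>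
      rosenMetric (D.pulledBackMetric Ψ)
        (rosenCoordinates Ψ u hu.continuousOn (t, q, y)) X Y) hdX hdY).symm
    have hpt : ((Ψ (t, q)).1, spaceInverse Ψ ((Ψ (t, q)).1, (Ψ (t, q)).2)) = (t, q) := by
      have h1 : (Ψ.symm (Ψ (t, q))).2 = q := by rw [Ψ.left_inv hx]
      exact Prod.ext (htime _ hx) h1
    have ha := congrArg (fun z : ℝ × Q => (D.a z.1 z.2 :
      EuclideanSpace ℝ (Fin d) →L[ℝ] EuclideanSpace ℝ (Fin d) →L[ℝ] ℝ)
      (X.2.1 - X.1 • Z) (Y.2.1 - Y.1 • Z)) hpt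
    have hp := pulledBackMetric_apply D Ψ (Ψ (t, q)).1 (Ψ (t, q)).2 (A (X.1, X.2.1)).2
      (A (Y.1, Y.2.1)).2
    have hp2 := hp.trans ((congrArg₂ (fun v w : EuclideanSpace ℝ (Fin d) =>
      D.a (Ψ (t, q)).1 (spaceInverse Ψ ((Ψ (t, q)).1, (Ψ (t, q)).2)) v w) hX2 hY2).trans ha)
    change _ = D.pulledBackMetric Ψ (Ψ (t, q)).1 (Ψ (t, q)).2 (A (X.1, X.2.1)).2
      (A (Y.1, Y.2.1)).2 - (A (X.1, X.2.1)).1 * (Y.2.2 - U (Y.1, Y.2.1)) -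
      (X.2.2 - U (X.1, X.2.1)) * (A (Y.1, Y.2.1)).1
    rw [hX1, hY1]
    exact congrArg (fun w => w - X.1 * (Y.2.2 - U (Y.1, Y.2.1)) -
      (X.2.2 - U (X.1, X.2.1)) * Y.1) hp2.symm

end BrinkmannData

end RosenOfSolution

/-! ### Integral curves of time dependent fields on manifolds and their uniqueness. -/

section Evolution

open Set Filter Topology

variable {d : ℕ} {Q : Type*} [TopologicalSpace Q] [ChartedSpace (EuclideanSpace ℝ (Fin d)) Q]

/-- `γ` is, over the set of times `J`, an integral curve of the time dependent field `X`. -/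
def IsEvolutionCurveOn (X : ℝ → (q : Q) → TangentSpace (𝓡 d) q) (J : Set ℝ) (γ : ℝ → Q) : Prop :=
  ∀ t ∈ J, HasMFDerivAt 𝓘(ℝ, ℝ) (𝓡 d) γ t (ContinuousLinearMap.toSpanSingleton ℝ (X t (γ t)))

/-- The time dependent vector field `X` is `C^n` in charts over `I × Q`. -/
def IsTimeFieldOn (n : ℕ∞) (X : ℝ → (q : Q) → TangentSpace (𝓡 d) q) (I : Set ℝ) : Prop :=
  ∀ q₁ : Q, ∃ f : ℝ × EuclideanSpace ℝ (Fin d) → EuclideanSpace ℝ (Fin d),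
    ContDiffOn ℝ n f (I ×ˢ (chartAt (EuclideanSpace ℝ (Fin d)) q₁).target) ∧
    ∀ t ∈ I, ∀ x ∈ (chartAt (EuclideanSpace ℝ (Fin d)) q₁).target,
      (mfderiv (𝓡 d) (𝓡 d) (chartAt (EuclideanSpace ℝ (Fin d)) q₁).symm x :
        EuclideanSpace ℝ (Fin d) →L[ℝ] EuclideanSpace ℝ (Fin d)) (f (t, x)) =
        X t ((chartAt (EuclideanSpace ℝ (Fin d)) q₁).symm x)

variable [IsManifold (𝓡 d) 1 Q] {X : ℝ → (q : Q) → TangentSpace (𝓡 d) q} {I J : Set ℝ} {n : ℕ∞}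

lemma IsEvolutionCurveOn.continuousAt {γ : ℝ → Q} (hγ : IsEvolutionCurveOn X J γ) {t : ℝ}
    (ht : t ∈ J) : ContinuousAt γ t := (hγ t ht).continuousAt

lemma IsEvolutionCurveOn.mono {γ : ℝ → Q} (hγ : IsEvolutionCurveOn X I γ) (hJ : J ⊆ I) :
    IsEvolutionCurveOn X J γ := fun t ht => hγ t (hJ ht)

/-- An integral curve solves, in a chart, an ordinary differential equation. -/
lemma hasDerivAt_chart_of_hasMFDerivAt {γ : ℝ → Q} {t : ℝ} {q₁ : Q}
    {w : TangentSpace (𝓡 d) (γ t)} {v : EuclideanSpace ℝ (Fin d)}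
    (hγ : HasMFDerivAt 𝓘(ℝ, ℝ) (𝓡 d) γ t (ContinuousLinearMap.toSpanSingleton ℝ w))
    (hs : γ t ∈ (chartAt (EuclideanSpace ℝ (Fin d)) q₁).source)
    (hv : (mfderiv (𝓡 d) (𝓡 d) (chartAt (EuclideanSpace ℝ (Fin d)) q₁).symm
      (chartAt (EuclideanSpace ℝ (Fin d)) q₁ (γ t)) :
        EuclideanSpace ℝ (Fin d) →L[ℝ] EuclideanSpace ℝ (Fin d)) v = w) :
    HasDerivAt (fun s => chartAt (EuclideanSpace ℝ (Fin d)) q₁ (γ s)) v t := by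
  have hc := mdifferentiable_chart (I := 𝓡 d) q₁
  have h1 := (hc.mdifferentiableAt hs).hasMFDerivAt.comp t hγ
  have h2 := hc.comp_symm_deriv ((chartAt (EuclideanSpace ℝ (Fin d)) q₁).map_source hs)
  have h3 := congrArg (fun L : EuclideanSpace ℝ (Fin d) →L[ℝ] EuclideanSpace ℝ (Fin d) => L v) h2
  have h4 : (mfderiv (𝓡 d) (𝓡 d) (chartAt (EuclideanSpace ℝ (Fin d)) q₁) (γ t) :
      EuclideanSpace ℝ (Fin d) →L[ℝ] EuclideanSpace ℝ (Fin d)) w = v := by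
    rw [(chartAt (EuclideanSpace ℝ (Fin d)) q₁).left_inv hs] at h3
    exact (congrArg (mfderiv (𝓡 d) (𝓡 d) (chartAt (EuclideanSpace ℝ (Fin d)) q₁) (γ t) :
      EuclideanSpace ℝ (Fin d) →L[ℝ] EuclideanSpace ℝ (Fin d)) hv).symm.trans h3
  have h5 := h1.congr_mfderiv (f₁' := ContinuousLinearMap.toSpanSingleton ℝ v)
    (ContinuousLinearMap.ext_ring ?_)
  · exact hasMFDerivAt_iff_hasFDerivAt.1 h5
  · have h6 : ∀ (L : EuclideanSpace ℝ (Fin d) →L[ℝ] EuclideanSpace ℝ (Fin d))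
      (w : EuclideanSpace ℝ (Fin d)), L w = v → L ((1 : ℝ) • w) = (1 : ℝ) • v :=
      fun L w h => by rw [one_smul, one_smul, h]
    exact h6 _ _ h4

lemma hasMFDerivAt_chart_symm_of_hasDerivAt {x : ℝ → EuclideanSpace ℝ (Fin d)} {t : ℝ} {q₁ : Q}
    {v : EuclideanSpace ℝ (Fin d)} (hx : HasDerivAt x v t)
    (hs : x t ∈ (chartAt (EuclideanSpace ℝ (Fin d)) q₁).target) :
    HasMFDerivAt 𝓘(ℝ, ℝ) (𝓡 d) (fun s => (chartAt (EuclideanSpace ℝ (Fin d)) q₁).symm (x s)) t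
      (ContinuousLinearMap.toSpanSingleton ℝ
        ((mfderiv (𝓡 d) (𝓡 d) (chartAt (EuclideanSpace ℝ (Fin d)) q₁).symm (x t) :
          EuclideanSpace ℝ (Fin d) →L[ℝ] EuclideanSpace ℝ (Fin d)) v)) := by
  have hc := mdifferentiable_chart (I := 𝓡 d) q₁
  have h1 := (hc.mdifferentiableAt_symm hs).hasMFDerivAt.comp t
    (hasMFDerivAt_iff_hasFDerivAt.2 hx.hasFDerivAt)
  refine h1.congr_mfderiv (ContinuousLinearMap.ext_ring ?_)
  have h2 : ∀ (L : EuclideanSpace ℝ (Fin d) →L[ℝ] EuclideanSpace ℝ (Fin d)),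
      L ((1 : ℝ) • v) = (1 : ℝ) • L v := fun L => map_smul L 1 v
  exact h2 _

/-- Two integral curves which meet agree near the time of the encounter. -/
lemma IsEvolutionCurveOn.eventuallyEq (hI : IsOpen I) (hn : 1 ≤ n) (hX : IsTimeFieldOn n X I)
    {γ γ' : ℝ → Q} (hγ : IsEvolutionCurveOn X J γ) (hγ' : IsEvolutionCurveOn X J γ')
    (hJ : IsOpen J) (hJI : J ⊆ I) {t : ℝ} (ht : t ∈ J) (h : γ t = γ' t) : γ =ᶠ[𝓝 t] γ' := by
  obtain ⟨f, hf, hfX⟩ := hX (γ t)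
  set c := chartAt (EuclideanSpace ℝ (Fin d)) (γ t) with hc
  have hct : c (γ t) ∈ c.target := c.map_source (mem_chart_source _ _)
  have hopen : IsOpen (I ×ˢ c.target) := hI.prod c.open_target
  have hn1 : (1 : WithTop ℕ∞) ≤ (n : WithTop ℕ∞) := by exact_mod_cast hn
  obtain ⟨K, N, hN, hK⟩ := ((hf.contDiffAt (hopen.mem_nhds
    (show (t, c (γ t)) ∈ I ×ˢ c.target from ⟨hJI ht, hct⟩))).of_le hn1).exists_lipschitzOnWith
  obtain ⟨N₁, hN₁, N₂, hN₂, hNN⟩ := mem_nhds_prod_iff.1 hN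
  have key : ∀ γ'' : ℝ → Q, IsEvolutionCurveOn X J γ'' → γ'' t = γ t →
      (∀ᶠ s in 𝓝 t, HasDerivAt (fun s => c (γ'' s)) (f (s, c (γ'' s))) s ∧ c (γ'' s) ∈ N₂) ∧
      ∀ᶠ s in 𝓝 t, c.symm (c (γ'' s)) = γ'' s := by
    intro γ'' h'' he
    have hcont := h''.continuousAt ht
    have h1 : ∀ᶠ s in 𝓝 t, γ'' s ∈ c.source := hcont.eventually_mem
      (c.open_source.mem_nhds (by rw [he]; exact mem_chart_source _ _))
    have h2 : ContinuousAt (fun s => c (γ'' s)) t :=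
      ContinuousAt.comp (c.continuousAt (by rw [he]; exact mem_chart_source _ _)) hcont
    refine ⟨?_, h1.mono fun s hs => c.left_inv hs⟩
    filter_upwards [h1, hJ.mem_nhds ht, h2.eventually_mem (by rw [he]; exact hN₂)] with s hs hsJ hs2
    refine ⟨hasDerivAt_chart_of_hasMFDerivAt (h'' s hsJ) hs ?_, hs2⟩
    have h3 := hfX s (hJI hsJ) (c (γ'' s)) (c.map_source hs)
    exact h3.trans (by rw [c.left_inv hs])
  obtain ⟨hd, hl⟩ := key γ hγ rfl
  obtain ⟨hd', hl'⟩ := key γ' hγ' h.symm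
  have huniq := ODE_solution_unique_of_eventually (v := fun s x => f (s, x)) (s := fun _ => N₂)
    (K := K) (f := fun s => c (γ s)) (g := fun s => c (γ' s)) (t₀ := t) (by
      filter_upwards [hN₁] with s hs
      intro x hx y hy
      have := hK (hNN (show (s, x) ∈ N₁ ×ˢ N₂ from ⟨hs, hx⟩)) (hNN (show (s, y) ∈ N₁ ×ˢ N₂ from ⟨hs, hy⟩))
      simpa [Prod.edist_eq] using this) hd hd' (by simp [h])
  filter_upwards [huniq, hl, hl'] with s hs h1 h2
  rw [← h1, ← h2]
  exact congrArg c.symm hs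

/-- The coincidence set is open by local uniqueness and closed because `Q` is Hausdorff; the set of
times is connected. -/
lemma IsEvolutionCurveOn.eqOn [T2Space Q] (hI : IsOpen I) (hn : 1 ≤ n) (hX : IsTimeFieldOn n X I)
    {γ γ' : ℝ → Q} (hγ : IsEvolutionCurveOn X J γ) (hγ' : IsEvolutionCurveOn X J γ')
    (hJ : IsOpen J) (hJc : J.OrdConnected) (hJI : J ⊆ I) {t : ℝ} (ht : t ∈ J) (h : γ t = γ' t) :
    EqOn γ γ' J := by
  intro s hs
  refine (hJc.isPreconnected.induction₂ (fun x y => γ x = γ' x ↔ γ y = γ' y) (fun x hx => ?_)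
    (fun x y z _ _ _ h1 h2 => h1.trans h2) (fun x y _ _ h1 => h1.symm) ht hs).1 h
  refine mem_nhdsWithin_of_mem_nhds ?_
  by_cases hxx : γ x = γ' x
  · filter_upwards [hγ.eventuallyEq hI hn hX hγ' hJ hJI hx hxx] with y hy
    exact ⟨fun _ => hy, fun _ => hxx⟩
  · filter_upwards [((hγ.continuousAt hx).ne_iff_eventually_ne (hγ'.continuousAt hx)).1 hxx] with y hy
    exact ⟨fun h1 => (hxx h1).elim, fun h1 => (hy h1).elim⟩

end Evolution

/-! ### Smooth dependence of a complete evolution on times and position. -/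

section SmoothEvolution

open Set Filter Topology

variable {d : ℕ} {Q : Type*} [TopologicalSpace Q] [ChartedSpace (EuclideanSpace ℝ (Fin d)) Q]
  [IsManifold (𝓡 d) 1 Q] {X : ℝ → (q : Q) → TangentSpace (𝓡 d) q} {I : Set ℝ} {n : ℕ∞}

/-- Local existence of the evolution of a time dependent field, with smooth dependence. -/
lemma IsTimeFieldOn.exists_flowBox [IsManifold (𝓡 d) (n : WithTop ℕ∞) Q] (hI : IsOpen I)
    (hn : 1 ≤ n) (hX : IsTimeFieldOn n X I) {t₁ : ℝ} (ht₁ : t₁ ∈ I) (q₁ : Q) :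
    ∃ (θ : ℝ × ℝ × Q → Q) (ε : ℝ) (U : Set Q), 0 < ε ∧ IsOpen U ∧ q₁ ∈ U ∧
      Ioo (t₁ - ε) (t₁ + ε) ⊆ I ∧
      ContMDiffOn (𝓘(ℝ, ℝ).prod (𝓘(ℝ, ℝ).prod (𝓡 d))) (𝓡 d) (n : WithTop ℕ∞) θ
        (Ioo (t₁ - ε) (t₁ + ε) ×ˢ Ioo (t₁ - ε) (t₁ + ε) ×ˢ U) ∧
      ∀ t ∈ Ioo (t₁ - ε) (t₁ + ε), ∀ q ∈ U, θ (t, t, q) = q ∧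
        IsEvolutionCurveOn X (Ioo (t₁ - ε) (t₁ + ε)) (fun s => θ (s, t, q)) := by
  obtain ⟨f, hf, hfX⟩ := hX q₁
  set c := chartAt (EuclideanSpace ℝ (Fin d)) q₁ with hc
  obtain ⟨φ, ε, hε, hφ, hφ'⟩ := hf.exists_contDiffOn_evolution hn (hI.prod c.open_target)
    (t₀ := t₁) (x₀ := c q₁) ⟨ht₁, c.map_source (mem_chart_source _ _)⟩
  have hmaps : ∀ p ∈ Ioo (t₁ - ε) (t₁ + ε) ×ˢ Ioo (t₁ - ε) (t₁ + ε) ×ˢ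
      (c.source ∩ c ⁻¹' Metric.ball (c q₁) ε),
      ((p.1, p.2.1, c p.2.2) : ℝ × ℝ × EuclideanSpace ℝ (Fin d)) ∈ Ioo (t₁ - ε) (t₁ + ε) ×ˢ
        Ioo (t₁ - ε) (t₁ + ε) ×ˢ Metric.ball (c q₁) ε := fun p hp => ⟨hp.1, hp.2.1, hp.2.2.2⟩
  refine ⟨fun p => c.symm (φ (p.1, p.2.1, c p.2.2)), ε, c.source ∩ c ⁻¹' Metric.ball (c q₁) ε, hε,
    c.isOpen_inter_preimage Metric.isOpen_ball,
    ⟨mem_chart_source _ _, Metric.mem_ball_self hε⟩, ?_, ?_, ?_⟩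
  · intro s hs
    exact ((hφ' s hs _ (Metric.mem_ball_self hε)).2 s hs).1.1
  · have h2 : ContMDiffOn (𝓘(ℝ, ℝ).prod (𝓘(ℝ, ℝ).prod (𝓡 d)))
        𝓘(ℝ, ℝ × ℝ × EuclideanSpace ℝ (Fin d)) (n : WithTop ℕ∞)
        (fun p : ℝ × ℝ × Q => (p.1, p.2.1, c p.2.2))
        (Ioo (t₁ - ε) (t₁ + ε) ×ˢ Ioo (t₁ - ε) (t₁ + ε) ×ˢ
          (c.source ∩ c ⁻¹' Metric.ball (c q₁) ε)) :=
      contMDiffOn_fst.prodMk_space ((contMDiff_fst.comp contMDiff_snd).contMDiffOn.prodMk_space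
        ((contMDiffOn_chart (I := 𝓡 d) (x := q₁)).comp
          (contMDiff_snd.comp contMDiff_snd).contMDiffOn (fun p hp => hp.2.2.1)))
    exact (contMDiffOn_chart_symm (I := 𝓡 d) (x := q₁)).comp (hφ.contMDiffOn.comp h2 hmaps)
      (fun p hp => ((hφ' _ hp.2.1 _ hp.2.2.2).2 _ hp.1).1.2)
  · intro t ht q hq
    obtain ⟨h1, h2⟩ := hφ' t ht (c q) hq.2
    refine ⟨by simp only [h1]; exact c.left_inv hq.1, fun s hs => ?_⟩
    obtain ⟨h3, h4⟩ := h2 s hs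
    refine (hasMFDerivAt_chart_symm_of_hasDerivAt h4 h3.2).congr_mfderiv ?_
    exact congrArg (fun w : EuclideanSpace ℝ (Fin d) => ContinuousLinearMap.toSpanSingleton ℝ w)
      (hfX s h3.1 _ h3.2)

variable {ψ : ℝ → ℝ → Q → Q}

/-- The composition law of the evolution. -/
lemma evolution_comp [T2Space Q] (hI : IsOpen I) (hIc : I.OrdConnected)
    (hn : 1 ≤ n) (hX : IsTimeFieldOn n X I)
    (hψ : ∀ t ∈ I, ∀ q, IsEvolutionCurveOn X I (fun s => ψ s t q) ∧ ψ t t q = q)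
    {s t t' : ℝ} (hs : s ∈ I) (ht : t ∈ I) (ht' : t' ∈ I) (q : Q) :
    ψ s t' (ψ t' t q) = ψ s t q :=
  (hψ t' ht' _).1.eqOn hI hn hX (hψ t ht q).1 hI hIc Subset.rfl ht'
    (hψ t' ht' (ψ t' t q)).2 hs

/-- The evolution of a complete time dependent field depends smoothly on all of its arguments. -/
theorem contMDiffAt_evolution [T2Space Q] [IsManifold (𝓡 d) (n : WithTop ℕ∞) Q] (hI : IsOpen I)
    (hIc : I.OrdConnected) (hn : 1 ≤ n) (hX : IsTimeFieldOn n X I)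
    (hψ : ∀ t ∈ I, ∀ q, IsEvolutionCurveOn X I (fun s => ψ s t q) ∧ ψ t t q = q)
    {s t : ℝ} (hs : s ∈ I) (ht : t ∈ I) (q : Q) :
    ContMDiffAt (𝓘(ℝ, ℝ).prod (𝓘(ℝ, ℝ).prod (𝓡 d))) (𝓡 d) (n : WithTop ℕ∞)
      (fun p : ℝ × ℝ × Q => ψ p.1 p.2.1 p.2.2) (s, t, q) := by
  -- Near the diagonal `s = t`, uniqueness identifies `ψ` with the smooth flow of a flow box.
  have hbox : ∀ t₁ ∈ I, ∀ q₁, ∃ (N : Set ℝ) (U : Set Q), IsOpen N ∧ IsOpen U ∧ t₁ ∈ N ∧ q₁ ∈ U ∧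
      N ⊆ I ∧ ContMDiffOn (𝓘(ℝ, ℝ).prod (𝓘(ℝ, ℝ).prod (𝓡 d))) (𝓡 d) (n : WithTop ℕ∞)
      (fun p : ℝ × ℝ × Q => ψ p.1 p.2.1 p.2.2) (N ×ˢ N ×ˢ U) := by
    intro t₁ ht₁ q₁
    obtain ⟨θ, ε, U, hε, hU, hqU, hNI, hθ, hθ'⟩ := hX.exists_flowBox hI hn ht₁ q₁
    refine ⟨Ioo (t₁ - ε) (t₁ + ε), U, isOpen_Ioo, hU, ⟨by linarith, by linarith⟩, hqU, hNI,
      hθ.congr ?_⟩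
    rintro ⟨s, t, q⟩ ⟨hs, ht, hq⟩
    obtain ⟨h1, h2⟩ := hθ' t ht q hq
    exact ((hψ t (hNI ht) q).1.mono hNI).eqOn hI hn hX h2 isOpen_Ioo ordConnected_Ioo hNI ht
      ((hψ t (hNI ht) q).2.trans h1.symm) hs
  -- Smoothness travels along the trajectory: near `s₁` one evolves from `t` to a fixed `s₂` and
  -- then inside the flow box around `ψ s₁ t q`, using the composition law. Connectedness of `I`
  -- carries this from `t` to `s`.
  have hstep : ∀ s₁ ∈ I, ∃ N : Set ℝ, IsOpen N ∧ s₁ ∈ N ∧ ∀ s₂ ∈ N, ∀ s₃ ∈ N,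
      ContMDiffAt (𝓘(ℝ, ℝ).prod (𝓘(ℝ, ℝ).prod (𝓡 d))) (𝓡 d) (n : WithTop ℕ∞)
        (fun p : ℝ × ℝ × Q => ψ p.1 p.2.1 p.2.2) (s₂, t, q) →
      ContMDiffAt (𝓘(ℝ, ℝ).prod (𝓘(ℝ, ℝ).prod (𝓡 d))) (𝓡 d) (n : WithTop ℕ∞)
        (fun p : ℝ × ℝ × Q => ψ p.1 p.2.1 p.2.2) (s₃, t, q) := by
    intro s₁ hs₁
    obtain ⟨N, U, hN, hU, hsN, hqU, hNI, hNU⟩ := hbox s₁ hs₁ (ψ s₁ t q)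
    have hcont : ∀ s ∈ I, ContinuousAt (fun s => ψ s t q) s :=
      fun s hs => (hψ t ht q).1.continuousAt hs
    obtain ⟨N', hN'N, hN', hsN'⟩ := mem_nhds_iff.1 (Filter.inter_mem (hN.mem_nhds hsN)
      ((hcont s₁ hs₁).eventually_mem (hU.mem_nhds hqU)))
    refine ⟨N', hN', hsN', fun s₂ hs₂ s₃ hs₃ h₂ => ?_⟩
    have hin : ContMDiffAt (𝓘(ℝ, ℝ).prod (𝓘(ℝ, ℝ).prod (𝓡 d)))
        (𝓘(ℝ, ℝ).prod (𝓘(ℝ, ℝ).prod (𝓡 d))) (n : WithTop ℕ∞)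
        (fun p : ℝ × ℝ × Q => (s₂, p.2.1, p.2.2)) (s₃, t, q) :=
      contMDiffAt_const.prodMk contMDiffAt_snd
    have h3 : ContMDiffAt (𝓘(ℝ, ℝ).prod (𝓘(ℝ, ℝ).prod (𝓡 d))) (𝓡 d) (n : WithTop ℕ∞)
        (fun p : ℝ × ℝ × Q => ψ s₂ p.2.1 p.2.2) (s₃, t, q) :=
      ContMDiffAt.comp (s₃, t, q)
        (f := fun p : ℝ × ℝ × Q => ((s₂, p.2.1, p.2.2) : ℝ × ℝ × Q)) h₂ hin
    have h4 : ContMDiffAt (𝓘(ℝ, ℝ).prod (𝓘(ℝ, ℝ).prod (𝓡 d)))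
        (𝓘(ℝ, ℝ).prod (𝓘(ℝ, ℝ).prod (𝓡 d))) (n : WithTop ℕ∞)
        (fun p : ℝ × ℝ × Q => ((p.1, s₂, ψ s₂ p.2.1 p.2.2) : ℝ × ℝ × Q)) (s₃, t, q) :=
      contMDiffAt_fst.prodMk (contMDiffAt_const.prodMk h3)
    have h5 := (hNU.contMDiffAt ((hN.prod (hN.prod hU)).mem_nhds
      (show ((s₃, s₂, ψ s₂ t q) : ℝ × ℝ × Q) ∈ N ×ˢ N ×ˢ U from
        ⟨(hN'N hs₃).1, (hN'N hs₂).1, (hN'N hs₂).2⟩)))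
    refine (ContMDiffAt.comp (s₃, t, q)
      (f := fun p : ℝ × ℝ × Q => ((p.1, s₂, ψ s₂ p.2.1 p.2.2) : ℝ × ℝ × Q))
      h5 h4).congr_of_eventuallyEq ?_
    filter_upwards [(hI.prod (hI.prod isOpen_univ)).mem_nhds
      (show ((s₃, t, q) : ℝ × ℝ × Q) ∈ I ×ˢ I ×ˢ univ from
        ⟨hNI (hN'N hs₃).1, ht, trivial⟩)] with p hp
    exact (evolution_comp hI hIc hn hX hψ hp.1 hp.2.1 (hNI (hN'N hs₂).1) p.2.2).symm
  have hstart : ContMDiffAt (𝓘(ℝ, ℝ).prod (𝓘(ℝ, ℝ).prod (𝓡 d))) (𝓡 d) (n : WithTop ℕ∞)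
      (fun p : ℝ × ℝ × Q => ψ p.1 p.2.1 p.2.2) (t, t, q) := by
    obtain ⟨N, U, hN, hU, htN, hqU, hNI, hNU⟩ := hbox t ht q
    exact hNU.contMDiffAt ((hN.prod (hN.prod hU)).mem_nhds ⟨htN, htN, hqU⟩)
  refine hIc.isPreconnected.induction₂' (fun x y =>
    ContMDiffAt (𝓘(ℝ, ℝ).prod (𝓘(ℝ, ℝ).prod (𝓡 d))) (𝓡 d) (n : WithTop ℕ∞)
      (fun p : ℝ × ℝ × Q => ψ p.1 p.2.1 p.2.2) (x, t, q) →
    ContMDiffAt (𝓘(ℝ, ℝ).prod (𝓘(ℝ, ℝ).prod (𝓡 d))) (𝓡 d) (n : WithTop ℕ∞)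
      (fun p : ℝ × ℝ × Q => ψ p.1 p.2.1 p.2.2) (y, t, q)) (fun x hx => ?_)
    (fun x y z _ _ _ h1 h2 h => h2 (h1 h)) ht hs hstart
  obtain ⟨N, hN, hxN, h⟩ := hstep x hx
  filter_upwards [mem_nhdsWithin_of_mem_nhds (hN.mem_nhds hxN)] with y hy
  exact ⟨h x hxN y hy, h y hy x hxN⟩

end SmoothEvolution

/-! ### The Hamiltonian on a vector space and its momentum derivative. -/

section Legendre

variable {E : Type u} [NormedAddCommGroup E] [NormedSpace ℝ E]

/-- The velocity `A⁻¹(p - b)` as a function of `(t, x, p)`. -/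
noncomputable def legendreVelocity (A : ℝ × E → E →L[ℝ] E →L[ℝ] ℝ) (b : ℝ × E → E →L[ℝ] ℝ)
    (w : ℝ × E × (E →L[ℝ] ℝ)) : E :=
  (A (w.1, w.2.1)).inverse (w.2.2 - b (w.1, w.2.1))

/-- The Hamiltonian `A⁻¹(p - b, p - b) / 2 + V` as a function of `(t, x, p)`. -/
noncomputable def legendreHamiltonian (A : ℝ × E → E →L[ℝ] E →L[ℝ] ℝ) (b : ℝ × E → E →L[ℝ] ℝ)
    (V : ℝ × E → ℝ) (w : ℝ × E × (E →L[ℝ] ℝ)) : ℝ :=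
  1 / 2 * (w.2.2 - b (w.1, w.2.1)) (legendreVelocity A b w) + V (w.1, w.2.1)

variable [FiniteDimensional ℝ E] {A : ℝ × E → E →L[ℝ] E →L[ℝ] ℝ} {b : ℝ × E → E →L[ℝ] ℝ}
  {V : ℝ × E → ℝ} {O : Set (ℝ × E)} {n : WithTop ℕ∞}

lemma contDiffOn_legendreVelocity (hA : ContDiffOn ℝ n A O) (hb : ContDiffOn ℝ n b O)
    (hpos : ∀ z ∈ O, ∀ v, v ≠ 0 → 0 < A z v v) :
    ContDiffOn ℝ n (legendreVelocity A b) {w | (w.1, w.2.1) ∈ O} := by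
  have : CompleteSpace E := FiniteDimensional.complete ℝ E
  have hp : ContDiff ℝ n (fun w : ℝ × E × (E →L[ℝ] ℝ) => (w.1, w.2.1)) := by fun_prop
  have h1 : ContDiffOn ℝ n (fun z => (A z).inverse) O := fun z hz =>
    (ContinuousLinearMap.isInvertible_of_pos (hpos z hz)).contDiffAt_map_inverse.comp_contDiffWithinAt
      z (hA z hz)
  have h2 : ContDiff ℝ n (fun w : ℝ × E × (E →L[ℝ] ℝ) => w.2.2) := by fun_prop
  exact (h1.comp hp.contDiffOn (fun w hw => hw)).clm_apply
    (h2.contDiffOn.sub (hb.comp hp.contDiffOn (fun w hw => hw)))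

lemma contDiffOn_legendreHamiltonian (hA : ContDiffOn ℝ n A O) (hb : ContDiffOn ℝ n b O)
    (hV : ContDiffOn ℝ n V O) (hpos : ∀ z ∈ O, ∀ v, v ≠ 0 → 0 < A z v v) :
    ContDiffOn ℝ n (legendreHamiltonian A b V) {w | (w.1, w.2.1) ∈ O} := by
  have hp : ContDiff ℝ n (fun w : ℝ × E × (E →L[ℝ] ℝ) => (w.1, w.2.1)) := by fun_prop
  have h2 : ContDiff ℝ n (fun w : ℝ × E × (E →L[ℝ] ℝ) => w.2.2) := by fun_prop
  exact (contDiffOn_const.mul ((h2.contDiffOn.sub (hb.comp hp.contDiffOn (fun w hw => hw))).clm_apply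
    (contDiffOn_legendreVelocity hA hb hpos))).add (hV.comp hp.contDiffOn (fun w hw => hw))

/-- The derivative of the Hamiltonian in the direction of the momenta. -/
lemma fderiv_legendreHamiltonian {w : ℝ × E × (E →L[ℝ] ℝ)}
    (hd : DifferentiableAt ℝ (legendreHamiltonian A b V) w)
    (hsymm : ∀ v v', A (w.1, w.2.1) v v' = A (w.1, w.2.1) v' v)
    (hpos : ∀ v, v ≠ 0 → 0 < A (w.1, w.2.1) v v) (π : E →L[ℝ] ℝ) :
    fderiv ℝ (legendreHamiltonian A b V) w (0, 0, π) = π (legendreVelocity A b w) := by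
  obtain ⟨t, x, p⟩ := w
  set B := (A (t, x)).inverse with hB
  have hinv := ContinuousLinearMap.isInvertible_of_pos hpos
  have hBs : ∀ α β : E →L[ℝ] ℝ, α (B β) = β (B α) := fun α β => by
    conv_lhs => rw [← hinv.self_apply_inverse α]
    conv_rhs => rw [← hinv.self_apply_inverse β]
    exact hsymm _ _
  have h1 : HasDerivAt (fun s : ℝ => ((t, x, p + s • π) : ℝ × E × (E →L[ℝ] ℝ))) (0, 0, π) 0 := by
    refine (hasDerivAt_const _ _).prodMk ((hasDerivAt_const _ _).prodMk ?_)
    simpa using ((hasDerivAt_id (0 : ℝ)).smul_const π).const_add p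
  have h2 : HasFDerivAt (legendreHamiltonian A b V)
      (fderiv ℝ (legendreHamiltonian A b V) (t, x, p)) (t, x, p + (0 : ℝ) • π) := by
    rw [zero_smul, add_zero]
    exact hd.hasFDerivAt
  have h3 := h2.comp_hasDerivAt (0 : ℝ) h1
  -- Along a line of momenta the Hamiltonian is a quadratic polynomial in `s`; symmetry of the
  -- inverse merges the two linear terms.
  have h4 : (legendreHamiltonian A b V ∘ fun s : ℝ => ((t, x, p + s • π) : ℝ × E × (E →L[ℝ] ℝ))) =
      fun s => (1 / 2 * (p - b (t, x)) (B (p - b (t, x))) + V (t, x)) +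
        s * π (B (p - b (t, x))) + s * s * (1 / 2 * π (B π)) := by
    funext s
    have e : p + s • π - b (t, x) = (p - b (t, x)) + s • π := by abel
    simp only [Function.comp, legendreHamiltonian, legendreVelocity, ← hB, e]
    generalize p - b (t, x) = β
    have h5 := hBs π β
    simp only [map_add, map_smul, add_apply, smul_apply, smul_eq_mul]
    rw [h5]
    ring
  rw [h4] at h3
  refine h3.unique ?_
  have h6 : HasDerivAt (fun s : ℝ => (1 / 2 * (p - b (t, x)) (B (p - b (t, x))) + V (t, x)) +
        s * π (B (p - b (t, x))) + s * s * (1 / 2 * π (B π)))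
      (0 + 1 * π (B (p - b (t, x))) + (1 * 0 + 0 * 1) * (1 / 2 * π (B π))) 0 :=
    ((hasDerivAt_const _ _).add ((hasDerivAt_id (0 : ℝ)).mul_const _)).add
      (((hasDerivAt_id (0 : ℝ)).mul (hasDerivAt_id (0 : ℝ))).mul_const _)
  refine h6.congr_deriv ?_
  simp [legendreVelocity, ← hB]

end Legendre

/-! ### The data in a chart. -/

section ChartData

open Set Filter Topology

variable {d : ℕ} {Q : Type*} [TopologicalSpace Q] [ChartedSpace (EuclideanSpace ℝ (Fin d)) Q]

/-- The differential of the inverse of the chart at `q₁`. -/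
noncomputable def chartSymmDeriv (q₁ : Q) (x : EuclideanSpace ℝ (Fin d)) :
    EuclideanSpace ℝ (Fin d) →L[ℝ] EuclideanSpace ℝ (Fin d) :=
  mfderiv (𝓡 d) (𝓡 d) (chartAt (EuclideanSpace ℝ (Fin d)) q₁).symm x

variable [IsManifold (𝓡 d) 1 Q]

lemma mfderiv_chart_chartSymmDeriv {q₁ : Q} {x : EuclideanSpace ℝ (Fin d)}
    (hx : x ∈ (chartAt (EuclideanSpace ℝ (Fin d)) q₁).target) (v : EuclideanSpace ℝ (Fin d)) :
    (mfderiv (𝓡 d) (𝓡 d) (chartAt (EuclideanSpace ℝ (Fin d)) q₁)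
      ((chartAt (EuclideanSpace ℝ (Fin d)) q₁).symm x) :
      EuclideanSpace ℝ (Fin d) →L[ℝ] EuclideanSpace ℝ (Fin d)) (chartSymmDeriv q₁ x v) = v :=
  congrArg (fun L : EuclideanSpace ℝ (Fin d) →L[ℝ] EuclideanSpace ℝ (Fin d) => L v)
    ((mdifferentiable_chart (I := 𝓡 d) q₁).comp_symm_deriv hx)

lemma chartSymmDeriv_mfderiv_chart {q₁ : Q} {x : EuclideanSpace ℝ (Fin d)}
    (hx : x ∈ (chartAt (EuclideanSpace ℝ (Fin d)) q₁).target) (v : EuclideanSpace ℝ (Fin d)) :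
    chartSymmDeriv q₁ x ((mfderiv (𝓡 d) (𝓡 d) (chartAt (EuclideanSpace ℝ (Fin d)) q₁)
      ((chartAt (EuclideanSpace ℝ (Fin d)) q₁).symm x) :
      EuclideanSpace ℝ (Fin d) →L[ℝ] EuclideanSpace ℝ (Fin d)) v) = v := by
  have h1 := (mdifferentiable_chart (I := 𝓡 d) q₁).symm_comp_deriv
    ((chartAt (EuclideanSpace ℝ (Fin d)) q₁).map_target hx)
  have h2 := congrArg
    (fun L : EuclideanSpace ℝ (Fin d) →L[ℝ] EuclideanSpace ℝ (Fin d) => L v) h1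
  rw [(chartAt (EuclideanSpace ℝ (Fin d)) q₁).right_inv hx] at h2
  exact h2

lemma chartSymmDeriv_injective {q₁ : Q} {x : EuclideanSpace ℝ (Fin d)}
    (hx : x ∈ (chartAt (EuclideanSpace ℝ (Fin d)) q₁).target) :
    Function.Injective (chartSymmDeriv q₁ x) := fun v w h => by
  rw [← mfderiv_chart_chartSymmDeriv hx v, ← mfderiv_chart_chartSymmDeriv hx w, h]

/-- Composing the functions on `ℝ × TQ` that define the regularity of `a` and `b` with this
coordinate field gives components in the chart. The tangent map of the chart costs one derivative,
hence the class `n + 1` of `Q`. -/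
lemma contMDiffOn_chartSymmDeriv {n : WithTop ℕ∞} [IsManifold (𝓡 d) (n + 1) Q] (q₁ : Q)
    (v : EuclideanSpace ℝ (Fin d)) :
    ContMDiffOn 𝓘(ℝ, ℝ × EuclideanSpace ℝ (Fin d)) (𝓘(ℝ, ℝ).prod (𝓡 d).tangent) n
      (fun z : ℝ × EuclideanSpace ℝ (Fin d) =>
        (z.1, (⟨(chartAt (EuclideanSpace ℝ (Fin d)) q₁).symm z.2, chartSymmDeriv q₁ z.2 v⟩ :
          TangentBundle (𝓡 d) Q)))
      (univ ×ˢ (chartAt (EuclideanSpace ℝ (Fin d)) q₁).target) := by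
  set c := chartAt (EuclideanSpace ℝ (Fin d)) q₁ with hc
  have h1 : ContMDiff 𝓘(ℝ, EuclideanSpace ℝ (Fin d)) 𝓘(ℝ, EuclideanSpace ℝ (Fin d)).tangent n
      (fun x : EuclideanSpace ℝ (Fin d) =>
        (⟨x, v⟩ : TangentBundle 𝓘(ℝ, EuclideanSpace ℝ (Fin d)) (EuclideanSpace ℝ (Fin d)))) :=
    contMDiff_vectorSpace_iff_contDiff (V := fun _ => v).2 contDiff_const
  have h2 := (contMDiffOn_chart_symm (I := 𝓡 d) (x := q₁) (n := n + 1)).contMDiffOn_tangentMapWithin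
    le_rfl c.open_target.uniqueMDiffOn
  have h3 := h2.comp (h1.comp (contDiff_snd (𝕜 := ℝ) (E := ℝ)).contMDiff).contMDiffOn
    (s := univ ×ˢ c.target) (fun z hz => hz.2)
  refine (contDiff_fst.contMDiff.contMDiffOn.prodMk h3).congr fun z hz => ?_
  have e : mfderivWithin (𝓡 d) (𝓡 d) c.symm c.target z.2 = mfderiv (𝓡 d) (𝓡 d) c.symm z.2 :=
    mfderivWithin_of_isOpen c.open_target hz.2
  exact congrArg (fun L : EuclideanSpace ℝ (Fin d) →L[ℝ] EuclideanSpace ℝ (Fin d) =>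
    (z.1, (⟨c.symm z.2, L v⟩ : TangentBundle (𝓡 d) Q))) e.symm

/-- The derivative of a map on `ℝ × Q` given in a chart. -/
lemma hasMFDerivAt_of_hasFDerivAt_chart {F : Type*} [NormedAddCommGroup F] [NormedSpace ℝ F]
    {u : ℝ × EuclideanSpace ℝ (Fin d) → F} {L : ℝ × EuclideanSpace ℝ (Fin d) →L[ℝ] F} {t : ℝ} {q q₁ : Q}
    (hq : q ∈ (chartAt (EuclideanSpace ℝ (Fin d)) q₁).source)
    (hu : HasFDerivAt u L (t, chartAt (EuclideanSpace ℝ (Fin d)) q₁ q)) :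
    HasMFDerivAt (𝓘(ℝ, ℝ).prod (𝓡 d)) 𝓘(ℝ, F)
      (fun z : ℝ × Q => u (z.1, chartAt (EuclideanSpace ℝ (Fin d)) q₁ z.2)) (t, q)
      (L ∘L (ContinuousLinearMap.fst ℝ ℝ (EuclideanSpace ℝ (Fin d))).prod
        ((mfderiv (𝓡 d) (𝓡 d) (chartAt (EuclideanSpace ℝ (Fin d)) q₁) q :
          EuclideanSpace ℝ (Fin d) →L[ℝ] EuclideanSpace ℝ (Fin d)) ∘L
          ContinuousLinearMap.snd ℝ ℝ (EuclideanSpace ℝ (Fin d)))) := by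
  have h1 := ((mdifferentiable_chart (I := 𝓡 d) q₁).mdifferentiableAt hq).hasMFDerivAt
  have h2 := (hasMFDerivAt_fst (I := 𝓘(ℝ, ℝ)) (I' := 𝓡 d) (t, q)).prodMk
    (h1.comp (t, q) (hasMFDerivAt_snd (I := 𝓘(ℝ, ℝ)) (I' := 𝓡 d) (t, q)))
  have h3 := hasMFDerivAt_iff_hasFDerivAt.2 hu
  rw [modelWithCornersSelf_prod, ← chartedSpaceSelf_prod] at h3
  exact h3.comp (t, q) h2

/-- The derivative, in a chart, of a function on `ℝ × Q`. -/
lemma hasFDerivAt_chart_of_hasMFDerivAt {u : ℝ × Q → ℝ}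
    {L : ℝ × EuclideanSpace ℝ (Fin d) →L[ℝ] ℝ} {t : ℝ} {x : EuclideanSpace ℝ (Fin d)} {q₁ : Q}
    (hx : x ∈ (chartAt (EuclideanSpace ℝ (Fin d)) q₁).target)
    (hu : HasMFDerivAt (𝓘(ℝ, ℝ).prod (𝓡 d)) 𝓘(ℝ, ℝ) u
      (t, (chartAt (EuclideanSpace ℝ (Fin d)) q₁).symm x) L) :
    HasFDerivAt (fun z : ℝ × EuclideanSpace ℝ (Fin d) =>
      u (z.1, (chartAt (EuclideanSpace ℝ (Fin d)) q₁).symm z.2))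
      (L ∘L (ContinuousLinearMap.fst ℝ ℝ (EuclideanSpace ℝ (Fin d))).prod
        (chartSymmDeriv q₁ x ∘L ContinuousLinearMap.snd ℝ ℝ (EuclideanSpace ℝ (Fin d)))) (t, x) := by
  have h1 := ((mdifferentiable_chart (I := 𝓡 d) q₁).mdifferentiableAt_symm hx).hasMFDerivAt
  have h2 : HasMFDerivAt 𝓘(ℝ, ℝ × EuclideanSpace ℝ (Fin d)) 𝓘(ℝ, ℝ)
      (Prod.fst : ℝ × EuclideanSpace ℝ (Fin d) → ℝ) (t, x)
      (ContinuousLinearMap.fst ℝ ℝ (EuclideanSpace ℝ (Fin d))) :=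
    hasMFDerivAt_iff_hasFDerivAt.2 hasFDerivAt_fst
  have h3 : HasMFDerivAt 𝓘(ℝ, ℝ × EuclideanSpace ℝ (Fin d)) 𝓘(ℝ, EuclideanSpace ℝ (Fin d))
      (Prod.snd : ℝ × EuclideanSpace ℝ (Fin d) → EuclideanSpace ℝ (Fin d)) (t, x)
      (ContinuousLinearMap.snd ℝ ℝ (EuclideanSpace ℝ (Fin d))) :=
    hasMFDerivAt_iff_hasFDerivAt.2 hasFDerivAt_snd
  exact hasMFDerivAt_iff_hasFDerivAt.1 (hu.comp (t, x) (h2.prodMk (h1.comp (t, x) h3)))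

namespace BrinkmannData

variable {r : ℕ∞}

/-- The metric in the chart at `q₁`. -/
noncomputable def chartMetric (D : BrinkmannData d Q r) (q₁ : Q)
    (z : ℝ × EuclideanSpace ℝ (Fin d)) :
    EuclideanSpace ℝ (Fin d) →L[ℝ] EuclideanSpace ℝ (Fin d) →L[ℝ] ℝ :=
  ContinuousLinearMap.bilinearComp
    (D.a z.1 ((chartAt (EuclideanSpace ℝ (Fin d)) q₁).symm z.2) :
      EuclideanSpace ℝ (Fin d) →L[ℝ] EuclideanSpace ℝ (Fin d) →L[ℝ] ℝ)
    (chartSymmDeriv q₁ z.2) (chartSymmDeriv q₁ z.2)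

/-- The 1-form in the chart at `q₁`. -/
noncomputable def chartForm (D : BrinkmannData d Q r) (q₁ : Q)
    (z : ℝ × EuclideanSpace ℝ (Fin d)) : EuclideanSpace ℝ (Fin d) →L[ℝ] ℝ :=
  (D.b z.1 ((chartAt (EuclideanSpace ℝ (Fin d)) q₁).symm z.2) :
    EuclideanSpace ℝ (Fin d) →L[ℝ] ℝ) ∘L chartSymmDeriv q₁ z.2

/-- The potential in the chart at `q₁`. -/
def chartPotential (D : BrinkmannData d Q r) (q₁ : Q) (z : ℝ × EuclideanSpace ℝ (Fin d)) : ℝ :=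
  D.V z.1 ((chartAt (EuclideanSpace ℝ (Fin d)) q₁).symm z.2)

variable (D : BrinkmannData d Q r)

lemma chartMetric_symm (q₁ : Q) (z : ℝ × EuclideanSpace ℝ (Fin d))
    (v w : EuclideanSpace ℝ (Fin d)) : D.chartMetric q₁ z v w = D.chartMetric q₁ z w v :=
  D.isMetric.symm z.1 _ trivial (chartSymmDeriv q₁ z.2 v) (chartSymmDeriv q₁ z.2 w)

lemma chartMetric_pos {q₁ : Q} {z : ℝ × EuclideanSpace ℝ (Fin d)}
    (hz : z.2 ∈ (chartAt (EuclideanSpace ℝ (Fin d)) q₁).target)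
    (v : EuclideanSpace ℝ (Fin d)) (hv : v ≠ 0) : 0 < D.chartMetric q₁ z v v :=
  D.isMetric.pos z.1 _ trivial (chartSymmDeriv q₁ z.2 v) fun h =>
    hv (chartSymmDeriv_injective hz (h.trans (map_zero _).symm))

/-- Regularity is given for the quadratic form only; polarization and symmetry pass to the bilinear
components. -/
lemma contDiffOn_chartMetric [IsManifold (𝓡 d) ((r : WithTop ℕ∞) + 1) Q] (q₁ : Q) :
    ContDiffOn ℝ r (D.chartMetric q₁)
      (univ ×ˢ (chartAt (EuclideanSpace ℝ (Fin d)) q₁).target) := by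
  have hquad : ∀ v, ContDiffOn ℝ r (fun z => D.chartMetric q₁ z v v)
      (univ ×ˢ (chartAt (EuclideanSpace ℝ (Fin d)) q₁).target) := fun v =>
    (D.isMetric.contMDiffOn.comp (contMDiffOn_chartSymmDeriv q₁ v)
      (fun _ _ => trivial)).contDiffOn
  rw [contDiffOn_clm_apply]
  intro v
  rw [contDiffOn_clm_apply]
  intro w
  refine (contDiffOn_const (c := (1 / 2 : ℝ)).mul
    (((hquad (v + w)).sub (hquad v)).sub (hquad w))).congr fun z _ => ?_
  have h1 := D.chartMetric_symm q₁ z v w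
  simp only [map_add, add_apply]
  rw [h1]
  ring

lemma contDiffOn_chartForm [IsManifold (𝓡 d) ((r : WithTop ℕ∞) + 1) Q] (q₁ : Q) :
    ContDiffOn ℝ r (D.chartForm q₁)
      (univ ×ˢ (chartAt (EuclideanSpace ℝ (Fin d)) q₁).target) := by
  rw [contDiffOn_clm_apply]
  intro v
  exact (D.contMDiff_b.comp_contMDiffOn (contMDiffOn_chartSymmDeriv q₁ v)).contDiffOn

lemma contDiffOn_chartPotential [IsManifold (𝓡 d) (r : WithTop ℕ∞) Q] (q₁ : Q) :
    ContDiffOn ℝ r (D.chartPotential q₁)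
      (univ ×ˢ (chartAt (EuclideanSpace ℝ (Fin d)) q₁).target) :=
  (D.contMDiff_V.comp_contMDiffOn (contDiff_fst.contMDiff.contMDiffOn.prodMk
    ((contMDiffOn_chart_symm (I := 𝓡 d) (x := q₁)).comp contDiff_snd.contMDiff.contMDiffOn
      (fun z hz => hz.2)))).contDiffOn

/-- The vector `a_t⁻¹(·, p - b_t)` in the chart at `q₁`. -/
lemma chartSymmDeriv_legendreVelocity {q₁ : Q} {t : ℝ} {x : EuclideanSpace ℝ (Fin d)}
    (hx : x ∈ (chartAt (EuclideanSpace ℝ (Fin d)) q₁).target)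
    {p : TangentSpace (𝓡 d) ((chartAt (EuclideanSpace ℝ (Fin d)) q₁).symm x) →L[ℝ] ℝ}
    {π : EuclideanSpace ℝ (Fin d) →L[ℝ] ℝ} (hp : ∀ v, π v = p (chartSymmDeriv q₁ x v)) :
    chartSymmDeriv q₁ x (legendreVelocity (D.chartMetric q₁) (D.chartForm q₁) (t, x, π)) =
      D.sharp t ((chartAt (EuclideanSpace ℝ (Fin d)) q₁).symm x)
        (p - D.b t ((chartAt (EuclideanSpace ℝ (Fin d)) q₁).symm x)) := by
  refine D.eq_sharp_iff.2 (ContinuousLinearMap.ext fun w => ?_)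
  obtain ⟨w', hw'⟩ : ∃ w' : EuclideanSpace ℝ (Fin d), chartSymmDeriv q₁ x w' = w :=
    ⟨_, chartSymmDeriv_mfderiv_chart hx w⟩
  subst hw'
  have h1 := (ContinuousLinearMap.isInvertible_of_pos
    (D.chartMetric_pos (z := (t, x)) hx)).self_apply_inverse (π - D.chartForm q₁ (t, x))
  exact (congrArg (fun L : EuclideanSpace ℝ (Fin d) →L[ℝ] ℝ => L w') h1).trans
    (congrArg (· - D.chartForm q₁ (t, x) w') (hp w'))

lemma legendreHamiltonian_chart {q₁ : Q} {t : ℝ} {x : EuclideanSpace ℝ (Fin d)}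
    (hx : x ∈ (chartAt (EuclideanSpace ℝ (Fin d)) q₁).target)
    {p : TangentSpace (𝓡 d) ((chartAt (EuclideanSpace ℝ (Fin d)) q₁).symm x) →L[ℝ] ℝ}
    {π : EuclideanSpace ℝ (Fin d) →L[ℝ] ℝ} (hp : ∀ v, π v = p (chartSymmDeriv q₁ x v)) :
    D.hamiltonian t ((chartAt (EuclideanSpace ℝ (Fin d)) q₁).symm x) p =
      legendreHamiltonian (D.chartMetric q₁) (D.chartForm q₁) (D.chartPotential q₁) (t, x, π) := by
  rw [hamiltonian, ← D.chartSymmDeriv_legendreVelocity hx hp]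
  exact congrArg (fun s => 1 / 2 * (s - D.chartForm q₁ (t, x)
    (legendreVelocity (D.chartMetric q₁) (D.chartForm q₁) (t, x, π))) + D.chartPotential q₁ (t, x))
    (hp _).symm

end BrinkmannData

end ChartData

/-! ### Rosen coordinates from a solution with complete characteristics. -/

section RosenOfHamiltonJacobi

open Set Filter Topology

variable {d : ℕ}

/-- The change of coordinates which follows the curves of a complete evolution back to `t₀`. -/
noncomputable def evolutionCoordinates {Q : Type*} [TopologicalSpace Q] {I : Set ℝ} (hI : IsOpen I)
    {t₀ : ℝ} (ht₀ : t₀ ∈ I) (ψ : ℝ → ℝ → Q → Q)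
    (hcomp : ∀ s ∈ I, ∀ t ∈ I, ∀ q, ψ t s (ψ s t q) = q)
    (h₁ : ContinuousOn (fun z : ℝ × Q => ψ t₀ z.1 z.2) (I ×ˢ univ))
    (h₂ : ContinuousOn (fun z : ℝ × Q => ψ z.1 t₀ z.2) (I ×ˢ univ)) :
    OpenPartialHomeomorph (ℝ × Q) (ℝ × Q) where
  toFun z := (z.1, ψ t₀ z.1 z.2)
  invFun z := (z.1, ψ z.1 t₀ z.2)
  source := I ×ˢ univ
  target := I ×ˢ univ
  map_source' z hz := ⟨hz.1, trivial⟩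
  map_target' z hz := ⟨hz.1, trivial⟩
  left_inv' z hz := Prod.ext rfl (hcomp t₀ ht₀ z.1 hz.1 z.2)
  right_inv' z hz := Prod.ext rfl (hcomp z.1 hz.1 t₀ ht₀ z.2)
  open_source := hI.prod isOpen_univ
  open_target := hI.prod isOpen_univ
  continuousOn_toFun := continuousOn_fst.prodMk h₁
  continuousOn_invFun := continuousOn_fst.prodMk h₂

namespace BrinkmannData

variable {Q : Type*} [TopologicalSpace Q] [ChartedSpace (EuclideanSpace ℝ (Fin d)) Q]
  [IsManifold (𝓡 d) 1 Q] {r k : ℕ∞} {I : Set ℝ} {u : ℝ → Q → ℝ}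

/-- The velocity field of the base characteristics. -/
noncomputable def characteristicField (D : BrinkmannData d Q r) (u : ℝ → Q → ℝ) (t : ℝ) (q : Q) :
    TangentSpace (𝓡 d) q := D.sharp t q (dq u t q - D.b t q)

/-- The field involves `∂u/∂q`, which is `C^(k-1)`, and the data, which are `C^r` with `k - 1 ≤ r`;
in a chart it is the Legendre velocity at the momentum `∂u/∂q`. -/
lemma isTimeFieldOn_characteristicField (D : BrinkmannData d Q r)
    [IsManifold (𝓡 d) ((r : WithTop ℕ∞) + 1) Q] (hI : IsOpen I) (hk : 1 ≤ k) (hkr : k ≤ r + 1)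
    (hu : ContMDiffOn (𝓘(ℝ, ℝ).prod (𝓡 d)) 𝓘(ℝ, ℝ) (k : WithTop ℕ∞)
      (fun p : ℝ × Q => u p.1 p.2) (I ×ˢ univ)) :
    IsTimeFieldOn (k - 1) (D.characteristicField u) I := by
  intro q₁
  set c := chartAt (EuclideanSpace ℝ (Fin d)) q₁ with hc
  set v : ℝ × EuclideanSpace ℝ (Fin d) → ℝ := fun z => u z.1 (c.symm z.2) with hv
  have hkr' : ((k : ℕ∞) : WithTop ℕ∞) ≤ (r : WithTop ℕ∞) + 1 := by exact_mod_cast hkr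
  have hopen : IsOpen (I ×ˢ c.target) := hI.prod c.open_target
  have hvk : ContDiffOn ℝ k v (I ×ˢ c.target) :=
    (hu.comp (contDiff_fst.contMDiff.contMDiffOn.prodMk
      (((contMDiffOn_chart_symm (I := 𝓡 d) (x := q₁)).of_le hkr').comp
        contDiff_snd.contMDiff.contMDiffOn (fun z hz => hz.2)))
      (fun z hz => ⟨hz.1, trivial⟩)).contDiffOn
  have hk1 : (((k - 1 : ℕ∞) : WithTop ℕ∞)) + 1 ≤ (k : WithTop ℕ∞) := by
    exact_mod_cast (tsub_add_cancel_of_le hk).le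
  have hr1 : ((k - 1 : ℕ∞) : WithTop ℕ∞) ≤ (r : WithTop ℕ∞) := by
    exact_mod_cast tsub_le_iff_right.2 hkr
  have hdv : ContDiffOn ℝ ((k - 1 : ℕ∞) : WithTop ℕ∞)
      (fun z => fderiv ℝ v z ∘L ContinuousLinearMap.inr ℝ ℝ (EuclideanSpace ℝ (Fin d)))
      (I ×ˢ c.target) := (hvk.fderiv_of_isOpen hopen hk1).clm_comp contDiffOn_const
  have hleg := contDiffOn_legendreVelocity
    ((D.contDiffOn_chartMetric q₁).of_le hr1) ((D.contDiffOn_chartForm q₁).of_le hr1)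
    (fun _ hz => D.chartMetric_pos hz.2)
  refine ⟨fun z => legendreVelocity (D.chartMetric q₁) (D.chartForm q₁) (z.1, z.2,
    fderiv ℝ v z ∘L ContinuousLinearMap.inr ℝ ℝ (EuclideanSpace ℝ (Fin d))),
    hleg.comp (contDiffOn_fst.prodMk (contDiffOn_snd.prodMk hdv)) (fun z hz => ⟨trivial, hz.2⟩),
    fun t ht x hx => ?_⟩
  refine D.chartSymmDeriv_legendreVelocity hx fun w => ?_
  have hk0 : (k : WithTop ℕ∞) ≠ 0 := by
    have : k ≠ 0 := (zero_lt_one.trans_le hk).ne'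
    exact_mod_cast this
  obtain ⟨U, hU⟩ : ∃ U : ℝ × EuclideanSpace ℝ (Fin d) →L[ℝ] ℝ,
      HasMFDerivAt (𝓘(ℝ, ℝ).prod (𝓡 d)) 𝓘(ℝ, ℝ) (fun z : ℝ × Q => u z.1 z.2) (t, c.symm x) U :=
    ⟨_, ((hu.contMDiffAt ((hI.prod isOpen_univ).mem_nhds ⟨ht, trivial⟩)).mdifferentiableAt
      hk0).hasMFDerivAt⟩
  have h1 := (hasFDerivAt_chart_of_hasMFDerivAt hx hU).fderiv
  exact (congrArg (fun L : ℝ × EuclideanSpace ℝ (Fin d) →L[ℝ] ℝ => L (0, w)) h1).trans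
    ((hasDerivAt_dq_of_hasMFDerivAt hU).2 (chartSymmDeriv q₁ x w)).symm

end BrinkmannData

/-- A change of coordinates which is constant along a curve kills its velocity. -/
lemma mfderiv_evolutionCoordinates {Q : Type*} [TopologicalSpace Q]
    [ChartedSpace (EuclideanSpace ℝ (Fin d)) Q] {Ψ : ℝ × Q → ℝ × Q} {t : ℝ} {q' : Q} {γ : ℝ → Q}
    {Z : TangentSpace (𝓡 d) (γ t)}
    (hΨ : MDifferentiableAt (𝓘(ℝ, ℝ).prod (𝓡 d)) (𝓘(ℝ, ℝ).prod (𝓡 d)) Ψ (t, γ t))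
    (hγ : HasMFDerivAt 𝓘(ℝ, ℝ) (𝓡 d) γ t (ContinuousLinearMap.toSpanSingleton ℝ Z))
    (hconst : ∀ᶠ s in 𝓝 t, Ψ (s, γ s) = (s, q')) :
    (mfderiv (𝓘(ℝ, ℝ).prod (𝓡 d)) (𝓘(ℝ, ℝ).prod (𝓡 d)) Ψ (t, γ t) :
      ℝ × EuclideanSpace ℝ (Fin d) →L[ℝ] ℝ × EuclideanSpace ℝ (Fin d)) (1, Z) = (1, 0) := by
  have h1 := hΨ.hasMFDerivAt.comp t ((hasMFDerivAt_id t).prodMk hγ)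
  have h2 : HasMFDerivAt 𝓘(ℝ, ℝ) (𝓘(ℝ, ℝ).prod (𝓡 d)) (fun s : ℝ => (s, q')) t
      ((ContinuousLinearMap.id ℝ ℝ).prod (0 : ℝ →L[ℝ] EuclideanSpace ℝ (Fin d))) :=
    (hasMFDerivAt_id t).prodMk (hasMFDerivAt_const q' t)
  have h3 := hasMFDerivAt_unique h1 (h2.congr_of_eventuallyEq hconst)
  have h4 := congrArg (fun L : ℝ →L[ℝ] ℝ × EuclideanSpace ℝ (Fin d) => L 1) h3
  have h5 : ∀ (A : ℝ × EuclideanSpace ℝ (Fin d) →L[ℝ] ℝ × EuclideanSpace ℝ (Fin d))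
      (Z : EuclideanSpace ℝ (Fin d)), A (1, (1 : ℝ) • Z) = (1, 0) → A (1, Z) = (1, 0) :=
    fun A Z h => by rwa [one_smul] at h
  exact h5 _ _ h4

namespace BrinkmannData

/-- A solution of the Hamilton-Jacobi equation whose base characteristics are complete gives Rosen
coordinates. -/
theorem HasHJSolution.hasRosen {Q : Type u} [TopologicalSpace Q] [T2Space Q]
    [ChartedSpace (EuclideanSpace ℝ (Fin d)) Q] [IsManifold (𝓡 d) 1 Q] {r k : ℕ∞}
    [IsManifold (𝓡 d) ((r : WithTop ℕ∞) + 1) Q] {D : BrinkmannData d Q r} {I : Set ℝ}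
    (hk : 2 ≤ k) (hkr : k ≤ r + 1) (hI : IsOpen I) (hIc : I.OrdConnected) {t₀ : ℝ} (ht₀ : t₀ ∈ I)
    (h : D.HasHJSolution k I) : D.HasRosen (k - 1) k I := by
  obtain ⟨u, hu, hchar⟩ := h
  have hk1 : 1 ≤ k := le_trans (by norm_num) hk
  have hn : 1 ≤ k - 1 := ENat.le_sub_of_add_le_left ENat.one_ne_top
    (by simpa [one_add_one_eq_two] using hk)
  have hnk : k - 1 ≤ k := tsub_le_self
  have hnr : k - 1 ≤ r + 1 := hnk.trans hkr
  have hn0 : ((k - 1 : ℕ∞) : WithTop ℕ∞) ≠ 0 := by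
    have : k - 1 ≠ 0 := (zero_lt_one.trans_le hn).ne'
    exact_mod_cast this
  have hX := D.isTimeFieldOn_characteristicField hI hk1 hkr hu.contMDiffOn
  have hman : IsManifold (𝓡 d) ((k - 1 : ℕ∞) : WithTop ℕ∞) Q :=
    IsManifold.of_le (n := (r : WithTop ℕ∞) + 1) (by exact_mod_cast hnr)
  -- Membership in `I` sits inside the existential so that `choose` yields a total function; for `t`
  -- outside `I` a constant curve is a default.
  have hex : ∀ t q, ∃ γ : ℝ → Q, t ∈ I →
      IsEvolutionCurveOn (D.characteristicField u) I γ ∧ γ t = q := by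
    intro t q
    by_cases ht : t ∈ I
    · obtain ⟨γ, h1, h2⟩ := hchar.1 t ht q
      exact ⟨γ, fun _ => ⟨h1, h2⟩⟩
    · exact ⟨fun _ => q, fun h => (ht h).elim⟩
  choose γ hγ using hex
  set ψ : ℝ → ℝ → Q → Q := fun s t q => γ t q s with hψdef
  have hψ : ∀ t ∈ I, ∀ q, IsEvolutionCurveOn (D.characteristicField u) I (fun s => ψ s t q) ∧
      ψ t t q = q := fun t ht q => hγ t q ht
  have hcomp : ∀ s ∈ I, ∀ t ∈ I, ∀ q, ψ t s (ψ s t q) = q := fun s hs t ht q =>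
    (evolution_comp hI hIc hn hX hψ ht ht hs q).trans (hψ t ht q).2
  have hsmooth : ∀ s ∈ I, ∀ t ∈ I, ∀ q, _ := fun s hs t ht q =>
    contMDiffAt_evolution hI hIc hn hX hψ hs ht q
  have hb : ContMDiffOn (𝓘(ℝ, ℝ).prod (𝓡 d)) (𝓡 d) ((k - 1 : ℕ∞) : WithTop ℕ∞)
      (fun z : ℝ × Q => ψ t₀ z.1 z.2) (I ×ˢ univ) := fun z hz =>
    (ContMDiffAt.comp z (f := fun z : ℝ × Q => ((t₀, z.1, z.2) : ℝ × ℝ × Q))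
      (hsmooth t₀ ht₀ z.1 hz.1 z.2) (contMDiffAt_const.prodMk contMDiffAt_id)).contMDiffWithinAt
  have hf : ContMDiffOn (𝓘(ℝ, ℝ).prod (𝓡 d)) (𝓡 d) ((k - 1 : ℕ∞) : WithTop ℕ∞)
      (fun z : ℝ × Q => ψ z.1 t₀ z.2) (I ×ˢ univ) := fun z hz =>
    (ContMDiffAt.comp z (f := fun z : ℝ × Q => ((z.1, t₀, z.2) : ℝ × ℝ × Q))
      (hsmooth z.1 hz.1 t₀ ht₀ z.2)
      (contMDiffAt_fst.prodMk (contMDiffAt_const.prodMk contMDiffAt_snd))).contMDiffWithinAt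
  set Ψ := evolutionCoordinates hI ht₀ ψ hcomp hb.continuousOn hf.continuousOn with hΨdef
  have hΨ : ContMDiffOn (𝓘(ℝ, ℝ).prod (𝓡 d)) (𝓘(ℝ, ℝ).prod (𝓡 d))
      ((k - 1 : ℕ∞) : WithTop ℕ∞) Ψ Ψ.source := contMDiffOn_fst.prodMk hb
  have hΨ' : ContMDiffOn (𝓘(ℝ, ℝ).prod (𝓡 d)) (𝓘(ℝ, ℝ).prod (𝓡 d))
      ((k - 1 : ℕ∞) : WithTop ℕ∞) Ψ.symm Ψ.target := contMDiffOn_fst.prodMk hf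
  have hR := isRosen_rosenCoordinates (D := D) (l := k) (u := u) hn hnr hnk hΨ hΨ'
    (fun z _ => rfl) hu.contMDiffOn (fun z hz => hu.equation z.1 hz.1 z.2) (by
      rintro ⟨t, q⟩ ⟨ht, -⟩
      have hγt : γ t q t = q := (hψ t ht q).2
      have h1 := mfderiv_evolutionCoordinates (Ψ := Ψ) (γ := γ t q) (q' := ψ t₀ t q)
        (t := t) (Z := D.characteristicField u t (γ t q t))
        ((hΨ.contMDiffAt (Ψ.open_source.mem_nhds
          (show (t, γ t q t) ∈ I ×ˢ univ from ⟨ht, trivial⟩))).mdifferentiableAt hn0)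
        ((hψ t ht q).1 t ht) (by
          filter_upwards [hI.mem_nhds ht] with s hs
          exact Prod.ext rfl (evolution_comp hI hIc hn hX hψ ht₀ ht hs q))
      rw [hγt] at h1
      exact h1)
  -- The manifold `Q'` is `Q` itself: a characteristic is labelled by its position at `t₀`.
  refine ⟨Q, inferInstance, inferInstance, inferInstance, hman, _, _, ?_, ?_, hR⟩
  · ext x
    exact ⟨fun hx => hx.1, fun hx => ⟨hx, trivial⟩⟩
  · ext x
    exact ⟨fun hx => hx.1, fun hx => ⟨hx, trivial⟩⟩

end BrinkmannData

end RosenOfHamiltonJacobi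

/-! ### Rosen coordinates near a point. -/

section LocalRosen

open Set Filter Topology

namespace BrinkmannData

/-- Rosen coordinates exist near every point. -/
theorem exists_isRosen {d : ℕ} {Q : Type*} [TopologicalSpace Q]
    [ChartedSpace (EuclideanSpace ℝ (Fin d)) Q] [IsManifold (𝓡 d) 1 Q] {r : ℕ∞}
    [IsManifold (𝓡 d) ((r : WithTop ℕ∞) + 1) Q] (hr : 2 ≤ r) (D : BrinkmannData d Q r)
    (p : ℝ × Q × ℝ) :
    ∃ (Φ : OpenPartialHomeomorph (ℝ × Q × ℝ) (ℝ × EuclideanSpace ℝ (Fin d) × ℝ))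
      (a' : TimeBilin d (EuclideanSpace ℝ (Fin d))),
      p ∈ Φ.source ∧ D.IsRosen (r - 1) r Φ a' := by
  obtain ⟨t₀, q₁, y₀⟩ := p
  have hr1 : 1 ≤ r := le_trans (by norm_num) hr
  have hn : 1 ≤ r - 1 := ENat.le_sub_of_add_le_left ENat.one_ne_top
    (by simpa [one_add_one_eq_two] using hr)
  have hrr : ((r - 1 : ℕ∞) : WithTop ℕ∞) + 1 = (r : WithTop ℕ∞) := by
    exact_mod_cast tsub_add_cancel_of_le hr1
  have hnr : ((r - 1 : ℕ∞) : WithTop ℕ∞) ≤ (r : WithTop ℕ∞) := by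
    exact_mod_cast (tsub_le_self : r - 1 ≤ r)
  have hn0 : ((r - 1 : ℕ∞) : WithTop ℕ∞) ≠ 0 := by
    have : r - 1 ≠ 0 := (zero_lt_one.trans_le hn).ne'
    exact_mod_cast this
  have hr0 : (r : WithTop ℕ∞) ≠ 0 := by
    have : r ≠ 0 := (zero_lt_one.trans_le hr1).ne'
    exact_mod_cast this
  have hmanr : IsManifold (𝓡 d) (r : WithTop ℕ∞) Q :=
    IsManifold.of_le (n := (r : WithTop ℕ∞) + 1) le_self_add
  have hman : IsManifold (𝓡 d) ((r - 1 : ℕ∞) : WithTop ℕ∞) Q :=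
    IsManifold.of_le (n := (r : WithTop ℕ∞)) hnr
  set c := chartAt (EuclideanSpace ℝ (Fin d)) q₁ with hc
  set O : Set (ℝ × EuclideanSpace ℝ (Fin d)) := univ ×ˢ c.target with hO
  set W : Set (ℝ × EuclideanSpace ℝ (Fin d) × (EuclideanSpace ℝ (Fin d) →L[ℝ] ℝ)) :=
    {w | (w.1, w.2.1) ∈ O} with hW
  have hWo : IsOpen W := (isOpen_univ.prod c.open_target).preimage (by fun_prop)
  have hA := D.contDiffOn_chartMetric q₁
  have hb := D.contDiffOn_chartForm q₁
  have hV := D.contDiffOn_chartPotential q₁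
  have hpos : ∀ z ∈ O, ∀ v, v ≠ 0 → 0 < D.chartMetric q₁ z v v :=
    fun _ hz => D.chartMetric_pos hz.2
  have hH := contDiffOn_legendreHamiltonian hA hb hV hpos
  have hv := (contDiffOn_legendreVelocity hA hb hpos).of_le hnr
  -- The method of characteristics in the chart with `m = r - 1`: the straightening `Ψ₁` is
  -- `C^(r-1)` and the solution `v` is `C^r`.
  obtain ⟨Ψ₁, v, P, hsrc, hΨ₁, hΨ₁', hvr, hz⟩ := exists_local_hamiltonJacobi hn hWo (hrr ▸ hH) hv
    (fun w hw π => fderiv_legendreHamiltonian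
      ((hH.contDiffAt (hWo.mem_nhds hw)).differentiableAt hr0)
      (D.chartMetric_symm q₁ _) (hpos _ hw) π) (t₀ := t₀) (x₀ := c q₁)
    ⟨trivial, c.map_source (mem_chart_source _ _)⟩
  rw [hrr] at hvr
  set Ψ : OpenPartialHomeomorph (ℝ × Q) (ℝ × EuclideanSpace ℝ (Fin d)) :=
    ((OpenPartialHomeomorph.refl ℝ).prod c).trans Ψ₁ with hΨdef
  have hmem : ∀ z ∈ Ψ.source, z.2 ∈ c.source ∧ (z.1, c z.2) ∈ Ψ₁.source := fun z hz => by
    rw [hΨdef, OpenPartialHomeomorph.trans_source] at hz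
    exact ⟨hz.1.2, hz.2⟩
  have hc₁ : ContMDiffOn (𝓘(ℝ, ℝ).prod (𝓡 d)) 𝓘(ℝ, ℝ × EuclideanSpace ℝ (Fin d))
      (r : WithTop ℕ∞) (fun z : ℝ × Q => (z.1, c z.2)) Ψ.source :=
    contMDiffOn_fst.prodMk_space ((contMDiffOn_chart (I := 𝓡 d) (x := q₁)).comp contMDiffOn_snd
      (fun z hz => (hmem z hz).1))
  have hΨ : ContMDiffOn (𝓘(ℝ, ℝ).prod (𝓡 d)) (𝓘(ℝ, ℝ).prod (𝓡 d))
      ((r - 1 : ℕ∞) : WithTop ℕ∞) Ψ Ψ.source := by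
    have h1 := hΨ₁.contMDiffOn.comp (hc₁.of_le hnr) (fun z hz => (hmem z hz).2)
    rw [modelWithCornersSelf_prod, ← chartedSpaceSelf_prod] at h1
    exact h1
  have hΨ' : ContMDiffOn (𝓘(ℝ, ℝ).prod (𝓡 d)) (𝓘(ℝ, ℝ).prod (𝓡 d))
      ((r - 1 : ℕ∞) : WithTop ℕ∞) Ψ.symm Ψ.target := by
    have hsub : ∀ z ∈ Ψ.target, z ∈ Ψ₁.target ∧ (Ψ₁.symm z).2 ∈ c.target := fun z hz => by
      rw [hΨdef, OpenPartialHomeomorph.trans_target] at hz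
      exact ⟨hz.1, hz.2.2⟩
    have h1 := (hΨ₁'.mono (fun z hz => (hsub z hz).1)).fst.contMDiffOn
    have h2 := (contMDiffOn_chart_symm (I := 𝓡 d) (x := q₁)
      (n := ((r - 1 : ℕ∞) : WithTop ℕ∞))).comp
      (hΨ₁'.mono (fun z hz => (hsub z hz).1)).snd.contMDiffOn (fun z hz => (hsub z hz).2)
    have h3 := h1.prodMk h2
    rw [modelWithCornersSelf_prod, ← chartedSpaceSelf_prod] at h3
    exact h3
  have hu : ContMDiffOn (𝓘(ℝ, ℝ).prod (𝓡 d)) 𝓘(ℝ, ℝ) (r : WithTop ℕ∞)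
      (fun z : ℝ × Q => (fun t q => v (t, c q)) z.1 z.2) Ψ.source :=
    hvr.contMDiffOn.comp hc₁ (fun z hz => (hmem z hz).2)
  -- The momentum `P` found in the chart is the spatial differential of `v` transported to `Q`, so
  -- the chart versions of the Hamiltonian and velocity become the intrinsic ones.
  have hdq : ∀ t x, x ∈ c.target → (t, x) ∈ Ψ₁.source →
      HasDerivAt (fun s => v (s, c (c.symm x)))
        (-legendreHamiltonian (D.chartMetric q₁) (D.chartForm q₁) (D.chartPotential q₁)
          (t, x, P (t, x))) t ∧
      ∀ w, P (t, x) w = dq (d := d) (fun t q => v (t, c q)) t (c.symm x)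
        (chartSymmDeriv q₁ x w) := by
    intro t x hx hsx
    have h1 := (hz (t, x) hsx).2.2.1
    have h2 := hasMFDerivAt_of_hasFDerivAt_chart (u := v) (t := t) (c.map_target hx)
      (by rw [c.right_inv hx]; exact h1)
    obtain ⟨h3, h4⟩ := hasDerivAt_dq_of_hasMFDerivAt (u := fun t q => v (t, c q)) h2
    constructor
    · refine h3.congr_deriv ?_
      have h5 : ∀ C : EuclideanSpace ℝ (Fin d) →L[ℝ] EuclideanSpace ℝ (Fin d),
          (canonicalForm (P (t, x)) (legendreHamiltonian (D.chartMetric q₁) (D.chartForm q₁)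
            (D.chartPotential q₁) (t, x, P (t, x))) ∘L
            (ContinuousLinearMap.fst ℝ ℝ (EuclideanSpace ℝ (Fin d))).prod
            (C ∘L ContinuousLinearMap.snd ℝ ℝ (EuclideanSpace ℝ (Fin d)))) (1, 0) =
          -legendreHamiltonian (D.chartMetric q₁) (D.chartForm q₁) (D.chartPotential q₁)
            (t, x, P (t, x)) := fun C => by simp
      exact h5 _
    · intro w
      refine Eq.trans ?_ (h4 _).symm
      have h5 := mfderiv_chart_chartSymmDeriv hx w
      have h6 : ∀ C : EuclideanSpace ℝ (Fin d) →L[ℝ] EuclideanSpace ℝ (Fin d),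
          C (chartSymmDeriv q₁ x w) = w → P (t, x) w = (canonicalForm (P (t, x))
          (legendreHamiltonian (D.chartMetric q₁) (D.chartForm q₁) (D.chartPotential q₁)
          (t, x, P (t, x))) ∘L (ContinuousLinearMap.fst ℝ ℝ (EuclideanSpace ℝ (Fin d))).prod
          (C ∘L ContinuousLinearMap.snd ℝ ℝ (EuclideanSpace ℝ (Fin d))))
          (0, chartSymmDeriv q₁ x w) := fun C hC => by simp [hC]
      exact h6 _ h5
  have hpt : ∀ z ∈ Ψ.source, ∃ t x, x ∈ c.target ∧ (t, x) ∈ Ψ₁.source ∧ z = (t, c.symm x) :=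
    fun z hz => ⟨z.1, c z.2, c.map_source (hmem z hz).1, (hmem z hz).2,
      Prod.ext rfl (c.left_inv (hmem z hz).1).symm⟩
  refine ⟨_, _, ?_, isRosen_rosenCoordinates (D := D) (l := r) (u := fun t q => v (t, c q)) hn
    (tsub_le_self.trans le_self_add) tsub_le_self hΨ hΨ' (fun z hz' => (hz _ (hmem z hz').2).1)
    hu ?_ ?_⟩
  · change (t₀, q₁) ∈ Ψ.source
    rw [hΨdef, OpenPartialHomeomorph.trans_source]
    exact ⟨⟨trivial, mem_chart_source _ _⟩, hsrc⟩
  · intro z hz'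
    obtain ⟨t, x, hx, hsx, rfl⟩ := hpt z hz'
    obtain ⟨h1, h2⟩ := hdq t x hx hsx
    rw [D.legendreHamiltonian_chart hx h2, h1.deriv]
    exact neg_add_cancel _
  · intro z hz'
    obtain ⟨t, x, hx, hsx, rfl⟩ := hpt z hz'
    obtain ⟨-, h2⟩ := hdq t x hx hsx
    have h3 := D.chartSymmDeriv_legendreVelocity (t := t) hx h2
    have h4 : DifferentiableAt ℝ Ψ₁ (t, x) :=
      (hΨ₁.contDiffAt (Ψ₁.open_source.mem_nhds hsx)).differentiableAt hn0
    have h5 := (hasMFDerivAt_of_hasFDerivAt_chart (u := Ψ₁) (t := t) (L := fderiv ℝ Ψ₁ (t, x))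
      (c.map_target hx) (by rw [c.right_inv hx]; exact h4.hasFDerivAt)).mfderiv
    rw [modelWithCornersSelf_prod, ← chartedSpaceSelf_prod] at h5
    have h6 := mfderiv_chart_chartSymmDeriv hx
      (legendreVelocity (D.chartMetric q₁) (D.chartForm q₁) (t, x, P (t, x)))
    have h7 : ∀ C : EuclideanSpace ℝ (Fin d) →L[ℝ] EuclideanSpace ℝ (Fin d), ∀ w,
        C w = legendreVelocity (D.chartMetric q₁) (D.chartForm q₁) (t, x, P (t, x)) →
        (fderiv ℝ Ψ₁ (t, x) ∘L (ContinuousLinearMap.fst ℝ ℝ (EuclideanSpace ℝ (Fin d))).prod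
          (C ∘L ContinuousLinearMap.snd ℝ ℝ (EuclideanSpace ℝ (Fin d)))) (1, w) = (1, 0) :=
      fun C w hC => by
        simp only [ContinuousLinearMap.comp_apply, ContinuousLinearMap.prod_apply,
          ContinuousLinearMap.coe_fst', ContinuousLinearMap.coe_snd', hC]
        exact (hz (t, x) hsx).2.2.2
    refine (congrArg (fun L : ℝ × EuclideanSpace ℝ (Fin d) →L[ℝ] ℝ × EuclideanSpace ℝ (Fin d) =>
      L (1, D.sharp t (c.symm x) (dq (fun t q => v (t, c q)) t (c.symm x) - D.b t (c.symm x))))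
      h5).trans ?_
    exact h7 _ _ ((congrArg _ h3.symm).trans h6)

end BrinkmannData

end LocalRosen

/-! ### The main theorem. -/

theorem mainTheorem7 {d : ℕ} {Q : Type u} [TopologicalSpace Q] [T2Space Q]
    [ChartedSpace (EuclideanSpace ℝ (Fin d)) Q] {r : ℕ∞} (hr : 2 ≤ r)
    [IsManifold (𝓡 d) 1 Q] [IsManifold (𝓡 d) ((r + 1 : ℕ∞) : WithTop ℕ∞) Q]
    (D : BrinkmannData d Q r) :
    -- Rosen coordinates near every point of the spacetime
    (∀ p : ℝ × Q × ℝ,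
      ∃ (Φ : OpenPartialHomeomorph (ℝ × Q × ℝ) (ℝ × EuclideanSpace ℝ (Fin d) × ℝ))
        (a' : TimeBilin d (EuclideanSpace ℝ (Fin d))),
        p ∈ Φ.source ∧ D.IsRosen (r - 1) r Φ a') ∧
    -- global Rosen coordinates
    ((∀ k : ℕ∞, 1 ≤ k → k ≤ r + 1 →
        D.HasRosen k k Set.univ → D.HasHJSolution k Set.univ) ∧
      (∀ k : ℕ∞, 2 ≤ k → k ≤ r + 1 →
        (D.HasRosen (k - 1) k Set.univ ↔ D.HasHJSolution k Set.univ))) ∧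
    -- Rosen coordinates that are local in time
    (∀ t₀ : ℝ,
      (∀ k : ℕ∞, 1 ≤ k → k ≤ r + 1 →
        TimeLocally t₀ (D.HasRosen k k) → TimeLocally t₀ (D.HasHJSolution k)) ∧
      (∀ k : ℕ∞, 2 ≤ k → k ≤ r + 1 →
        (TimeLocally t₀ (D.HasRosen (k - 1) k) ↔ TimeLocally t₀ (D.HasHJSolution k)))) := by
  have hman : IsManifold (𝓡 d) ((r : WithTop ℕ∞) + 1) Q := by
    exact_mod_cast (inferInstance : IsManifold (𝓡 d) ((r + 1 : ℕ∞) : WithTop ℕ∞) Q)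
  refine ⟨D.exists_isRosen hr, ⟨fun k hk _ h => h.hasHJSolution hk, fun k hk hkr =>
    -- In the global case any time can label the characteristics; `0` is chosen.
    ⟨fun h => h.hasHJSolution ?_, fun h => h.hasRosen hk hkr isOpen_univ Set.ordConnected_univ
      (Set.mem_univ 0)⟩⟩, fun t₀ => ⟨?_, fun k hk hkr => ⟨?_, ?_⟩⟩⟩
  · exact ENat.le_sub_of_add_le_left ENat.one_ne_top (by simpa [one_add_one_eq_two] using hk)
  · rintro k hk - ⟨I, hI, hIc, ht, h⟩
    exact ⟨I, hI, hIc, ht, h.hasHJSolution hk⟩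
  · rintro ⟨I, hI, hIc, ht, h⟩
    exact ⟨I, hI, hIc, ht, h.hasHJSolution
      (ENat.le_sub_of_add_le_left ENat.one_ne_top (by simpa [one_add_one_eq_two] using hk))⟩
  · rintro ⟨I, hI, hIc, ht, h⟩
    exact ⟨I, hI, hIc, ht, h.hasRosen hk hkr hI hIc ht⟩
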